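/- An $l$-space is a locally compact Hausdorff space in which every point has a basis of compact open neighbourhoods; an $l$-group is a topological group that is an $l$-space. Let $G$ be an $l$-group that is countable at infinity (a countable union of compact subsets), acting continuously on an $l$-space $X$, and let $Z\subset X$ be a $G$-invariant closed subset. Assume that the action of $G$ on $Z$ is constructible, i.e. its graph $\{(z,gz) : z\in Z,\ g\in G\}$ is a finite union of locally closed subsets of $Z\times Z$. Let $R$ be a commutative $\mathbb{C}$-algebra and let $L$ be a $G$-equivariant $R$-line bundle on $X$, i.e. a $G$-equivariant sheaf of $R$-modules on $X$ that is locally isomorphic to the sheaf of locally constant $R$-valued functions. For an invariant open subset $U\subset X$ let $\mathcal{S}(U,L)$ be the $R$-module of compactly supported sections of $L$ over $U$, with its natural $G$-action, and let $\mathcal{S}(U,L)_G$ be its module of $G$-coinvariants. For $z\in Z$ let $G_z\subset G$ be the stabilizer of $z$ and let $\chi_{L,z}:G_z\to R^*$ be the character by which $G_z$ acts on the fibre $L_z$. For a locally compact group $H$ let $\Delta_H:H\to\mathbb{R}_{>0}$ be the modular character, normalised by $\mu(Ah)=\Delta_H(h)\,\mu(A)$ for a left Haar measure $\mu$ on $H$.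 Let $H_i^{sm}(H,-)$ be the smooth homology of an $l$-group $H$: the left derived functors of the functor of $H$-coinvariants on the category of smooth $R$-linear representations of $H$. Suppose that for every $z\in Z$, $$H_i^{sm}\bigl(G_z,\ \chi_{L,z}\cdot \Delta_{G_z}/\Delta_G|_{G_z}\bigr)=0$$ for $i=0,1$ (respectively, for $i=0$), where the character stands for the free $R$-module of rank one on which $G_z$ acts through it. Then the natural map, given by extension of sections by zero, $$\mathcal{S}(X\setminus Z,L)_G\longrightarrow \mathcal{S}(X,L)_G$$ is an isomorphism (respectively, surjective). -/

import Mathlib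

open CategoryTheory Limits Topology Pointwise

universe u v w t

set_option linter.unusedSectionVars false

noncomputable section

namespace LSpaceCoinv

/-! An `l`-space is a locally compact Hausdorff totally disconnected space; equivalently, it is
Hausdorff, locally compact, and every point has a basis of compact open neighbourhoods. An `l`-group
is a topological group that is an `l`-space. -/

/-- In an `l`-group every neighbourhood of `1` contains a compact open subgroup. -/
theorem exists_compact_open_subgroup {G : Type v} [Group G] [TopologicalSpace G]
    [IsTopologicalGroup G] [LocallyCompactSpace G] [T2Space G] [TotallyDisconnectedSpace G]
    {V : Set G} (hV : V ∈ 𝓝 (1 : G)) :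
    ∃ K : Subgroup G, IsOpen (K : Set G) ∧ IsCompact (K : Set G) ∧ (K : Set G) ⊆ V := by
  obtain ⟨C, hCn, hCV, hC⟩ := LocallyCompactSpace.local_compact_nhds (1 : G) V hV
  obtain ⟨W, hW, h1W, hWC⟩ :=
    (loc_compact_Haus_tot_disc_of_zero_dim (H := G)).mem_nhds_iff.1 hCn
  have hWcl : IsClopen W := hW
  have hWc : IsCompact W := hC.of_isClosed_subset hWcl.1 hWC
  obtain ⟨T, hT, hWT⟩ := compact_open_separated_mul_right hWc hWcl.2 subset_rfl
  let K : Subgroup G :=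
    { carrier := {g | ∀ x ∈ W, x * g ∈ W ∧ x * g⁻¹ ∈ W}
      mul_mem' := by
        intro a b ha hb x hx
        refine ⟨?_, ?_⟩
        · rw [← mul_assoc]; exact (hb _ (ha x hx).1).1
        · rw [mul_inv_rev, ← mul_assoc]; exact (ha _ (hb x hx).2).2
      one_mem' := by intro x hx; simpa using hx
      inv_mem' := by
        intro a ha x hx
        exact ⟨(ha x hx).2, by simpa using (ha x hx).1⟩ }
  have hKW : (K : Set G) ⊆ W := fun g hg => by simpa using (hg 1 h1W).1
  have hKo : IsOpen (K : Set G) := by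
    refine K.isOpen_of_mem_nhds (g := 1) (Filter.mem_of_superset
      (Filter.inter_mem hT (inv_mem_nhds_one G hT)) ?_)
    intro g hg x hx
    exact ⟨hWT (Set.mul_mem_mul hx hg.1), hWT (Set.mul_mem_mul hx hg.2)⟩
  exact ⟨K, hKo, hWc.of_isClosed_subset (K.isClosed_of_isOpen hKo) hKW, (hKW.trans hWC).trans hCV⟩

/-- The smooth representations: every vector has an open stabilizer. -/
def isSmooth (R : Type u) (G : Type v) [CommRing R] [Group G] [TopologicalSpace G] :
    ObjectProperty (Rep.{max u v} R G) :=
  fun M => ∀ m : M.V, IsOpen {g : G | M.ρ g m = m}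

section

variable (R : Type u) (G : Type v) [CommRing R] [Group G] [TopologicalSpace G]

instance : (isSmooth R G).IsClosedUnderSubobjects where
  prop_of_mono {X Y} f hf hY m := by
    have h := hY (f.hom m)
    convert h using 3 with g
    rw [← Rep.hom_comm_apply]
    exact ((Rep.mono_iff_injective f).1 hf).eq_iff.symm

theorem isOpen_stab_of_le [IsTopologicalGroup G] (M : Rep.{max u v} R G) (m : M.V) (s : Set G)
    (hs : s ∈ 𝓝 (1 : G)) (h : ∀ g ∈ s, M.ρ g m = m) : IsOpen {g : G | M.ρ g m = m} := by
  let S : Subgroup G :=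
    { carrier := {g : G | M.ρ g m = m}
      mul_mem' := by
        intro a b ha hb
        change M.ρ (a * b) m = m
        rw [map_mul, Module.End.mul_apply, hb, ha]
      one_mem' := by simp
      inv_mem' := by
        intro a ha
        change M.ρ a⁻¹ m = m
        conv_lhs => rw [← (show M.ρ a m = m from ha)]
        simp }
  exact S.isOpen_of_mem_nhds (g := 1) (Filter.mem_of_superset hs h)

variable [IsTopologicalGroup G]

instance : (isSmooth R G).IsClosedUnderQuotients where
  prop_of_epi {X Y} f hf hX m := by
    obtain ⟨x, rfl⟩ := (Rep.epi_iff_surjective f).1 hf m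
    refine isOpen_stab_of_le R G Y _ _ ((hX x).mem_nhds (by simp)) ?_
    intro g hg
    rw [← Rep.hom_comm_apply, hg]

instance : (isSmooth R G).ContainsZero where
  exists_zero := ⟨Rep.of (Representation.trivial R G PUnit.{max u v + 1}),
    (Rep.isZero_iff R G _).2 (inferInstanceAs (Subsingleton PUnit)),
    fun m => by simp⟩

instance : (isSmooth R G).IsClosedUnderBinaryProducts where
  limitsOfShape_le := by
    rintro X ⟨p⟩ m
    have key : ∀ j, IsOpen {g : G | (p.diag.obj j).ρ g ((p.π.app j).hom m) = (p.π.app j).hom m} :=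
      fun j => p.prop_diag_obj j _
    refine isOpen_stab_of_le R G X _ _
      (Filter.inter_mem ((key ⟨WalkingPair.left⟩).mem_nhds (by simp))
        ((key ⟨WalkingPair.right⟩).mem_nhds (by simp))) ?_
    rintro g ⟨h1, h2⟩
    refine Concrete.isLimit_ext (p.diag ⋙ forget₂ (Rep.{max u v} R G) (ModuleCat.{max u v} R))
      (isLimitOfPreserves _ p.isLimit) _ _ ?_
    rintro ⟨⟨⟩⟩
    · exact (Rep.hom_comm_apply _ _ _).trans h1
    · exact (Rep.hom_comm_apply _ _ _).trans h2

instance : (isSmooth R G).IsClosedUnderFiniteProducts :=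
  ObjectProperty.IsClosedUnderFiniteProducts.mk'

/-- The category `M(G; R)` of smooth representations of `G` on `R`-modules. -/
abbrev SmoothRep := (isSmooth R G).FullSubcategory

instance : Abelian (SmoothRep R G) := inferInstance

theorem smoothRep_epi {X Y : SmoothRep R G} (f : X ⟶ Y) [Epi f] :
    Function.Surjective f.hom.hom := by
  have := (isSmooth R G).preservesEpimorphisms_ι_of_isNormalMonoCategory
  exact (Rep.epi_iff_surjective _).1 (inferInstanceAs (Epi ((isSmooth R G).ι.map f)))

theorem smoothRep_epi_of {X Y : SmoothRep R G} (f : X ⟶ Y)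
    (h : Function.Surjective f.hom.hom) : Epi f :=
  (isSmooth R G).ι.epi_of_epi_map ((Rep.epi_iff_surjective _).2 h)


/-- The representation `⨁ₘ R[G / K m]`. -/
abbrev permRep {I : Type max u v} (K : I → Subgroup G) : Rep.{max u v} R G :=
  Rep.of (X := (Σ i, G ⧸ K i) →₀ R)
    { toFun := fun g => Finsupp.lmapDomain R R (g • ·)
      map_one' := by ext; simp
      map_mul' := fun g h => by ext; simp [mul_smul] }

theorem permRep_smooth {I : Type max u v} (K : I → Subgroup G)
    (hK : ∀ i, IsOpen (K i : Set G)) : isSmooth R G (permRep R G K) := by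
  intro (m : (Σ i, G ⧸ K i) →₀ R)
  have hst : ∀ s : Σ i, G ⧸ K i, IsOpen {g : G | g • s = s} := by
    rintro ⟨i, q⟩
    obtain ⟨a, rfl⟩ := QuotientGroup.mk_surjective q
    have : {g : G | g • (⟨i, (a : G ⧸ K i)⟩ : Σ i, G ⧸ K i) = ⟨i, (a : G ⧸ K i)⟩}
        = (fun g => a⁻¹ * g⁻¹ * a) ⁻¹' (K i : Set G) := by
      ext g
      have h : g • (⟨i, (a : G ⧸ K i)⟩ : Σ i, G ⧸ K i) = ⟨i, ((g * a : G) : G ⧸ K i)⟩ := rfl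
      change _ = _ ↔ _ ∈ K i
      rw [h, Sigma.mk.injEq, heq_eq_eq, QuotientGroup.eq, mul_inv_rev]
      simp
    rw [this]
    exact (hK i).preimage (by fun_prop)
  refine isOpen_stab_of_le R G (permRep R G K) m (⋂ s ∈ m.support, {g : G | g • s = s})
    ((Filter.biInter_finset_mem m.support).2 fun s _ => (hst s).mem_nhds (by simp)) ?_
  intro g hg
  simp only [Set.mem_iInter, Set.mem_ofPred_eq] at hg
  change Finsupp.lmapDomain R R (g • ·) m = m
  rw [Finsupp.lmapDomain_apply]
  conv_rhs => rw [← Finsupp.mapDomain_id (v := m)]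
  exact Finsupp.mapDomain_congr hg

theorem exists_fixed_lift [Algebra ℂ R] {A B : SmoothRep R G} (e : A ⟶ B)
    (he : Function.Surjective e.hom.hom) (K : Subgroup G) (hK : IsCompact (K : Set G))
    (b : B.obj.V) (hb : ∀ k ∈ K, B.obj.ρ k b = b) :
    ∃ a : A.obj.V, e.hom.hom a = b ∧ ∀ k ∈ K, A.obj.ρ k a = a := by
  classical
  obtain ⟨a, rfl⟩ := he b
  have hfin : ((fun k => A.obj.ρ k a) '' (K : Set G)).Finite := by
    let _ : TopologicalSpace A.obj.V := ⊥
    have : DiscreteTopology A.obj.V := ⟨rfl⟩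
    refine isCompact_iff_finite.1 (hK.image ?_)
    refine continuous_discrete_rng.2 fun b => ?_
    rw [isOpen_iff_mem_nhds]
    rintro g rfl
    have h1 := A.property a
    have h2 : (fun x => g⁻¹ * x) ⁻¹' {g : G | A.obj.ρ g a = a} ∈ 𝓝 g :=
      (h1.preimage (by fun_prop)).mem_nhds (by simp)
    refine Filter.mem_of_superset h2 fun x hx => ?_
    have hx' : A.obj.ρ (g⁻¹ * x) a = a := hx
    change A.obj.ρ x a = A.obj.ρ g a
    conv_rhs => rw [← hx']
    rw [map_mul, Module.End.mul_apply, Representation.self_inv_apply]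
  let O : Finset A.obj.V := hfin.toFinset
  have hO : ∀ x, x ∈ O ↔ ∃ k ∈ K, A.obj.ρ k a = x := by intro x; simp [O]
  have hne : (O.card : ℂ) ≠ 0 := by
    have : a ∈ O := (hO a).2 ⟨1, K.one_mem, by simp⟩
    exact_mod_cast (Finset.card_pos.2 ⟨a, this⟩).ne'
  refine ⟨algebraMap ℂ R ((O.card : ℂ)⁻¹) • ∑ x ∈ O, x, ?_, ?_⟩
  · rw [map_smul, map_sum]
    have : ∀ x ∈ O, e.hom.hom x = e.hom.hom a := by
      intro x hx
      obtain ⟨k, hk, rfl⟩ := (hO x).1 hx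
      rw [Rep.hom_comm_apply, hb k hk]
    rw [Finset.sum_congr rfl this, Finset.sum_const, ← Nat.cast_smul_eq_nsmul R, smul_smul,
      ← map_natCast (algebraMap ℂ R), ← map_mul, inv_mul_cancel₀ hne, map_one, one_smul]
  · intro k hk
    rw [map_smul, map_sum]
    congr 1
    refine Finset.sum_bij (fun x _ => A.obj.ρ k x) ?_ ?_ ?_ (fun _ _ => rfl)
    · intro x hx
      obtain ⟨l, hl, rfl⟩ := (hO x).1 hx
      exact (hO _).2 ⟨k * l, K.mul_mem hk hl, by rw [map_mul]; rfl⟩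
    · intro x _ y _ h
      simpa using congrArg (A.obj.ρ k⁻¹) h
    · intro x hx
      obtain ⟨l, hl, rfl⟩ := (hO x).1 hx
      exact ⟨A.obj.ρ (k⁻¹ * l) a, (hO _).2 ⟨k⁻¹ * l, K.mul_mem (K.inv_mem hk) hl, rfl⟩, by
        rw [map_mul]; simp⟩

variable {R G} in
/-- The morphism out of `⨁ₘ R[G / K m]` given by a family of `K m`-fixed vectors. -/
def permDesc {I : Type max u v} (K : I → Subgroup G) (A : Rep.{max u v} R G) (a : I → A.V)
    (ha : ∀ i, ∀ k ∈ K i, A.ρ k (a i) = a i) : permRep R G K ⟶ A :=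
  let f : (Σ i, G ⧸ K i) → A.V := fun s => Quotient.liftOn' s.2 (fun g => A.ρ g (a s.1))
    (fun x y h => by
      rw [QuotientGroup.leftRel_apply] at h
      have := ha s.1 _ h
      change A.ρ x (a s.1) = A.ρ y (a s.1)
      conv_lhs => rw [← this]
      rw [map_mul, Module.End.mul_apply, Representation.self_inv_apply])
  Rep.ofHom ⟨Finsupp.linearCombination R f, fun g => by
    ext ⟨i, q⟩
    obtain ⟨x, rfl⟩ := QuotientGroup.mk_surjective q
    simp [f]⟩

variable {R G} in
theorem permDesc_single {I : Type max u v} (K : I → Subgroup G) (A : Rep.{max u v} R G)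
    (a : I → A.V) (ha : ∀ i, ∀ k ∈ K i, A.ρ k (a i) = a i) (i : I) (x : G) :
    (permDesc K A a ha).hom (Finsupp.single (⟨i, (x : G ⧸ K i)⟩ : Σ i, G ⧸ K i) (1 : R)) =
      A.ρ x (a i) := by
  have : (permDesc K A a ha).hom (Finsupp.single (⟨i, (x : G ⧸ K i)⟩ : Σ i, G ⧸ K i) (1 : R)) =
    (1 : R) • A.ρ x (a i) := Finsupp.linearCombination_single _ _ _
  rw [this, one_smul]

variable {R G} in
theorem permRep_hom_ext {I : Type max u v} (K : I → Subgroup G) (A : Rep.{max u v} R G)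
    (f g : permRep R G K ⟶ A)
    (h : ∀ i, f.hom (Finsupp.single (⟨i, ((1 : G) : G ⧸ K i)⟩ : Σ i, G ⧸ K i) (1 : R)) =
      g.hom (Finsupp.single (⟨i, ((1 : G) : G ⧸ K i)⟩ : Σ i, G ⧸ K i) (1 : R))) : f = g := by
  refine Rep.hom_ext (Representation.IntertwiningMap.toLinearMap_injective _ _ ?_)
  refine Finsupp.lhom_ext' fun s => LinearMap.ext_ring ?_
  obtain ⟨i, q⟩ := s
  obtain ⟨x, rfl⟩ := QuotientGroup.mk_surjective q
  have hx : (permRep R G K).ρ x (Finsupp.single (⟨i, ((1 : G) : G ⧸ K i)⟩ : Σ i, G ⧸ K i) (1 : R))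
      = Finsupp.single (⟨i, (x : G ⧸ K i)⟩ : Σ i, G ⧸ K i) (1 : R) := by
    refine Finsupp.mapDomain_single.trans ?_
    congr 1
    change (⟨i, ((x * 1 : G) : G ⧸ K i)⟩ : Σ i, G ⧸ K i) = _
    rw [mul_one]
  change f.hom (Finsupp.single _ _) = g.hom (Finsupp.single _ _)
  rw [← hx, Rep.hom_comm_apply, Rep.hom_comm_apply, h]

instance [LocallyCompactSpace G] [T2Space G] [TotallyDisconnectedSpace G] [Algebra ℂ R] :
    EnoughProjectives (SmoothRep R G) where
  presentation M := by
    have h : ∀ m : M.obj.V, ∃ K : Subgroup G, IsOpen (K : Set G) ∧ IsCompact (K : Set G) ∧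
        (K : Set G) ⊆ {g | M.obj.ρ g m = m} := fun m =>
      exists_compact_open_subgroup ((M.property m).mem_nhds (by simp))
    choose K hKo hKc hKm using h
    let P : SmoothRep R G := ⟨permRep R G K, permRep_smooth R G K hKo⟩
    let π : P ⟶ M := ObjectProperty.homMk (permDesc K M.obj id hKm)
    have hπ : Epi π := smoothRep_epi_of R G π fun m =>
      ⟨_, (permDesc_single K M.obj id hKm m 1).trans (by simp)⟩
    have hP : Projective P := by
      constructor
      intro A B f e he
      have hf : ∀ m : M.obj.V, ∃ a : A.obj.V, e.hom.hom a
          = f.hom.hom (Finsupp.single (⟨m, ((1 : G) : G ⧸ K m)⟩ : Σ i, G ⧸ K i) (1 : R)) ∧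
          ∀ k ∈ K m, A.obj.ρ k a = a := by
        intro m
        refine exists_fixed_lift R G e (smoothRep_epi R G e) (K m) (hKc m) _ ?_
        intro k hk
        rw [← Rep.hom_comm_apply]
        congr 1
        refine Finsupp.mapDomain_single.trans ?_
        congr 1
        change (⟨m, ((k * 1 : G) : G ⧸ K m)⟩ : Σ i, G ⧸ K i) = _
        rw [mul_one]
        congr 1
        exact QuotientGroup.eq.2 (by simpa using hk)
      choose a ha1 ha2 using hf
      refine Exists.intro (ObjectProperty.homMk (permDesc K A.obj a ha2) : P ⟶ A) ?_
      refine ObjectProperty.hom_ext _ (permRep_hom_ext K B.obj _ _ fun m => ?_)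
      refine Eq.trans ?_ (ha1 m)
      refine congrArg e.hom.hom ((permDesc_single K A.obj a ha2 m 1).trans (by simp))
    exact ⟨{ p := P, f := π, projective := hP, epi := hπ }⟩

/-- The functor of coinvariants on smooth representations. -/
def smoothCoinvariants : SmoothRep R G ⥤ ModuleCat.{max u v} R :=
  (isSmooth R G).ι ⋙ Rep.coinvariantsFunctor R G

instance : (smoothCoinvariants R G).Additive where
  map_add := (Rep.coinvariantsFunctor R G).map_add

/-- Smooth homology `H_i^{sm}(G, -)`: the left derived functors of coinvariants on the category of
smooth representations of the `l`-group `G` (with coefficients in a `ℂ`-algebra `R`). -/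
def smoothHomology [LocallyCompactSpace G] [T2Space G] [TotallyDisconnectedSpace G] [Algebra ℂ R]
    (i : ℕ) : SmoothRep R G ⥤ ModuleCat.{max u v} R :=
  (smoothCoinvariants R G).leftDerived i

end


section Characters

variable {R : Type u} {H : Type v} [CommRing R] [Group H] [TopologicalSpace H]

/-- The smooth representation `R_χ`: the module `R` (lifted to a larger universe) on which `H` acts
through a locally constant character `χ`. -/
def charRep (χ : H →* R) (hχ : ∀ᶠ h in 𝓝 (1 : H), χ h = 1) [IsTopologicalGroup H] :
    SmoothRep R H where
  obj := Rep.of (X := ULift.{v} R)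
    { toFun := fun h => χ h • LinearMap.id
      map_one' := by ext; simp
      map_mul' := fun g h => by
        refine LinearMap.ext fun m => ?_
        change χ (g * h) • m = χ g • χ h • m
        rw [map_mul, mul_smul] }
  property := fun m => by
    refine isOpen_stab_of_le R H _ m _ hχ fun g hg => ?_
    have hg' : χ g = 1 := hg
    change χ g • m = m
    rw [hg']
    exact one_smul R (m : ULift.{v} R)

variable (H) in
/-- The modular character `Δ_H`, normalised by `μ (A g) = Δ_H(g) μ(A)` for a left Haar measure `μ`;
for the points of a linear algebraic group it is the absolute value of the action on the top
exterior power of the dual of the Lie algebra. Mathlib's character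
`modularCharacterFun g = μ (A g⁻¹) / μ A` is the inverse of this one. -/
def modulus [IsTopologicalGroup H] [LocallyCompactSpace H] : H →* NNReal where
  toFun h := (MeasureTheory.Measure.modularCharacterFun h)⁻¹
  map_one' := by rw [MeasureTheory.Measure.modularCharacterFun_map_one, inv_one]
  map_mul' g h := by rw [MeasureTheory.Measure.modularCharacterFun_map_mul, mul_inv]

theorem modulus_eq_one [IsTopologicalGroup H] [LocallyCompactSpace H] (K : Subgroup H)
    (hKo : IsOpen (K : Set H)) (hKc : IsCompact (K : Set H)) (k : H) (hk : k ∈ K) :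
    modulus H k = 1 := by
  borelize H
  have hcl : IsClosed (K : Set H) := K.isClosed_of_isOpen hKo
  have h := MeasureTheory.Measure.measure_isMulInvariant_eq_smul_of_isCompact_closure
    (MeasureTheory.Measure.map (· * k) MeasureTheory.Measure.haar)
    (MeasureTheory.Measure.haar (G := H)) (s := (K : Set H)) (by rwa [hcl.closure_eq])
  rw [← MeasureTheory.Measure.modularCharacterFun_eq_haarScalarFactor,
    MeasureTheory.Measure.map_apply (measurable_mul_const k) hcl.measurableSet] at h
  have hpre : (· * k) ⁻¹' (K : Set H) = (K : Set H) := by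
    ext x
    exact K.mul_mem_cancel_right hk
  rw [hpre] at h
  have h0 : MeasureTheory.Measure.haar (K : Set H) ≠ 0 :=
    (hKo.measure_pos _ ⟨1, K.one_mem⟩).ne'
  have h1 : MeasureTheory.Measure.haar (K : Set H) ≠ ⊤ := hKc.measure_lt_top.ne
  have h2 : (MeasureTheory.Measure.modularCharacterFun k : ENNReal) = 1 := by
    rw [ENNReal.smul_def, smul_eq_mul] at h
    exact (ENNReal.mul_eq_right h0 h1).1 h.symm
  change (MeasureTheory.Measure.modularCharacterFun k)⁻¹ = 1
  rw [show MeasureTheory.Measure.modularCharacterFun k = 1 by exact_mod_cast h2, inv_one]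

end Characters

/-- Local triviality of a family of `R`-modules whose total space carries a topology: near every
point there is a fibrewise `R`-linear homeomorphism over the base between the total space and
`U × R`, where `R` has the discrete topology. -/
def IsLocallyTrivial (R : Type u) {X : Type w} [CommRing R] [TopologicalSpace X] (E : X → Type t)
    [∀ x, AddCommGroup (E x)] [∀ x, Module R (E x)] [TopologicalSpace (Bundle.TotalSpace R E)] : Prop :=
  letI : TopologicalSpace R := ⊥
  ∀ x : X, ∃ e : Bundle.Trivialization R (Bundle.TotalSpace.proj : Bundle.TotalSpace R E → X), x ∈ e.baseSet ∧ e.IsLinear R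

/-- A `G`-equivariant `R`-line bundle on `X`, presented through its étalé space: the stalks `L_x`,
the topology of the étalé space (the disjoint union of the stalks) (local triviality says that the sheaf of its continuous
sections is locally isomorphic to the sheaf of locally constant `R`-valued functions), and the
equivariance isomorphism `p^* L ≅ a^* L` on `G × X`, which is the same as fibrewise linear maps
`act g : L_x → L_{g x}` that satisfy the cocycle condition and fit together to a continuous map
`G × L → L` of étalé spaces. -/
structure EquivariantLineBundle (R : Type u) (G : Type v) (X : Type w) [CommRing R] [Group G]
    [TopologicalSpace G] [TopologicalSpace X] [MulAction G X] where
  Fiber : X → Type t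
  [addCommGroup : ∀ x, AddCommGroup (Fiber x)]
  [module : ∀ x, Module R (Fiber x)]
  [topology : TopologicalSpace (Bundle.TotalSpace R Fiber)]
  locallyTrivial : IsLocallyTrivial R Fiber
  act : ∀ (g : G) {x y : X}, g • x = y → (Fiber x →ₗ[R] Fiber y)
  act_one : ∀ {x : X} (h : (1 : G) • x = x) (v : Fiber x), act 1 h v = v
  act_mul : ∀ (g g' : G) {x y z : X} (h' : g' • x = y) (h : g • y = z) (hh : (g * g') • x = z)
    (v : Fiber x), act (g * g') hh v = act g h (act g' h' v)
  continuous_act : Continuous fun p : G × Bundle.TotalSpace R Fiber =>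
    (⟨p.1 • p.2.proj, act p.1 rfl p.2.2⟩ : Bundle.TotalSpace R Fiber)

attribute [instance] EquivariantLineBundle.addCommGroup EquivariantLineBundle.module
  EquivariantLineBundle.topology

namespace EquivariantLineBundle

variable {R : Type u} {G : Type v} {X : Type w} [CommRing R] [Group G]
    [TopologicalSpace G] [TopologicalSpace X] [MulAction G X]
    (L : EquivariantLineBundle.{u, v, w, t} R G X)

theorem exists_chart (x₀ : X) : ∃ (U : Set X) (φ : ∀ x, L.Fiber x →ₗ[R] R), IsOpen U ∧ x₀ ∈ U ∧
    (∀ x ∈ U, Function.Bijective (φ x)) ∧ ∀ x ∈ U, ∀ v : L.Fiber x,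
      𝓝 (⟨x, v⟩ : Bundle.TotalSpace R L.Fiber) =
        Filter.comap Bundle.TotalSpace.proj (𝓝 x) ⊓ Filter.principal {p | φ p.proj p.2 = φ x v} := by
  let _ : TopologicalSpace R := ⊥
  have : DiscreteTopology R := ⟨rfl⟩
  obtain ⟨e, hx, he⟩ := L.locallyTrivial x₀
  refine ⟨e.baseSet, fun x => e.linearMapAt R x, e.open_baseSet, hx, ?_, ?_⟩
  · intro x hx
    change Function.Bijective (e.linearMapAt R x)
    rw [e.linearMapAt_def_of_mem hx]
    exact (e.linearEquivAt R x hx).bijective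
  · intro x hx v
    have hs : (⟨x, v⟩ : Bundle.TotalSpace R L.Fiber) ∈ e.source := e.mem_source.2 hx
    have hU : Bundle.TotalSpace.proj ⁻¹' e.baseSet ∈
        Filter.comap (Bundle.TotalSpace.proj : Bundle.TotalSpace R L.Fiber → X) (𝓝 x) :=
      Filter.preimage_mem_comap (e.open_baseSet.mem_nhds hx)
    have hφ : ∀ p : Bundle.TotalSpace R L.Fiber, p.proj ∈ e.baseSet →
        e.linearMapAt R p.proj p.2 = (e p).2 := fun p hp => by
      rw [e.linearMapAt_apply, if_pos hp]
    have hφx : e.linearMapAt R x v = (e ⟨x, v⟩).2 := hφ ⟨x, v⟩ hx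
    rw [e.nhds_eq_inf_comap hs, nhds_discrete R, Filter.comap_pure]
    refine le_antisymm (le_inf inf_le_left ?_) (le_inf inf_le_left ?_)
    all_goals
      rw [Filter.le_principal_iff]
      filter_upwards [Filter.mem_inf_of_left hU,
        Filter.mem_inf_of_right (Filter.mem_principal_self _)] with p hp hpe
    · exact (hφ p hp).trans (hpe.trans hφx.symm)
    · exact (hφ p hp).symm.trans (hpe.trans hφx)

theorem mk_act (g : G) {x y : X} (h : g • x = y) (v : L.Fiber x) :
    (⟨y, L.act g h v⟩ : Bundle.TotalSpace R L.Fiber) = ⟨g • x, L.act g rfl v⟩ := by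
  subst h; rfl

theorem act_inv_act (g : G) {x y : X} (h : g • x = y) (h' : g⁻¹ • y = x) (v : L.Fiber x) :
    L.act g⁻¹ h' (L.act g h v) = v := by
  rw [← L.act_mul g⁻¹ g h h' (by rw [inv_mul_cancel, one_smul])]
  have : ∀ (k : G) (hk : k = 1) (e : k • x = x), L.act k e v = v := by
    rintro k rfl e; exact L.act_one e v
  exact this _ (inv_mul_cancel g) _

theorem act_act_inv (g : G) {x y : X} (h : g • x = y) (h' : g⁻¹ • y = x) (v : L.Fiber y) :
    L.act g h (L.act g⁻¹ h' v) = v := by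
  rw [← L.act_mul g g⁻¹ h' h (by rw [mul_inv_cancel, one_smul])]
  have : ∀ (k : G) (hk : k = 1) (e : k • y = y), L.act k e v = v := by
    rintro k rfl e; exact L.act_one e v
  exact this _ (mul_inv_cancel g) _

theorem exists_fiberEquiv (z : X) : Nonempty (L.Fiber z ≃ₗ[R] R) := by
  obtain ⟨U, φ, -, hz, hφ, -⟩ := L.exists_chart z
  exact ⟨LinearEquiv.ofBijective (φ z) (hφ z hz)⟩

/-- The character `χ_{L,z}` by which the stabilizer of `z` acts on the fibre `L_z`, a free module of
rank one (see `act_eq_stabChar_smul`). -/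
def stabChar (z : X) : MulAction.stabilizer G z →* R :=
  let φ : L.Fiber z ≃ₗ[R] R := (L.exists_fiberEquiv z).some
  { toFun := fun g => φ (L.act g g.2 (φ.symm 1))
    map_one' := by
      have := L.act_one (x := z) (one_smul G z) (φ.symm 1)
      exact (congrArg φ this).trans (φ.apply_symm_apply 1)
    map_mul' := fun g h => by
      have h1 := L.act_mul g h (x := z) h.2 g.2 (g * h).2 (φ.symm 1)
      have h2 : L.act h h.2 (φ.symm 1) = φ (L.act h h.2 (φ.symm 1)) • φ.symm 1 := by
        rw [← map_smul, smul_eq_mul, mul_one, φ.symm_apply_apply]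
      refine (congrArg φ h1).trans ?_
      conv_lhs => rw [h2]
      rw [map_smul, map_smul, smul_eq_mul, mul_comm] }

theorem act_eq_stabChar_smul (z : X) (g : MulAction.stabilizer G z) (v : L.Fiber z) :
    L.act (g : G) g.2 v = L.stabChar z g • v := by
  let φ : L.Fiber z ≃ₗ[R] R := (L.exists_fiberEquiv z).some
  have hv : v = φ v • φ.symm 1 := by
    rw [← map_smul, smul_eq_mul, mul_one, φ.symm_apply_apply]
  apply φ.injective
  have : φ (L.act (g : G) g.2 v) = φ v * L.stabChar z g := by
    conv_lhs => rw [hv]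
    rw [map_smul, map_smul]
    rfl
  rw [this, map_smul, smul_eq_mul, mul_comm]

theorem eventually_stabChar (z : X) :
    ∀ᶠ g in 𝓝 (1 : MulAction.stabilizer G z), L.stabChar z g = 1 := by
  obtain ⟨U, φ, -, hz, hφ, hn⟩ := L.exists_chart z
  obtain ⟨v, hv⟩ := (hφ z hz).2 1
  let f : MulAction.stabilizer G z → Bundle.TotalSpace R L.Fiber :=
    fun g => ⟨(g : G) • z, L.act (g : G) rfl v⟩
  have h1 : Continuous f := L.continuous_act.comp (continuous_subtype_val.prodMk
        (continuous_const (y := (⟨z, v⟩ : Bundle.TotalSpace R L.Fiber))))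
  have hc : Filter.Tendsto f (𝓝 1) (𝓝 (f 1)) := h1.tendsto 1
  rw [show f 1 = ⟨z, v⟩ from (L.mk_act 1 (one_smul G z) v).symm.trans (by rw [L.act_one]),
    hn z hz v] at hc
  have h2 := hc (Filter.mem_inf_of_right (Filter.mem_principal_self _))
  filter_upwards [h2] with g hg
  have hg' : φ (g • z) (L.act (g : G) rfl v) = φ z v := hg
  have h3 : φ z (L.act (g : G) g.2 v) = φ (g • z) (L.act (g : G) rfl v) :=
    congrArg (fun p : Bundle.TotalSpace R L.Fiber => φ p.proj p.2) (L.mk_act (g : G) g.2 v)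
  rw [hg', act_eq_stabChar_smul, map_smul, hv, smul_eq_mul, mul_one] at h3
  exact h3

end EquivariantLineBundle

/-- The stabilizers of an action on a Hausdorff space are closed, hence locally compact. -/
instance {G : Type v} {X : Type w} [Group G] [TopologicalSpace G] [LocallyCompactSpace G]
    [TopologicalSpace X] [T2Space X] [MulAction G X] [ContinuousSMul G X] (z : X) :
    LocallyCompactSpace (MulAction.stabilizer G z) :=
  (show IsClosed {g : G | g • z = z} from
    isClosed_eq (by fun_prop) continuous_const).isClosedEmbedding_subtypeVal.locallyCompactSpace

theorem eventually_modulus (H : Type v) [Group H] [TopologicalSpace H] [IsTopologicalGroup H]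
    [LocallyCompactSpace H] [T2Space H] [TotallyDisconnectedSpace H] :
    ∀ᶠ h in 𝓝 (1 : H), modulus H h = 1 := by
  obtain ⟨K, hKo, hKc, -⟩ := exists_compact_open_subgroup (G := H) Filter.univ_mem
  exact Filter.mem_of_superset (hKo.mem_nhds K.one_mem) fun k hk => modulus_eq_one K hKo hKc k hk

namespace EquivariantLineBundle

section Twist

variable {R : Type u} {G : Type v} {X : Type w} [CommRing R] [Algebra ℂ R] [Group G]
    [TopologicalSpace G] [IsTopologicalGroup G] [LocallyCompactSpace G]
    [TopologicalSpace X] [T2Space X] [MulAction G X] [ContinuousSMul G X]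
    (L : EquivariantLineBundle.{u, v, w, t} R G X)

/-- The character `χ_{L,z} · Δ_{G_z} / Δ_G|_{G_z}` of the stabilizer `G_z`, with values in `R`. -/
def twistedChar (z : X) : MulAction.stabilizer G z →* R where
  toFun g := L.stabChar z g *
    algebraMap ℂ R (((modulus (MulAction.stabilizer G z) g / modulus G (g : G) : NNReal) : ℝ) : ℂ)
  map_one' := by simp
  map_mul' g h := by
    rw [map_mul, map_mul, Subgroup.coe_mul, map_mul, mul_div_mul_comm, NNReal.coe_mul,
      Complex.ofReal_mul, map_mul, mul_mul_mul_comm]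

variable [T2Space G] [TotallyDisconnectedSpace G]

theorem eventually_twistedChar (z : X) :
    ∀ᶠ g in 𝓝 (1 : MulAction.stabilizer G z), L.twistedChar z g = 1 := by
  have ht : Filter.Tendsto (fun g : MulAction.stabilizer G z => (g : G)) (𝓝 1) (𝓝 1) :=
    continuous_subtype_val.tendsto (1 : MulAction.stabilizer G z)
  have h : ∀ᶠ g : MulAction.stabilizer G z in 𝓝 1, modulus G (g : G) = 1 :=
    ht.eventually (eventually_modulus G)
  filter_upwards [L.eventually_stabChar z, eventually_modulus (MulAction.stabilizer G z), h]
    with g h1 h2 h3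
  change L.stabChar z g * algebraMap ℂ R
    (((modulus (MulAction.stabilizer G z) g / modulus G (g : G) : NNReal) : ℝ) : ℂ) = 1
  simp [h1, h2, h3]

/-- The smooth representation `χ_{L,z} · Δ_{G_z} / Δ_G|_{G_z}` of the stabilizer `G_z`. -/
def twistedRep (z : X) : SmoothRep R (MulAction.stabilizer G z) :=
  charRep (L.twistedChar z) (L.eventually_twistedChar z)

end Twist

section Schwartz

variable {R : Type u} {G : Type v} {X : Type w} [CommRing R] [Group G]
    [TopologicalSpace G] [TopologicalSpace X] [MulAction G X]
    (L : EquivariantLineBundle.{u, v, w, t} R G X)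

/-- The section of the étalé space given by a choice of an element in each fibre. -/
def toTotal (s : ∀ x, L.Fiber x) (x : X) : Bundle.TotalSpace R L.Fiber := ⟨x, s x⟩

theorem continuousAt_toTotal_iff {x₀ : X} {U : Set X} {φ : ∀ x, L.Fiber x →ₗ[R] R} (h0 : x₀ ∈ U)
    (hn : ∀ x ∈ U, ∀ v : L.Fiber x, 𝓝 (⟨x, v⟩ : Bundle.TotalSpace R L.Fiber) =
        Filter.comap Bundle.TotalSpace.proj (𝓝 x) ⊓
          Filter.principal {p | φ p.proj p.2 = φ x v}) (s : ∀ x, L.Fiber x) :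
    ContinuousAt (L.toTotal s) x₀ ↔ ∀ᶠ y in 𝓝 x₀, φ y (s y) = φ x₀ (s x₀) := by
  have : 𝓝 (L.toTotal s x₀) = _ := hn x₀ h0 (s x₀)
  rw [ContinuousAt, this, Filter.tendsto_inf, Filter.tendsto_comap_iff, Filter.tendsto_principal]
  exact and_iff_right Filter.tendsto_id

/-- The space `𝒮(X, L)` of compactly supported sections of `L`, as an `R`-module. -/
def schwartz : Submodule R (∀ x, L.Fiber x) where
  carrier := {s | Continuous (L.toTotal s) ∧ IsCompact (closure {x | s x ≠ 0})}
  zero_mem' := by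
    refine ⟨continuous_iff_continuousAt.2 fun x => ?_, by simp⟩
    obtain ⟨U, φ, -, hx, -, hn⟩ := L.exists_chart x
    rw [L.continuousAt_toTotal_iff hx hn]
    simp
  add_mem' := by
    rintro s s' ⟨hs, hsc⟩ ⟨hs', hsc'⟩
    refine ⟨continuous_iff_continuousAt.2 fun x => ?_, ?_⟩
    · obtain ⟨U, φ, -, hx, -, hn⟩ := L.exists_chart x
      rw [L.continuousAt_toTotal_iff hx hn]
      filter_upwards [(L.continuousAt_toTotal_iff hx hn s).1 hs.continuousAt,
        (L.continuousAt_toTotal_iff hx hn s').1 hs'.continuousAt] with y h1 h2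
      rw [Pi.add_apply, Pi.add_apply, map_add, map_add, h1, h2]
    · refine (hsc.union hsc').of_isClosed_subset isClosed_closure ?_
      rw [← closure_union]
      refine closure_mono fun x hx => ?_
      by_contra h
      simp only [Set.mem_union, Set.mem_ofPred_eq, not_or, not_not] at h
      exact hx (by rw [Pi.add_apply, h.1, h.2, add_zero])
  smul_mem' := by
    rintro r s ⟨hs, hsc⟩
    refine ⟨continuous_iff_continuousAt.2 fun x => ?_, ?_⟩
    · obtain ⟨U, φ, -, hx, -, hn⟩ := L.exists_chart x
      rw [L.continuousAt_toTotal_iff hx hn]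
      filter_upwards [(L.continuousAt_toTotal_iff hx hn s).1 hs.continuousAt] with y h1
      rw [Pi.smul_apply, Pi.smul_apply, map_smul, map_smul, h1]
    · refine hsc.of_isClosed_subset isClosed_closure (closure_mono fun x hx h => ?_)
      exact hx (by rw [Pi.smul_apply, h, smul_zero])

variable [ContinuousSMul G X]

/-- The translate `g s` of a section: `(g s)(x) = g · s(g⁻¹ x)`. -/
def translate (g : G) (s : ∀ x, L.Fiber x) (x : X) : L.Fiber x :=
  L.act g (smul_inv_smul g x) (s (g⁻¹ • x))

theorem translate_mem (g : G) {s : ∀ x, L.Fiber x} (hs : s ∈ L.schwartz) :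
    L.translate g s ∈ L.schwartz := by
  refine ⟨?_, ?_⟩
  · have : L.toTotal (L.translate g s) = (fun p : G × Bundle.TotalSpace R L.Fiber =>
        (⟨p.1 • p.2.proj, L.act p.1 rfl p.2.2⟩ : Bundle.TotalSpace R L.Fiber)) ∘
        fun x => (g, L.toTotal s (g⁻¹ • x)) :=
      funext fun x => L.mk_act g (smul_inv_smul g x) (s (g⁻¹ • x))
    rw [this]
    exact L.continuous_act.comp
      (continuous_const.prodMk (hs.1.comp (continuous_const_smul g⁻¹)))
  · have h1 : {x | L.translate g s x ≠ 0} ⊆ (g • ·) '' closure {x | s x ≠ 0} := by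
      intro x hx
      refine ⟨g⁻¹ • x, subset_closure fun h => hx ?_, smul_inv_smul g x⟩
      rw [translate, h, map_zero]
    have h2 : IsClosed ((g • ·) '' closure {x | s x ≠ 0}) :=
      (Homeomorph.smul g).isClosedMap _ isClosed_closure
    exact (hs.2.image (continuous_const_smul g)).of_isClosed_subset isClosed_closure
      (closure_minimal h1 h2)

/-- The representation of `G` on `𝒮(X, L)`. -/
def schwartzRep : Representation R G L.schwartz where
  toFun g :=
    { toFun := fun s => ⟨L.translate g s, L.translate_mem g s.2⟩
      map_add' := fun s s' => Subtype.ext (funext fun x => map_add _ _ _)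
      map_smul' := fun r s => Subtype.ext (funext fun x => map_smul _ _ _) }
  map_one' := by
    refine LinearMap.ext fun s => Subtype.ext (funext fun x => ?_)
    change L.act 1 (smul_inv_smul 1 x) ((s : ∀ x, L.Fiber x) ((1 : G)⁻¹ • x)) =
      (s : ∀ x, L.Fiber x) x
    have key : ∀ (y : X) (h : (1 : G) • y = x), L.act 1 h ((s : ∀ x, L.Fiber x) y) =
        (s : ∀ x, L.Fiber x) x := by
      intro y h
      obtain rfl : y = x := by rw [← h, one_smul]
      exact L.act_one h _
    exact key _ _
  map_mul' g g' := by
    refine LinearMap.ext fun s => Subtype.ext (funext fun x => ?_)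
    change L.act (g * g') (smul_inv_smul (g * g') x)
        ((s : ∀ x, L.Fiber x) ((g * g')⁻¹ • x)) =
      L.act g (smul_inv_smul g x) (L.act g' (smul_inv_smul g' (g⁻¹ • x))
        ((s : ∀ x, L.Fiber x) (g'⁻¹ • g⁻¹ • x)))
    have key : ∀ (y y' : X) (_ : y = y') (h : (g * g') • y = x) (h' : g' • y' = g⁻¹ • x),
        L.act (g * g') h ((s : ∀ x, L.Fiber x) y) =
          L.act g (smul_inv_smul g x) (L.act g' h' ((s : ∀ x, L.Fiber x) y')) := by
      rintro y _ rfl h h'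
      exact L.act_mul g g' h' _ h _
    exact key _ _ (by rw [mul_inv_rev, mul_smul]) _ _

theorem isLocallyTrivial_restrict (U : Set X) :
    letI : TopologicalSpace (Bundle.TotalSpace R (fun x : U => L.Fiber x)) :=
      _root_.Pullback.TotalSpace.topologicalSpace R L.Fiber (Subtype.val : U → X)
    IsLocallyTrivial R (fun x : U => L.Fiber x) := by
  let _ : TopologicalSpace R := ⊥
  let _ : TopologicalSpace (Bundle.TotalSpace R (fun x : U => L.Fiber x)) :=
    _root_.Pullback.TotalSpace.topologicalSpace R L.Fiber (Subtype.val : U → X)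
  intro x
  obtain ⟨e, hx, he⟩ := L.locallyTrivial x
  refine ⟨e.pullback (⟨Subtype.val, continuous_subtype_val⟩ : C(U, X)), hx, ?_⟩
  exact ⟨fun y hy => e.linear R hy⟩

/-- The restriction of `L` to a `G`-invariant subset: the étalé space is the pull-back of that of
`L` along the inclusion. -/
def restrict (U : SubMulAction G X) : EquivariantLineBundle.{u, v, w, t} R G U where
  Fiber x := L.Fiber x
  topology := _root_.Pullback.TotalSpace.topologicalSpace R L.Fiber (Subtype.val : U → X)
  locallyTrivial := L.isLocallyTrivial_restrict (U : Set X)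
  act g x y h := L.act g (congrArg Subtype.val h)
  act_one h v := L.act_one _ v
  act_mul g g' x y z h' h hh v := L.act_mul g g' _ _ _ v
  continuous_act := by
    let _ : TopologicalSpace (Bundle.TotalSpace R (fun x : U => L.Fiber x)) :=
      _root_.Pullback.TotalSpace.topologicalSpace R L.Fiber (Subtype.val : U → X)
    have hp := _root_.Pullback.continuous_proj R L.Fiber (Subtype.val : U → X)
    have hl := _root_.Pullback.continuous_lift R L.Fiber (Subtype.val : U → X)
    refine (inducing_pullbackTotalSpaceEmbedding R L.Fiber (Subtype.val : U → X)).continuous_iff.2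
      (Continuous.prodMk ?_ ?_)
    · exact continuous_fst.smul (hp.comp continuous_snd)
    · exact L.continuous_act.comp (continuous_fst.prodMk (hl.comp continuous_snd))

variable [T2Space X]

open Classical in
/-- The extension of a section by zero. -/
def extend (U : SubMulAction G X) (s : ∀ x : U, (L.restrict U).Fiber x) (x : X) : L.Fiber x :=
  if h : x ∈ U then s ⟨x, h⟩ else 0

theorem extend_of_mem (U : SubMulAction G X) (s : ∀ x : U, (L.restrict U).Fiber x) (x : X)
    (h : x ∈ U) : L.extend U s x = s ⟨x, h⟩ := dif_pos h

theorem extend_of_notMem (U : SubMulAction G X) (s : ∀ x : U, (L.restrict U).Fiber x) (x : X)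
    (h : x ∉ U) : L.extend U s x = 0 := dif_neg h

theorem extend_mem (U : SubMulAction G X) (hU : IsOpen (U : Set X))
    {s : ∀ x : U, (L.restrict U).Fiber x} (hs : s ∈ (L.restrict U).schwartz) :
    L.extend U s ∈ L.schwartz := by
  have hK : IsCompact ((fun x : U => (x : X)) '' closure {x | s x ≠ 0}) :=
    hs.2.image continuous_subtype_val
  have hsub : {x | L.extend U s x ≠ 0} ⊆ (fun x : U => (x : X)) '' closure {x | s x ≠ 0} := by
    intro x hx
    by_cases h : x ∈ U
    · refine ⟨⟨x, h⟩, subset_closure fun h0 => hx ?_, rfl⟩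
      rw [L.extend_of_mem U s x h, h0]
      rfl
    · exact absurd (L.extend_of_notMem U s x h) hx
  refine ⟨continuous_iff_continuousAt.2 fun x => ?_,
    hK.of_isClosed_subset isClosed_closure (closure_minimal hsub hK.isClosed)⟩
  by_cases h : x ∈ U
  · have h1 : ContinuousAt (L.toTotal (L.extend U s) ∘ (Subtype.val : U → X)) ⟨x, h⟩ := by
      have h2 : L.toTotal (L.extend U s) ∘ (Subtype.val : U → X) =
          Bundle.Pullback.lift (F := R) (E := L.Fiber) (Subtype.val : U → X) ∘
            (L.restrict U).toTotal s := by
        funext y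
        exact congrArg (fun v => (⟨y, v⟩ : Bundle.TotalSpace R L.Fiber))
          (L.extend_of_mem U s y y.2)
      rw [h2]
      exact ((_root_.Pullback.continuous_lift R L.Fiber (Subtype.val : U → X)).comp
        hs.1).continuousAt
    exact (hU.isOpenEmbedding_subtypeVal.continuousAt_iff (x := ⟨x, h⟩)).1 h1
  · obtain ⟨V, φ, -, hx, -, hn⟩ := L.exists_chart x
    rw [L.continuousAt_toTotal_iff hx hn]
    have hxK : x ∉ (fun x : U => (x : X)) '' closure {x | s x ≠ 0} := by
      rintro ⟨y, -, rfl⟩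
      exact h y.2
    filter_upwards [hK.isClosed.isOpen_compl.mem_nhds hxK] with y hy
    rw [L.extend_of_notMem U s x h, show L.extend U s y = 0 by
      by_contra h0; exact hy (hsub h0), map_zero, map_zero]

/-- Extension by zero `𝒮(U, L) → 𝒮(X, L)` from an open `G`-invariant subset, as a morphism of
representations of `G`. -/
def extendByZero (U : SubMulAction G X) (hU : IsOpen (U : Set X)) :
    (L.restrict U).schwartzRep.IntertwiningMap L.schwartzRep where
  toFun s := ⟨L.extend U s, L.extend_mem U hU s.2⟩
  map_add' s s' := by
    refine Subtype.ext (funext fun x => ?_)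
    change L.extend U (s + s' : (L.restrict U).schwartz) x = L.extend U s x + L.extend U s' x
    by_cases h : x ∈ U
    · simp only [L.extend_of_mem U _ x h]; rfl
    · simp only [L.extend_of_notMem U _ x h, add_zero]
  map_smul' r s := by
    refine Subtype.ext (funext fun x => ?_)
    change L.extend U (r • s : (L.restrict U).schwartz) x = r • L.extend U s x
    by_cases h : x ∈ U
    · simp only [L.extend_of_mem U _ x h]; rfl
    · simp only [L.extend_of_notMem U _ x h, smul_zero]
  isIntertwining' g := by
    refine LinearMap.ext fun s => Subtype.ext (funext fun x => ?_)
    change L.extend U ((L.restrict U).translate g s) x =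
      L.act g (smul_inv_smul g x) (L.extend U s (g⁻¹ • x))
    by_cases h : x ∈ U
    · rw [L.extend_of_mem U _ x h, L.extend_of_mem U _ (g⁻¹ • x) (U.smul_mem g⁻¹ h)]
      rfl
    · have h' : g⁻¹ • x ∉ U := fun h' => h (by simpa using U.smul_mem g h')
      rw [L.extend_of_notMem U _ x h, L.extend_of_notMem U _ _ h', map_zero]

/-- The natural map `𝒮(U, L)_G → 𝒮(X, L)_G` on coinvariants. -/
def coinvariantsMap (U : SubMulAction G X) (hU : IsOpen (U : Set X)) :
    (L.restrict U).schwartzRep.Coinvariants →ₗ[R] L.schwartzRep.Coinvariants :=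
  Representation.Coinvariants.map _ _ (L.extendByZero U hU)

end Schwartz

end EquivariantLineBundle

/-- A subset is constructible if it is a finite union of locally closed subsets. -/
def IsConstructibleSet {Y : Type w} [TopologicalSpace Y] (A : Set Y) : Prop :=
  ∃ 𝒞 : Set (Set Y), 𝒞.Finite ∧ (∀ C ∈ 𝒞, IsLocallyClosed C) ∧ ⋃₀ 𝒞 = A

/-- The action of `G` on `Z` is constructible if its graph `{(z, g z)} ⊆ Z × Z` is constructible. -/
def IsConstructibleAction (G : Type v) (Z : Type w) [Group G] [TopologicalSpace Z]
    [MulAction G Z] : Prop :=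
  IsConstructibleSet {p : Z × Z | ∃ g : G, p.2 = g • p.1}

end LSpaceCoinv

end

/-! All arguments take place inside one representation, `translateRep`, on arbitrary families of
fibre elements. The compactly supported sections over an invariant `Y`, extended by zero, form a
submodule `sec Y`. For invariant open `U` and `V`, extension and restriction give an exact sequence
`0 → sec U → sec (U ∪ V) → sec (V \ U) → 0`. Passing from `U` to `U ∪ V` is therefore surjective on
coinvariants if `H₀(G, sec (V \ U)) = 0`, and injective if `H₁(G, sec (V \ U)) = 0`. Zorn's lemma
(`invariant_open_induction`) enlarges `U` from the complement of `Z` to `X`, so each stage only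
needs one good `V`.

Constructibility provides it. Every nonempty closed invariant `F ⊆ Z` contains a nonempty,
relatively open, invariant `Y` whose orbit relation is closed and which is the saturation of a
compact set (`exists_isStratum`). In such a `Y`, invariant relatively clopen sets separate an orbit
from any compact set disjoint from it. Hence the vanishing of `H₀` and `H₁` can be tested orbit by
orbit (`mem_of_forall_orbit`).

On one orbit the vanishing is Shapiro's lemma, proved in dual form. The orbit is locally closed, and
countability at infinity makes the orbit map open. A functional on sections near `z` that is
invariant under a small open subgroup is a multiple of a single integral (`OrbitIntegral`), which
the stabilizer multiplies by `twistedChar`. So vanishing of `H₀` of the stabilizer kills invariant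
functionals (`coinvSub_orbitRep_eq_top`). A cocycle of `G` in functionals yields a cocycle of `G_z`
in `Hom(R_χ, A)`; this is a coboundary by `exists_coboundary`, and transporting the solution along
the orbit gives `exists_primitive`.

For `G` itself, `H₁` is handled by explicit chains: `CyclesAreTrivial` works modulo the
inhomogeneous relations and modulo chains on a compact open subgroup `K`. Discarding the latter is
harmless, since averaging over a compact group is exact over a `ℂ`-algebra. -/

noncomputable section

namespace LSpaceCoinv

namespace EquivariantLineBundle

/-! ### Sections over subsets of `X`, extended by zero -/

section Sections

variable {R : Type u} {G : Type v} {X : Type w} [CommRing R] [Group G]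
    [TopologicalSpace G] [TopologicalSpace X] [MulAction G X]
    (L : EquivariantLineBundle.{u, v, w, t} R G X)

theorem act_congr (g : G) {x x' y : X} (hx : x = x') (h : g • x = y) (h' : g • x' = y)
    (s : ∀ x, L.Fiber x) : L.act g h (s x) = L.act g h' (s x') := by
  subst hx; rfl

/-- The representation of `G` on all (possibly discontinuous) sections of `L`. -/
def translateRep : Representation R G (∀ x, L.Fiber x) where
  toFun g :=
    { toFun := fun s x => L.act g (smul_inv_smul g x) (s (g⁻¹ • x))
      map_add' := fun s s' => funext fun x => map_add _ _ _
      map_smul' := fun r s => funext fun x => map_smul _ _ _ }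
  map_one' := by
    refine LinearMap.ext fun s => funext fun x => ?_
    change L.act 1 (smul_inv_smul 1 x) (s ((1 : G)⁻¹ • x)) = s x
    rw [L.act_congr 1 (by simp : (1 : G)⁻¹ • x = x) _ (one_smul G x)]
    exact L.act_one _ _
  map_mul' g g' := by
    refine LinearMap.ext fun s => funext fun x => ?_
    change L.act (g * g') (smul_inv_smul (g * g') x) (s ((g * g')⁻¹ • x)) =
      L.act g (smul_inv_smul g x) (L.act g' (smul_inv_smul g' (g⁻¹ • x)) (s (g'⁻¹ • g⁻¹ • x)))
    rw [L.act_congr (g * g') (by rw [mul_inv_rev, mul_smul] : (g * g')⁻¹ • x = g'⁻¹ • g⁻¹ • x) _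
      (by rw [mul_smul, smul_inv_smul, smul_inv_smul])]
    exact L.act_mul g g' _ _ _ _

theorem translateRep_apply (g : G) (s : ∀ x, L.Fiber x) (x : X) :
    L.translateRep g s x = L.act g (smul_inv_smul g x) (s (g⁻¹ • x)) := rfl

theorem translateRep_apply_of_eq (g : G) (s : ∀ x, L.Fiber x) {x y : X} (h : g • x = y) :
    L.translateRep g s y = L.act g h (s x) := by
  rw [translateRep_apply]
  exact L.act_congr g (by rw [← h, inv_smul_smul]) _ _ s

theorem act_eq_zero_iff (g : G) {x y : X} (h : g • x = y) (v : L.Fiber x) :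
    L.act g h v = 0 ↔ v = 0 := by
  refine ⟨fun h0 => ?_, fun h0 => by rw [h0, map_zero]⟩
  rw [← L.act_inv_act g h (by rw [← h, inv_smul_smul]) v, h0, map_zero]

open Classical in
/-- Cutting off a section outside a set. -/
def cut (B : Set X) : (∀ x, L.Fiber x) →ₗ[R] (∀ x, L.Fiber x) where
  toFun s x := if x ∈ B then s x else 0
  map_add' s s' := by
    funext x
    by_cases h : x ∈ B <;> simp [h]
  map_smul' r s := by
    funext x
    by_cases h : x ∈ B <;> simp [h]

theorem cut_of_mem {B : Set X} (s : ∀ x, L.Fiber x) {x : X} (h : x ∈ B) : L.cut B s x = s x :=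
  if_pos h

theorem cut_of_notMem {B : Set X} (s : ∀ x, L.Fiber x) {x : X} (h : x ∉ B) : L.cut B s x = 0 :=
  if_neg h

theorem cut_eq_self {B : Set X} {s : ∀ x, L.Fiber x} (h : ∀ x ∉ B, s x = 0) : L.cut B s = s := by
  funext x
  by_cases hx : x ∈ B
  · exact L.cut_of_mem s hx
  · rw [L.cut_of_notMem s hx, h x hx]

theorem cut_cut (B B' : Set X) (s : ∀ x, L.Fiber x) : L.cut B (L.cut B' s) = L.cut (B ∩ B') s := by
  funext x
  by_cases hx : x ∈ B
  · rw [L.cut_of_mem _ hx]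
    by_cases hx' : x ∈ B'
    · rw [L.cut_of_mem _ hx', L.cut_of_mem _ (show x ∈ B ∩ B' from ⟨hx, hx'⟩)]
    · rw [L.cut_of_notMem _ hx', L.cut_of_notMem _ fun h => hx' h.2]
  · rw [L.cut_of_notMem _ hx, L.cut_of_notMem _ fun h => hx h.1]

theorem cut_add_cut_compl (B : Set X) (s : ∀ x, L.Fiber x) : L.cut B s + L.cut Bᶜ s = s := by
  funext x
  by_cases hx : x ∈ B
  · rw [Pi.add_apply, L.cut_of_mem _ hx, L.cut_of_notMem _ (by simpa using hx), add_zero]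
  · rw [Pi.add_apply, L.cut_of_notMem _ hx, L.cut_of_mem _ (by simpa using hx), zero_add]

theorem cut_eq_zero {B : Set X} {s : ∀ x, L.Fiber x} (h : ∀ x ∈ B, s x = 0) : L.cut B s = 0 := by
  funext x
  by_cases hx : x ∈ B
  · rw [L.cut_of_mem _ hx, h x hx]; rfl
  · rw [L.cut_of_notMem _ hx]; rfl

theorem cut_union (B B' : Set X) (s : ∀ x, L.Fiber x) :
    L.cut (B ∪ B') s = L.cut B s + L.cut (B' \ B) s := by
  have h1 : B ∩ (B ∪ B') = B := Set.inter_eq_left.2 Set.subset_union_left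
  have h2 : Bᶜ ∩ (B ∪ B') = B' \ B := by
    ext x
    simp only [Set.mem_inter_iff, Set.mem_compl_iff, Set.mem_union, Set.mem_sdiff]
    tauto
  rw [← L.cut_add_cut_compl B (L.cut (B ∪ B') s), cut_cut, cut_cut, h1, h2]

theorem cut_translateRep {B : Set X} (hB : ∀ (g : G), ∀ x ∈ B, g • x ∈ B) (g : G)
    (s : ∀ x, L.Fiber x) : L.cut B (L.translateRep g s) = L.translateRep g (L.cut B s) := by
  funext x
  rw [translateRep_apply]
  by_cases hx : x ∈ B
  · rw [L.cut_of_mem _ hx, L.cut_of_mem _ (hB g⁻¹ x hx), translateRep_apply]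
  · have hx' : g⁻¹ • x ∉ B := fun h => hx (by simpa using hB g _ h)
    rw [L.cut_of_notMem _ hx, L.cut_of_notMem _ hx', map_zero]

/-- In a chart the étalé space is the base times a discrete fibre, so a continuous section is one
with locally constant coordinate. -/
theorem continuousWithinAt_toTotal_iff {x₀ : X} {U : Set X} {φ : ∀ x, L.Fiber x →ₗ[R] R}
    (h0 : x₀ ∈ U)
    (hn : ∀ x ∈ U, ∀ v : L.Fiber x, 𝓝 (⟨x, v⟩ : Bundle.TotalSpace R L.Fiber) =
        Filter.comap Bundle.TotalSpace.proj (𝓝 x) ⊓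
          Filter.principal {p | φ p.proj p.2 = φ x v}) (Y : Set X) (s : ∀ x, L.Fiber x) :
    ContinuousWithinAt (L.toTotal s) Y x₀ ↔ ∀ᶠ y in 𝓝[Y] x₀, φ y (s y) = φ x₀ (s x₀) := by
  have : 𝓝 (L.toTotal s x₀) = _ := hn x₀ h0 (s x₀)
  rw [ContinuousWithinAt, this, Filter.tendsto_inf, Filter.tendsto_comap_iff,
    Filter.tendsto_principal]
  exact and_iff_right (Filter.tendsto_id.mono_left nhdsWithin_le_nhds)

theorem continuousWithinAt_zero (Y : Set X) (x : X) {s : ∀ x, L.Fiber x} (h0 : s x = 0)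
    (h : ∀ᶠ y in 𝓝[Y] x, s y = 0) : ContinuousWithinAt (L.toTotal s) Y x := by
  obtain ⟨U, φ, -, hx, -, hn⟩ := L.exists_chart x
  rw [L.continuousWithinAt_toTotal_iff hx hn]
  filter_upwards [h] with y hy
  rw [hy, h0, map_zero, map_zero]

/-- The compactly supported continuous sections of `L` over a subset `Y`, extended by zero. -/
def sec (Y : Set X) : Submodule R (∀ x, L.Fiber x) where
  carrier := {s | ContinuousOn (L.toTotal s) Y ∧ ∃ C ⊆ Y, IsCompact C ∧ ∀ x ∉ C, s x = 0}
  zero_mem' := ⟨fun x _ => L.continuousWithinAt_zero _ _ rfl (Filter.Eventually.of_forall fun _ => rfl),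
    ∅, Set.empty_subset _, isCompact_empty, fun _ _ => rfl⟩
  add_mem' := by
    rintro s s' ⟨hs, C, hCY, hC, hsC⟩ ⟨hs', C', hCY', hC', hsC'⟩
    refine ⟨fun x hxY => ?_, C ∪ C', Set.union_subset hCY hCY', hC.union hC', fun x hx => ?_⟩
    · obtain ⟨U, φ, -, hx, -, hn⟩ := L.exists_chart x
      rw [L.continuousWithinAt_toTotal_iff hx hn]
      filter_upwards [(L.continuousWithinAt_toTotal_iff hx hn Y s).1 (hs x hxY),
        (L.continuousWithinAt_toTotal_iff hx hn Y s').1 (hs' x hxY)] with y h1 h2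
      rw [Pi.add_apply, Pi.add_apply, map_add, map_add, h1, h2]
    · rw [Pi.add_apply, hsC x fun h => hx (Or.inl h), hsC' x fun h => hx (Or.inr h), add_zero]
  smul_mem' := by
    rintro r s ⟨hs, C, hCY, hC, hsC⟩
    refine ⟨fun x hxY => ?_, C, hCY, hC, fun x hx => ?_⟩
    · obtain ⟨U, φ, -, hx, -, hn⟩ := L.exists_chart x
      rw [L.continuousWithinAt_toTotal_iff hx hn]
      filter_upwards [(L.continuousWithinAt_toTotal_iff hx hn Y s).1 (hs x hxY)] with y h1
      rw [Pi.smul_apply, Pi.smul_apply, map_smul, map_smul, h1]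
    · rw [Pi.smul_apply, hsC x hx, smul_zero]

theorem sec_zero_of_notMem {Y : Set X} {s : ∀ x, L.Fiber x} (hs : s ∈ L.sec Y) {x : X}
    (hx : x ∉ Y) : s x = 0 := by
  obtain ⟨-, C, hCY, -, hC⟩ := hs
  exact hC x fun h => hx (hCY h)

section T2

variable [T2Space X]

theorem sec_univ : L.sec Set.univ = L.schwartz := by
  ext s
  constructor
  · rintro ⟨hs, C, -, hC, hsC⟩
    refine ⟨continuousOn_univ.1 hs, hC.of_isClosed_subset isClosed_closure
      (closure_minimal (fun x hx => ?_) hC.isClosed)⟩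
    by_contra h
    exact hx (hsC x h)
  · rintro ⟨hs, hC⟩
    refine ⟨hs.continuousOn, _, Set.subset_univ _, hC, fun x hx => ?_⟩
    by_contra h
    exact hx (subset_closure h)

/-- At a point of the compact support, `Y'` is a neighbourhood inside `Y`. At any other point the
section vanishes nearby, because the support lies in a closed set. -/
theorem sec_mono {Y' Y V : Set X} (hV : IsOpen V) (hYV : Y ∩ V = Y') : L.sec Y' ≤ L.sec Y := by
  rintro s ⟨hs, C, hCY, hC, hsC⟩
  have hY' : Y' ⊆ Y := hYV ▸ Set.inter_subset_left
  refine ⟨fun x hxY => ?_, C, hCY.trans hY', hC, hsC⟩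
  by_cases hx : x ∈ C
  · refine (hs x (hCY hx)).mono_of_mem_nhdsWithin ?_
    rw [← hYV]
    exact Filter.inter_mem self_mem_nhdsWithin
      (mem_nhdsWithin_of_mem_nhds (hV.mem_nhds ((hYV.symm ▸ hCY hx : x ∈ Y ∩ V).2)))
  · refine L.continuousWithinAt_zero _ _ (hsC x hx) (Filter.Eventually.filter_mono
      nhdsWithin_le_nhds ?_)
    filter_upwards [hC.isClosed.isOpen_compl.mem_nhds hx] with y hy using hsC y hy

theorem cut_mem_sec {Y' Y F : Set X} (hF : IsClosed F) (hYF : Y ∩ F = Y') {s : ∀ x, L.Fiber x}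
    (hs : s ∈ L.sec Y) : L.cut Y' s ∈ L.sec Y' := by
  obtain ⟨hs, C, hCY, hC, hsC⟩ := hs
  have hY' : Y' ⊆ Y := hYF ▸ Set.inter_subset_left
  refine ⟨fun x hx => ?_, C ∩ F, fun x hx => hYF ▸ ⟨hCY hx.1, hx.2⟩, hC.inter_right hF,
    fun x hx => ?_⟩
  · refine ((hs x (hY' hx)).mono hY').congr (fun y hy => ?_) ?_
    · exact congrArg (Bundle.TotalSpace.mk y) (L.cut_of_mem s hy)
    · exact congrArg (Bundle.TotalSpace.mk x) (L.cut_of_mem s hx)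
  · by_cases h : x ∈ Y'
    · rw [L.cut_of_mem s h]
      exact hsC x fun h' => hx ⟨h', (hYF.symm ▸ h : x ∈ Y ∩ F).2⟩
    · exact L.cut_of_notMem s h

theorem cut_clopen_mem_sec {Y B : Set X} {s : ∀ x, L.Fiber x} (hs : s ∈ L.sec Y)
    (hB : IsClopen B) : L.cut B s ∈ L.sec Y := by
  have h : L.cut B s = L.cut (Y ∩ B) s := by
    conv_lhs => rw [← L.cut_eq_self (B := Y) (s := s) fun x hx => L.sec_zero_of_notMem hs hx]
    rw [cut_cut, Set.inter_comm]
  rw [h]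
  exact L.sec_mono hB.2 rfl (L.cut_mem_sec hB.1 rfl hs)

variable [ContinuousSMul G X]

theorem translateRep_mem_sec {Y : Set X} (g : G) {s : ∀ x, L.Fiber x} (hs : s ∈ L.sec Y) :
    L.translateRep g s ∈ L.sec (g • Y) := by
  obtain ⟨hs, C, hCY, hC, hsC⟩ := hs
  refine ⟨?_, g • C, Set.smul_set_mono hCY, hC.image (continuous_const_smul g), fun x hx => ?_⟩
  · have : L.toTotal (L.translateRep g s) = (fun p : G × Bundle.TotalSpace R L.Fiber =>
        (⟨p.1 • p.2.proj, L.act p.1 rfl p.2.2⟩ : Bundle.TotalSpace R L.Fiber)) ∘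
        fun x => (g, L.toTotal s (g⁻¹ • x)) :=
      funext fun x => L.mk_act g (smul_inv_smul g x) (s (g⁻¹ • x))
    rw [this]
    refine L.continuous_act.comp_continuousOn (continuousOn_const.prodMk ?_)
    exact hs.comp (continuous_const_smul g⁻¹).continuousOn
      fun x hx => Set.mem_smul_set_iff_inv_smul_mem.1 hx
  · rw [translateRep_apply, hsC _ fun h => hx (Set.mem_smul_set_iff_inv_smul_mem.2 h), map_zero]

theorem translateRep_mem_sec_of_invariant {Y : Set X} (hY : ∀ (g : G), ∀ x ∈ Y, g • x ∈ Y) (g : G)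
    {s : ∀ x, L.Fiber x} (hs : s ∈ L.sec Y) : L.translateRep g s ∈ L.sec Y := by
  have h : g • Y = Y := by
    refine Set.Subset.antisymm ?_ fun x hx => ?_
    · rintro _ ⟨x, hx, rfl⟩
      exact hY g x hx
    · exact ⟨g⁻¹ • x, hY _ _ hx, smul_inv_smul g x⟩
  exact h ▸ L.translateRep_mem_sec g hs

/-- By continuity of the action at `(1, s x)`, the coordinate of `g · s y` is that of `s x` for `(g,
y)` near `(1, x)`. The coordinate of `s (g y)` is also that of `s x`, and charts are injective on
fibres. -/
theorem eventually_act_eq {Y : Set X} (hY : ∀ (g : G), ∀ x ∈ Y, g • x ∈ Y) {s : ∀ x, L.Fiber x}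
    (hs : s ∈ L.sec Y) {x : X} (hxY : x ∈ Y) :
    ∀ᶠ p : G × X in 𝓝 1 ×ˢ 𝓝 x, p.2 ∈ Y → L.act p.1 rfl (s p.2) = s (p.1 • p.2) := by
  obtain ⟨U, φ, hUo, hx, hφ, hn⟩ := L.exists_chart x
  have hcx := (L.continuousWithinAt_toTotal_iff hx hn Y s).1 (hs.1 x hxY)
  rw [eventually_nhdsWithin_iff] at hcx
  have hact : Filter.Tendsto (fun p : G × Bundle.TotalSpace R L.Fiber =>
      (⟨p.1 • p.2.proj, L.act p.1 rfl p.2.2⟩ : Bundle.TotalSpace R L.Fiber))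
      (𝓝 (1, ⟨x, s x⟩)) (𝓝 ⟨x, s x⟩) := by
    have h := L.continuous_act.tendsto (1, (⟨x, s x⟩ : Bundle.TotalSpace R L.Fiber))
    rwa [show (⟨(1 : G) • x, L.act 1 rfl (s x)⟩ : Bundle.TotalSpace R L.Fiber) = ⟨x, s x⟩ from
      (L.mk_act 1 (one_smul G x) (s x)).symm.trans (by rw [L.act_one])] at h
  rw [hn x hx (s x), nhds_prod_eq, hn x hx (s x)] at hact
  have h1 := hact (Filter.mem_inf_of_right (Filter.mem_principal_self _))
  rw [Filter.mem_map] at h1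
  obtain ⟨A, hA, T, hT, hAT⟩ := Filter.mem_prod_iff.1 h1
  obtain ⟨T', hT', hTT⟩ := (Filter.mem_inf_principal.1 hT)
  have hsm : Filter.Tendsto (fun p : G × X => p.1 • p.2) (𝓝 1 ×ˢ 𝓝 x) (𝓝 x) := by
    have := (continuous_smul (M := G) (X := X)).tendsto (1, x)
    rwa [one_smul, nhds_prod_eq] at this
  filter_upwards [Filter.prod_mem_prod hA (Filter.inter_mem hT' hcx), hsm (hUo.mem_nhds hx),
    hsm hcx] with p hp hpU hp2 hpY
  have h2 : (⟨p.2, s p.2⟩ : Bundle.TotalSpace R L.Fiber) ∈ T := by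
    exact hTT (show (⟨p.2, s p.2⟩ : Bundle.TotalSpace R L.Fiber).proj ∈ T' from hp.2.1)
      (hp.2.2 hpY)
  have h3 : φ (p.1 • p.2) (L.act p.1 rfl (s p.2)) = φ x (s x) :=
    hAT (show (p.1, (⟨p.2, s p.2⟩ : Bundle.TotalSpace R L.Fiber)) ∈ A ×ˢ T from ⟨hp.1, h2⟩)
  exact (hφ _ hpU).1 (h3.trans (hp2 (hY _ _ hpY)).symm)

/-- Sections over an invariant subset are smooth vectors. -/
theorem eventually_translateRep_eq [IsTopologicalGroup G] {Y : Set X}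
    (hY : ∀ (g : G), ∀ x ∈ Y, g • x ∈ Y) {s : ∀ x, L.Fiber x} (hs : s ∈ L.sec Y) :
    ∀ᶠ g in 𝓝 (1 : G), L.translateRep g s = s := by
  obtain ⟨C, hCY, hC, hsC⟩ := hs.2
  have key : ∀ᶠ g in 𝓝 (1 : G), ∀ y ∈ C, y ∈ Y → L.act g rfl (s y) = s (g • y) :=
    hC.eventually_forall_of_forall_eventually fun x hx => by
      rw [nhds_prod_eq]
      exact L.eventually_act_eq hY hs (hCY hx)
  have hinv : Filter.Tendsto (fun g : G => g⁻¹) (𝓝 1) (𝓝 1) := by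
    simpa using (continuous_inv (G := G)).tendsto 1
  filter_upwards [key, hinv key] with g h1 h2
  funext x
  by_cases hx : g⁻¹ • x ∈ C
  · have h3 := h1 _ hx (hCY hx)
    have h4 := L.translateRep_apply_of_eq g s (rfl : g • g⁻¹ • x = _)
    rw [h3] at h4
    have : g • g⁻¹ • x = x := smul_inv_smul g x
    rwa [this] at h4
  · rw [translateRep_apply, hsC _ hx, map_zero]
    -- Here `g⁻¹` moves `x` out of the support, so the local identity for `g⁻¹` at `x` forces `s x =
    -- 0`.
    by_cases hxC : x ∈ C
    · have h3 := h2 x hxC (hCY hxC)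
      rw [hsC _ hx, L.act_eq_zero_iff] at h3
      exact h3.symm
    · exact (hsC x hxC).symm

end T2

section Partition

variable [T2Space X] [LocallyCompactSpace X] [TotallyDisconnectedSpace X]

/-- A section lies in a submodule if it does so locally. -/
theorem mem_of_locally {Y : Set X} {s : ∀ x, L.Fiber x} (hs : s ∈ L.sec Y)
    (W : Submodule R (∀ x, L.Fiber x))
    (h : ∀ x ∈ Y, ∃ N ∈ 𝓝 x, ∀ B ⊆ N, IsClopen B → L.cut B s ∈ W) : s ∈ W := by
  obtain ⟨-, C, hCY, hC, hsC⟩ := hs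
  -- Asking for all clopen subsets of `B` makes the property stable under unions, since a union is
  -- split into two disjoint clopen pieces.
  have key : ∃ B, IsClopen B ∧ C ⊆ B ∧ ∀ B' ⊆ B, IsClopen B' → L.cut B' s ∈ W := by
    refine hC.induction_on (p := fun S => ∃ B, IsClopen B ∧ S ⊆ B ∧
      ∀ B' ⊆ B, IsClopen B' → L.cut B' s ∈ W) ?_ ?_ ?_ ?_
    · refine ⟨∅, isClopen_empty, subset_rfl, fun B' hB' _ => ?_⟩
      rw [L.cut_eq_zero fun x hx => (hB' hx).elim]
      exact W.zero_mem
    · rintro S T hST ⟨B, hB, hTB, hBW⟩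
      exact ⟨B, hB, hST.trans hTB, hBW⟩
    · rintro S T ⟨B, hB, hTB, hBW⟩ ⟨B', hB', hTB', hBW'⟩
      refine ⟨B ∪ B', hB.union hB', Set.union_subset_union hTB hTB', fun D hD hDc => ?_⟩
      have : D = (D ∩ B) ∪ (D ∩ B') := by
        rw [← Set.inter_union_distrib_left, Set.inter_eq_left.2 hD]
      rw [this, cut_union]
      exact W.add_mem (hBW _ Set.inter_subset_right (hDc.inter hB))
        (hBW' _ (Set.sdiff_subset.trans Set.inter_subset_right)
          ((hDc.inter hB').diff (hDc.inter hB)))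
    · intro x hx
      obtain ⟨N, hN, hNW⟩ := h x (hCY hx)
      obtain ⟨B, hB, hxB, hBN⟩ :=
        (loc_compact_Haus_tot_disc_of_zero_dim (H := X)).mem_nhds_iff.1 hN
      have hBc : IsClopen B := hB
      exact ⟨B, mem_nhdsWithin_of_mem_nhds (hBc.2.mem_nhds hxB), B, hBc, subset_rfl,
        fun B' h1 h2 => hNW B' (h1.trans hBN) h2⟩
  obtain ⟨B, hB, hCB, hBW⟩ := key
  rw [← L.cut_eq_self (B := B) (s := s) fun x hx => hsC x fun h => hx (hCB h)]
  exact hBW B subset_rfl hB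

/-- Sections over a subset of an open set extend to the open set. -/
theorem exists_extension {Y U : Set X} (hU : IsOpen U) (hYU : Y ⊆ U) {s : ∀ x, L.Fiber x}
    (hs : s ∈ L.sec Y) : ∃ s' ∈ L.sec U, L.cut Y s' = s := by
  suffices s ∈ (L.sec U).map (L.cut Y) from this
  refine L.mem_of_locally hs _ fun x hxY => ?_
  obtain ⟨V, φ, hV, hx, hφ, hn⟩ := L.exists_chart x
  have hcx := (L.continuousWithinAt_toTotal_iff hx hn Y s).1 (hs.1 x hxY)
  rw [eventually_nhdsWithin_iff] at hcx
  obtain ⟨N, hN, hNV, hNc⟩ := LocallyCompactSpace.local_compact_nhds x _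
    (Filter.inter_mem (Filter.inter_mem (hV.mem_nhds hx) (hU.mem_nhds (hYU hxY))) hcx)
  refine ⟨N, hN, fun B hBN hB => ?_⟩
  have hBc : IsCompact B := hNc.of_isClosed_subset hB.1 hBN
  -- Near `x` the coordinate of `s` is constant on `Y`; the extension keeps this constant coordinate
  -- on the whole chart.
  have hσ : ∀ y : X, ∃ v : L.Fiber y, y ∈ V → φ y v = φ x (s x) := fun y => by
    by_cases hy : y ∈ V
    · obtain ⟨v, hv⟩ := (hφ y hy).2 (φ x (s x))
      exact ⟨v, fun _ => hv⟩
    · exact ⟨0, fun h => absurd h hy⟩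
  choose σ hσ using hσ
  refine ⟨L.cut B σ, ⟨fun y _ => ContinuousAt.continuousWithinAt ?_, B,
    fun y hy => (hNV (hBN hy)).1.2, hBc, fun y hy => L.cut_of_notMem _ hy⟩, ?_⟩
  · by_cases hy : y ∈ B
    · rw [L.continuousAt_toTotal_iff (hNV (hBN hy)).1.1 hn]
      filter_upwards [hB.2.mem_nhds hy] with y' hy'
      rw [L.cut_of_mem _ hy, L.cut_of_mem _ hy', hσ _ (hNV (hBN hy)).1.1,
        hσ _ (hNV (hBN hy')).1.1]
    · rw [← continuousWithinAt_univ]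
      refine L.continuousWithinAt_zero _ _ (L.cut_of_notMem _ hy) ?_
      rw [nhdsWithin_univ]
      filter_upwards [hB.1.isOpen_compl.mem_nhds hy] with y' hy' using L.cut_of_notMem _ hy'
  · rw [cut_cut]
    funext y
    by_cases hy : y ∈ B
    · by_cases hyY : y ∈ Y
      · rw [L.cut_of_mem _ hy, L.cut_of_mem _ (⟨hyY, hy⟩ : y ∈ Y ∩ B)]
        have hyV := (hNV (hBN hy)).1.1
        exact (hφ y hyV).1 ((hσ y hyV).trans ((hNV (hBN hy)).2 hyY).symm)
      · rw [L.cut_of_mem _ hy, L.cut_of_notMem _ fun h => hyY h.1, L.sec_zero_of_notMem hs hyY]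
    · rw [L.cut_of_notMem _ hy, L.cut_of_notMem _ fun h => hy h.2]

end Partition

end Sections

end EquivariantLineBundle

/-! ### Averaging over cosets of a subgroup of finite index -/

section Averaging

variable {R : Type*} {K : Type*} {V : Type*} [CommRing R] [Algebra ℂ R] [Group K] [AddCommGroup V]
  [Module R V] (ρ : Representation R K V)

/-- A vector fixed by a subgroup of finite index. -/
def IsFiniteVector (v : V) : Prop := ∃ S : Subgroup K, S.FiniteIndex ∧ ∀ k ∈ S, ρ k v = v

theorem inv_natCast_smul {n : ℕ} (hn : n ≠ 0) (v : V) :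
    algebraMap ℂ R (n : ℂ)⁻¹ • n • v = v := by
  rw [← Nat.cast_smul_eq_nsmul R, smul_smul, ← map_natCast (algebraMap ℂ R), ← map_mul,
    inv_mul_cancel₀ (by exact_mod_cast hn), map_one, one_smul]

theorem out_apply_eq {S : Subgroup K} {v : V} (hS : ∀ k ∈ S, ρ k v = v) (q : K ⧸ S) (k : K)
    (hk : (k : K ⧸ S) = q) : ρ q.out v = ρ k v := by
  have h : k⁻¹ * q.out ∈ S := by
    rw [← QuotientGroup.eq, hk, QuotientGroup.out_eq']
  have h2 := congrArg (ρ k) (hS _ h)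
  rwa [← Module.End.mul_apply, ← map_mul, mul_inv_cancel_left] at h2

theorem apply_sum_out {S : Subgroup K} [Fintype (K ⧸ S)] {v : V} (hS : ∀ k ∈ S, ρ k v = v)
    (k : K) : ρ k (∑ q : K ⧸ S, ρ q.out v) = ∑ q : K ⧸ S, ρ q.out v := by
  rw [map_sum]
  refine Fintype.sum_equiv (MulAction.toPerm k) _ _ fun q => ?_
  rw [MulAction.toPerm_apply, ← Module.End.mul_apply, ← map_mul]
  refine (out_apply_eq ρ hS _ _ ?_).symm
  conv_rhs => rw [← QuotientGroup.out_eq' q]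
  rfl

variable {ρ} in
-- The mean over `K ⧸ S` is invariant, and it differs from `v` by a combination of the `k v - v`.
-- Dividing by the index is possible over a `ℂ`-algebra.
theorem IsFiniteVector.exists_average {v : V} (hv : IsFiniteVector ρ v) :
    ∃ v', (∀ k, ρ k v' = v') ∧ v - v' ∈ Submodule.span R (Set.range fun k => ρ k v - v) := by
  obtain ⟨S, hSf, hS⟩ := hv
  have := Fintype.ofFinite (K ⧸ S)
  have hn : Fintype.card (K ⧸ S) ≠ 0 := Fintype.card_ne_zero
  refine ⟨algebraMap ℂ R ((Fintype.card (K ⧸ S) : ℂ))⁻¹ • ∑ q : K ⧸ S, ρ q.out v, fun k => ?_, ?_⟩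
  · rw [map_smul, apply_sum_out ρ hS]
  · have h : v - algebraMap ℂ R ((Fintype.card (K ⧸ S) : ℂ))⁻¹ • ∑ q : K ⧸ S, ρ q.out v =
        -(algebraMap ℂ R ((Fintype.card (K ⧸ S) : ℂ))⁻¹ • ∑ q : K ⧸ S, (ρ q.out v - v)) := by
      rw [Finset.sum_sub_distrib, smul_sub, Finset.sum_const, Finset.card_univ,
        inv_natCast_smul hn, neg_sub]
    rw [h]
    exact Submodule.neg_mem _ (Submodule.smul_mem _ _ (Submodule.sum_mem _ fun q _ =>
      Submodule.subset_span ⟨_, rfl⟩))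

end Averaging

/-! ### Coinvariants and the first homology through inhomogeneous chains -/

section Chains

variable {R : Type*} {G : Type*} {V : Type*} [CommRing R] [Group G] [AddCommGroup V] [Module R V]
  (ρ : Representation R G V)

/-- The kernel of the projection of a subrepresentation `W` to its coinvariants. -/
def coinvSub (W : Submodule R V) : Submodule R V :=
  Submodule.span R {x | ∃ g, ∃ w ∈ W, ρ g w - w = x}

variable {ρ} in
theorem sub_mem_coinvSub {W : Submodule R V} (g : G) {w : V} (hw : w ∈ W) :
    ρ g w - w ∈ coinvSub ρ W := Submodule.subset_span ⟨g, w, hw, rfl⟩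

theorem coinvSub_mono {W W' : Submodule R V} (h : W ≤ W') : coinvSub ρ W ≤ coinvSub ρ W' :=
  Submodule.span_mono fun _ ⟨g, w, hw, e⟩ => ⟨g, w, h hw, e⟩

theorem coinvSub_comp_le {G' : Type*} [Group G'] (f : G' →* G) (W : Submodule R V) :
    coinvSub (ρ.comp f) W ≤ coinvSub ρ W :=
  Submodule.span_mono fun _ ⟨g, w, hw, e⟩ => ⟨f g, w, hw, e⟩

theorem coinvSub_map {W : Submodule R V} (p : V →ₗ[R] V) (hp : ∀ g v, p (ρ g v) = ρ g (p v)) :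
    coinvSub ρ (W.map p) = (coinvSub ρ W).map p := by
  rw [coinvSub, coinvSub, Submodule.map_span]
  congr 1
  ext x
  constructor
  · rintro ⟨g, _, ⟨w, hw, rfl⟩, rfl⟩
    exact ⟨_, ⟨g, w, hw, rfl⟩, by rw [map_sub, hp]⟩
  · rintro ⟨_, ⟨g, w, hw, rfl⟩, rfl⟩
    exact ⟨g, _, ⟨w, hw, rfl⟩, by rw [map_sub, hp]⟩

/-- The boundary `∑ [g] v ↦ ∑ (g v - v)`. -/
def boundary : (G →₀ V) →ₗ[R] V := Finsupp.lsum R fun g => ρ g - 1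

theorem boundary_single (g : G) (v : V) : boundary ρ (Finsupp.single g v) = ρ g v - v := by
  simp [boundary]

/-- The relations between the chains with values in `W`: those of inhomogeneous cycles, and that
the elements of `K` are trivial. -/
def chainRel (K : Subgroup G) (W : Submodule R V) : Submodule R (G →₀ V) :=
  Submodule.span R
    ({x | ∃ g h, ∃ w ∈ W, Finsupp.single (g * h) w - Finsupp.single g (ρ h w) -
        Finsupp.single h w = x} ∪ {x | ∃ k ∈ K, ∃ w ∈ W, Finsupp.single k w = x})

variable {ρ}

theorem mul_mem_chainRel (K : Subgroup G) {W : Submodule R V} (g h : G) {w : V} (hw : w ∈ W) :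
    Finsupp.single (g * h) w - Finsupp.single g (ρ h w) - Finsupp.single h w ∈ chainRel ρ K W :=
  Submodule.subset_span (Or.inl ⟨g, h, w, hw, rfl⟩)

theorem single_mem_chainRel {K : Subgroup G} {W : Submodule R V} {k : G} (hk : k ∈ K) {w : V}
    (hw : w ∈ W) : Finsupp.single k w ∈ chainRel ρ K W :=
  Submodule.subset_span (Or.inr ⟨k, hk, w, hw, rfl⟩)

theorem chainRel_mono {K : Subgroup G} {W W' : Submodule R V} (h : W ≤ W') :
    chainRel ρ K W ≤ chainRel ρ K W' := by
  refine Submodule.span_mono (Set.union_subset_union ?_ ?_)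
  · rintro _ ⟨g, g', w, hw, rfl⟩
    exact ⟨g, g', w, h hw, rfl⟩
  · rintro _ ⟨k, hk, w, hw, rfl⟩
    exact ⟨k, hk, w, h hw, rfl⟩

theorem chainRel_map (K : Subgroup G) {W : Submodule R V} (p : V →ₗ[R] V)
    (hp : ∀ g v, p (ρ g v) = ρ g (p v)) :
    chainRel ρ K (W.map p) = (chainRel ρ K W).map (Finsupp.mapRange.linearMap p) := by
  rw [chainRel, chainRel, Submodule.map_span, Set.image_union]
  congr 2
  · ext x
    constructor
    · rintro ⟨g, h, _, ⟨w, hw, rfl⟩, rfl⟩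
      exact ⟨_, ⟨g, h, w, hw, rfl⟩, by
        simp only [map_sub, Finsupp.mapRange.linearMap_apply, Finsupp.mapRange_single, hp]⟩
    · rintro ⟨_, ⟨g, h, w, hw, rfl⟩, rfl⟩
      exact ⟨g, h, _, ⟨w, hw, rfl⟩, by
        simp only [map_sub, Finsupp.mapRange.linearMap_apply, Finsupp.mapRange_single, hp]⟩
  · ext x
    constructor
    · rintro ⟨k, hk, _, ⟨w, hw, rfl⟩, rfl⟩
      exact ⟨_, ⟨k, hk, w, hw, rfl⟩, by simp⟩
    · rintro ⟨_, ⟨k, hk, w, hw, rfl⟩, rfl⟩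
      exact ⟨k, hk, _, ⟨w, hw, rfl⟩, by simp⟩

theorem apply_mem_of_mem_chainRel {K : Subgroup G} {W : Submodule R V}
    (hW : ∀ g, ∀ w ∈ W, ρ g w ∈ W) {r : G →₀ V} (hr : r ∈ chainRel ρ K W) (g : G) : r g ∈ W := by
  classical
  have hs : ∀ (g' : G) (w : V), w ∈ W → Finsupp.single g' w g ∈ W := by
    intro g' w hw
    rw [Finsupp.single_apply]
    split_ifs
    · exact hw
    · exact W.zero_mem
  refine Submodule.span_induction ?_ ?_ ?_ ?_ hr
  · rintro _ (⟨g, h, w, hw, rfl⟩ | ⟨k, hk, w, hw, rfl⟩)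
    · exact W.sub_mem (W.sub_mem (hs _ _ hw) (hs _ _ (hW _ _ hw))) (hs _ _ hw)
    · exact hs _ _ hw
  · exact W.zero_mem
  · exact fun x y _ _ hx hy => W.add_mem hx hy
  · exact fun a x _ hx => W.smul_mem a hx

/-- The cocycle-type relations have boundary zero, so only the chains on `K` contribute. -/
theorem boundary_mem_of_mem_chainRel {K : Subgroup G} {W : Submodule R V} {r : G →₀ V}
    (hr : r ∈ chainRel ρ K W) : boundary ρ r ∈ coinvSub (ρ.comp K.subtype) W := by
  suffices chainRel ρ K W ≤ (coinvSub (ρ.comp K.subtype) W).comap (boundary ρ) from this hr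
  refine Submodule.span_le.2 ?_
  rintro _ (⟨g, h, w, hw, rfl⟩ | ⟨k, hk, w, hw, rfl⟩)
  · have : boundary ρ (Finsupp.single (g * h) w - Finsupp.single g (ρ h w) -
        Finsupp.single h w) = 0 := by
      rw [map_sub, map_sub, boundary_single, boundary_single, boundary_single, map_mul,
        Module.End.mul_apply]
      abel
    change boundary ρ _ ∈ coinvSub (ρ.comp K.subtype) W
    rw [this]
    exact Submodule.zero_mem _
  · change boundary ρ _ ∈ coinvSub (ρ.comp K.subtype) W
    rw [boundary_single]
    exact Submodule.subset_span ⟨⟨k, hk⟩, w, hw, rfl⟩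

theorem boundary_mem_coinvSub {W : Submodule R V} {c : G →₀ V} (hc : ∀ g, c g ∈ W) :
    boundary ρ c ∈ coinvSub ρ W := by
  rw [boundary, Finsupp.lsum_apply]
  exact Submodule.sum_mem _ fun g _ => sub_mem_coinvSub g (hc g)

theorem exists_boundary_eq {W : Submodule R V} {x : V} (hx : x ∈ coinvSub ρ W) :
    ∃ c : G →₀ V, (∀ g, c g ∈ W) ∧ boundary ρ c = x := by
  classical
  refine Submodule.span_induction ?_ ?_ ?_ ?_ hx
  · rintro _ ⟨g, w, hw, rfl⟩
    refine ⟨Finsupp.single g w, fun g' => ?_, boundary_single ρ g w⟩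
    rw [Finsupp.single_apply]
    split_ifs
    · exact hw
    · exact W.zero_mem
  · exact ⟨0, fun _ => W.zero_mem, map_zero _⟩
  · rintro x y _ _ ⟨c, hc, rfl⟩ ⟨c', hc', rfl⟩
    exact ⟨c + c', fun g => W.add_mem (hc g) (hc' g), map_add _ _ _⟩
  · rintro a x _ ⟨c, hc, rfl⟩
    exact ⟨a • c, fun g => W.smul_mem a (hc g), map_smul _ _ _⟩

theorem boundary_mapRange (p : V →ₗ[R] V) (hp : ∀ g v, p (ρ g v) = ρ g (p v)) (c : G →₀ V) :
    boundary ρ (Finsupp.mapRange.linearMap p c) = p (boundary ρ c) := by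
  suffices boundary ρ ∘ₗ Finsupp.mapRange.linearMap p = p ∘ₗ boundary ρ from
    LinearMap.congr_fun this c
  refine Finsupp.lhom_ext fun g v => ?_
  simp [boundary_single, hp]

variable (ρ) in
/-- Every cycle with values in `W` is a relation; for a smooth subrepresentation `W` this means
`H₁(G, W) = 0`. -/
def CyclesAreTrivial (K : Subgroup G) (W : Submodule R V) : Prop :=
  ∀ c : G →₀ V, (∀ g, c g ∈ W) → boundary ρ c = 0 → c ∈ chainRel ρ K W

theorem coinvSub_le {W : Submodule R V} (hW : ∀ g, ∀ w ∈ W, ρ g w ∈ W) : coinvSub ρ W ≤ W :=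
  Submodule.span_le.2 fun _ ⟨g, w, hw, e⟩ => e ▸ W.sub_mem (hW g w hw) hw

/-- This is right exactness of coinvariants, with `p` in the role of the projection onto `W' / W`.
If `p v` is a combination of elements `g w - w`, lifting the `w` to `W'` changes `v` into an element
of the kernel. -/
theorem le_sup_coinvSub_of_quotient {W W' : Submodule R V} (hW' : ∀ g, ∀ w ∈ W', ρ g w ∈ W')
    (p : V →ₗ[R] V) (hp : ∀ g v, p (ρ g v) = ρ g (p v)) (hWW' : ∀ v ∈ W', p v = 0 → v ∈ W)
    (h0 : W'.map p ≤ coinvSub ρ (W'.map p)) : W' ≤ W ⊔ coinvSub ρ W' := by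
  intro v hv
  rw [coinvSub_map ρ p hp] at h0
  obtain ⟨y, hy, hyv⟩ := h0 ⟨v, hv, rfl⟩
  refine Submodule.mem_sup.2 ⟨v - y, hWW' _ (W'.sub_mem hv (coinvSub_le hW' hy)) ?_, y, hy,
    sub_add_cancel v y⟩
  rw [map_sub, hyv, sub_self]

/-- This is the connecting map of the long exact sequence. An element of `W` that bounds a chain `c`
in `W'` gives a cycle `p c`. Lifting the triviality of `p c` to a relation `r` in `W'` leaves `c -
r` with values in `W`. The boundary of `r` comes from chains on `K` alone and is handled by `hK`. -/
theorem inf_coinvSub_le_of_quotient {K : Subgroup G} {W W' : Submodule R V}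
    (hW : ∀ g, ∀ w ∈ W, ρ g w ∈ W) (hW' : ∀ g, ∀ w ∈ W', ρ g w ∈ W')
    (p : V →ₗ[R] V) (hp : ∀ g v, p (ρ g v) = ρ g (p v)) (hWW' : ∀ v ∈ W', p v = 0 → v ∈ W)
    (hpW : ∀ v ∈ W, p v = 0)
    (hK : W ⊓ coinvSub (ρ.comp K.subtype) W' ≤ coinvSub (ρ.comp K.subtype) W)
    (h1 : CyclesAreTrivial ρ K (W'.map p)) : W ⊓ coinvSub ρ W' ≤ coinvSub ρ W := by
  rintro v ⟨hvW, hv⟩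
  obtain ⟨c, hc, rfl⟩ := exists_boundary_eq hv
  have h := h1 (Finsupp.mapRange.linearMap p c) (fun g => ⟨c g, hc g, rfl⟩)
    (by rw [boundary_mapRange p hp, hpW _ hvW])
  rw [chainRel_map K p hp] at h
  obtain ⟨r, hr, hrc⟩ := h
  have hcr : ∀ g, (c - r) g ∈ W := fun g => by
    refine hWW' _ (W'.sub_mem (hc g) (apply_mem_of_mem_chainRel hW' hr g)) ?_
    have := DFunLike.congr_fun hrc g
    simp only [Finsupp.mapRange.linearMap_apply, Finsupp.mapRange_apply] at this
    rw [Finsupp.sub_apply, map_sub, this, sub_self]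
  have h2 := boundary_mem_coinvSub (ρ := ρ) hcr
  have h3 : boundary ρ r ∈ W := by
    have h4 := W.sub_mem hvW (coinvSub_le hW h2)
    rwa [map_sub, sub_sub_cancel] at h4
  have h5 := coinvSub_comp_le ρ K.subtype W (hK ⟨h3, boundary_mem_of_mem_chainRel hr⟩)
  have h6 := Submodule.add_mem _ h2 h5
  rwa [map_sub, sub_add_cancel] at h6

end Chains

/-! ### Exactness of invariants and coinvariants for compact groups -/

section Averaging

variable {R : Type*} {K : Type*} {V : Type*} [CommRing R] [Algebra ℂ R] [Group K] [AddCommGroup V]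
  [Module R V] {ρ : Representation R K V}

/-- Normality of `T` makes right multiplication by `k` a permutation of `K ⧸ T`, so the sums for `k
w` and for `w` agree. -/
theorem sum_out_sub_eq_zero {T : Subgroup K} [T.Normal] [Fintype (K ⧸ T)] {w : V}
    (hT : ∀ t ∈ T, ρ t w = w) (k : K) : ∑ q : K ⧸ T, ρ q.out (ρ k w - w) = 0 := by
  simp only [map_sub]
  rw [Finset.sum_sub_distrib, sub_eq_zero]
  refine Fintype.sum_equiv (Equiv.mulRight (k : K ⧸ T)) _ _ fun q => ?_
  rw [← Module.End.mul_apply, ← map_mul]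
  refine (out_apply_eq ρ hT _ _ ?_).symm
  rw [QuotientGroup.mk_mul, QuotientGroup.out_eq']
  rfl

/-- Summing over the quotient by a small normal subgroup kills every `k w - w`, but multiplies an
invariant vector by the index, which is invertible. -/
theorem eq_zero_of_mem_coinvSub {W : Submodule R V} (hW : ∀ w ∈ W, IsFiniteVector ρ w) {x : V}
    (hx : x ∈ coinvSub ρ W) (hxK : ∀ k, ρ k x = x) : x = 0 := by
  -- The statement for all smaller `T` lets the sum of two elements be treated by intersecting their
  -- subgroups.
  have key : ∃ S : Subgroup K, S.Normal ∧ S.FiniteIndex ∧ ∀ T ≤ S, T.Normal →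
      ∀ _ : Fintype (K ⧸ T), ∑ q : K ⧸ T, ρ q.out x = 0 := by
    clear hxK
    refine Submodule.span_induction ?_ ?_ ?_ ?_ hx
    · rintro _ ⟨k, w, hw, rfl⟩
      obtain ⟨S, hSf, hS⟩ := hW w hw
      refine ⟨S.normalCore, inferInstance, inferInstance, fun T hT hTn _ => ?_⟩
      exact sum_out_sub_eq_zero (fun t ht => hS t (S.normalCore_le (hT ht))) k
    · exact ⟨⊤, inferInstance, inferInstance, fun T _ _ _ => by simp⟩
    · rintro x y _ _ ⟨S, hSn, hSf, hS⟩ ⟨S', hSn', hSf', hS'⟩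
      refine ⟨S ⊓ S', inferInstance, inferInstance, fun T hT hTn _ => ?_⟩
      simp only [map_add]
      rw [Finset.sum_add_distrib, hS T (hT.trans inf_le_left) hTn,
        hS' T (hT.trans inf_le_right) hTn, add_zero]
    · rintro a x _ ⟨S, hSn, hSf, hS⟩
      refine ⟨S, hSn, hSf, fun T hT hTn _ => ?_⟩
      simp only [map_smul]
      rw [← Finset.smul_sum, hS T hT hTn, smul_zero]
  obtain ⟨S, hSn, hSf, hS⟩ := key
  have hfin := Fintype.ofFinite (K ⧸ S)
  have h := hS S le_rfl hSn hfin
  simp only [hxK, Finset.sum_const, Finset.card_univ] at h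
  have h2 := inv_natCast_smul (R := R) (Fintype.card_ne_zero (α := K ⧸ S)) x
  rw [← h2, h, smul_zero]

theorem IsFiniteVector.exists_average_mem {W : Submodule R V} {v : V} (hv : IsFiniteVector ρ v)
    (hvW : v ∈ W) : ∃ v', (∀ k, ρ k v' = v') ∧ v - v' ∈ coinvSub ρ W := by
  obtain ⟨v', h1, h2⟩ := hv.exists_average
  refine ⟨v', h1, Submodule.span_mono ?_ h2⟩
  rintro _ ⟨k, rfl⟩
  exact ⟨k, v, hvW, rfl⟩

/-- The vanishing of the first homology of compact groups. -/
theorem inf_coinvSub_le_of_isFiniteVector {W W' : Submodule R V} (hWle : W ≤ W')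
    (hW' : ∀ w ∈ W', IsFiniteVector ρ w) : W ⊓ coinvSub ρ W' ≤ coinvSub ρ W := by
  rintro v ⟨hv, hv'⟩
  obtain ⟨v', h1, h2⟩ := (hW' v (hWle hv)).exists_average_mem hv
  have h3 : v' = 0 := by
    refine eq_zero_of_mem_coinvSub hW' ?_ h1
    have := Submodule.sub_mem _ hv' (coinvSub_mono ρ hWle h2)
    rwa [sub_sub_cancel] at this
  rwa [h3, sub_zero] at h2

/-- The space is the direct sum of the invariants and the kernel of the map to coinvariants.
Averaging shows that they span, and `eq_zero_of_mem_coinvSub` that they meet in zero; `E` is the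
projection to the first summand. -/
theorem exists_projection (h : ∀ v, IsFiniteVector ρ v) : ∃ E : V →ₗ[R] V,
    (∀ k v, ρ k (E v) = E v) ∧ (∀ k v, E (ρ k v) = E v) ∧ (∀ v, (∀ k, ρ k v = v) → E v = v) ∧
    ∀ v, v - E v ∈ Submodule.span R (Set.range fun k => ρ k v - v) := by
  have hle : ∀ v, Submodule.span R (Set.range fun k => ρ k v - v) ≤ coinvSub ρ ⊤ := fun v => by
    refine Submodule.span_mono ?_
    rintro _ ⟨k, rfl⟩
    exact ⟨k, v, trivial, rfl⟩
  have hc : IsCompl ρ.invariants (coinvSub ρ ⊤) := by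
    constructor
    · rw [Submodule.disjoint_def]
      exact fun x hx hx' => eq_zero_of_mem_coinvSub (fun w _ => h w) hx' hx
    · rw [codisjoint_iff, eq_top_iff]
      intro v _
      obtain ⟨v', h1, h2⟩ := (h v).exists_average
      exact Submodule.mem_sup.2 ⟨v', h1, _, hle v h2, add_sub_cancel _ _⟩
  let E : V →ₗ[R] V := ρ.invariants.subtype ∘ₗ Submodule.projectionOnto _ _ hc
  have hE1 : ∀ k v, ρ k (E v) = E v := fun k v =>
    (Submodule.projectionOnto _ _ hc v).2 k
  have hE3 : ∀ v, (∀ k, ρ k v = v) → E v = v := fun v hv =>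
    congrArg Subtype.val (Submodule.projectionOnto_apply_left hc ⟨v, hv⟩)
  have hE0 : ∀ v ∈ coinvSub ρ ⊤, E v = 0 := fun v hv =>
    congrArg Subtype.val (Submodule.projectionOnto_apply_right hc ⟨v, hv⟩)
  refine ⟨E, hE1, fun k v => ?_, hE3, fun v => ?_⟩
  · have := hE0 _ (sub_mem_coinvSub k (Submodule.mem_top (x := v)))
    rwa [map_sub, sub_eq_zero] at this
  · obtain ⟨v', h1, h2⟩ := (h v).exists_average
    have := hE0 _ (hle v h2)
    rw [map_sub, hE3 v' h1, sub_eq_zero] at this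
    rwa [this]

end Averaging

/-! ### Constructible sets and invariant clopen subsets of strata -/

section Topology

/-- Induction on the number of locally closed pieces. A piece inside the closure of the others does
not change the closure and can be dropped. Otherwise, off the closure of the others only this piece
is seen, and it is locally closed. -/
theorem exists_isOpen_inter_closure_subset {Y : Type*} [TopologicalSpace Y] {Γ : Set Y}
    (hΓ : IsConstructibleSet Γ) (hne : Γ.Nonempty) :
    ∃ O : Set Y, IsOpen O ∧ (O ∩ Γ).Nonempty ∧ O ∩ closure Γ ⊆ Γ := by
  obtain ⟨𝒞, h𝒞, hlc, rfl⟩ := hΓ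
  induction 𝒞, h𝒞 using Set.Finite.induction_on with
  | empty => simp at hne
  | @insert C 𝒞 _ _ ih =>
    rw [Set.sUnion_insert] at hne ⊢
    by_cases h : C ⊆ closure (⋃₀ 𝒞)
    · have hcl : closure (C ∪ ⋃₀ 𝒞) = closure (⋃₀ 𝒞) := by
        rw [closure_union, Set.union_eq_right]
        exact closure_minimal h isClosed_closure
      have hne' : (⋃₀ 𝒞).Nonempty := by
        rw [← closure_nonempty_iff, ← hcl, closure_nonempty_iff]
        exact hne
      obtain ⟨O, hO, h1, h2⟩ := ih (fun C hC => hlc C (Set.mem_insert_of_mem _ hC)) hne'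
      exact ⟨O, hO, h1.mono (Set.inter_subset_inter_right _ Set.subset_union_right),
        by rw [hcl]; exact h2.trans Set.subset_union_right⟩
    · obtain ⟨x, hxC, hx⟩ := Set.not_subset.1 h
      obtain ⟨O, F, hO, hF, rfl⟩ := hlc C (Set.mem_insert _ _)
      refine ⟨O ∩ (closure (⋃₀ 𝒞))ᶜ, hO.inter isClosed_closure.isOpen_compl,
        ⟨x, ⟨hxC.1, hx⟩, Or.inl hxC⟩, ?_⟩
      rintro y ⟨⟨hyO, hy⟩, hy'⟩
      rw [closure_union] at hy'
      rcases hy' with hy' | hy'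
      · exact Or.inl ⟨hyO, closure_minimal Set.inter_subset_right hF hy'⟩
      · exact absurd hy' hy

variable {G : Type*} {X : Type*} [Group G] [TopologicalSpace G] [TopologicalSpace X]
  [MulAction G X]

/-- A subset of `Y` that is open and closed relative to `Y`, and invariant. -/
structure IsInvariantClopenIn (G : Type*) {X : Type*} [Group G] [TopologicalSpace X]
    [MulAction G X] (Y E : Set X) : Prop where
  subset : E ⊆ Y
  smul_mem : ∀ (g : G), ∀ x ∈ E, g • x ∈ E
  isOpen : ∀ x ∈ E, ∀ᶠ y in 𝓝 x, y ∈ Y → y ∈ E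
  isClosed : ∀ x ∈ Y, x ∉ E → ∀ᶠ y in 𝓝 x, y ∈ Y → y ∉ E

theorem IsInvariantClopenIn.union {Y E E' : Set X} (h : IsInvariantClopenIn G Y E)
    (h' : IsInvariantClopenIn G Y E') : IsInvariantClopenIn G Y (E ∪ E') where
  subset := Set.union_subset h.subset h'.subset
  smul_mem g x hx := hx.imp (h.smul_mem g x) (h'.smul_mem g x)
  isOpen x hx := by
    rcases hx with hx | hx
    · filter_upwards [h.isOpen x hx] with y hy hyY using Or.inl (hy hyY)
    · filter_upwards [h'.isOpen x hx] with y hy hyY using Or.inr (hy hyY)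
  isClosed x hxY hx := by
    filter_upwards [h.isClosed x hxY fun h => hx (Or.inl h),
      h'.isClosed x hxY fun h => hx (Or.inr h)] with y h1 h2 hyY h3
    exact h3.elim (h1 hyY) (h2 hyY)

theorem IsInvariantClopenIn.diff {Y E E' : Set X} (h : IsInvariantClopenIn G Y E)
    (h' : IsInvariantClopenIn G Y E') : IsInvariantClopenIn G Y (E \ E') where
  subset := Set.sdiff_subset.trans h.subset
  smul_mem g x hx := ⟨h.smul_mem g x hx.1, fun hg => hx.2 (by simpa using h'.smul_mem g⁻¹ _ hg)⟩
  isOpen x hx := by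
    filter_upwards [h.isOpen x hx.1, h'.isClosed x (h.subset hx.1) hx.2] with y h1 h2 hyY
    exact ⟨h1 hyY, h2 hyY⟩
  isClosed x hxY hx := by
    by_cases hxE : x ∈ E
    · have hxE' : x ∈ E' := by
        by_contra hc
        exact hx ⟨hxE, hc⟩
      filter_upwards [h'.isOpen x hxE'] with y h1 hyY h2 using h2.2 (h1 hyY)
    · filter_upwards [h.isClosed x hxY hxE] with y h1 hyY h2 using h1 hyY h2.1

variable (G) in
/-- An invariant locally compact subset with a closed orbit relation, which is the saturation of a
compact subset. -/
structure IsStratum (Y : Set X) : Prop where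
  smul_mem : ∀ (g : G), ∀ x ∈ Y, g • x ∈ Y
  exists_nhds : ∀ x ∈ Y, ∀ N ∈ 𝓝 x, ∃ A ⊆ N, IsOpen A ∧ x ∈ A ∧ IsCompact (A ∩ Y)
  separated : ∀ x ∈ Y, ∀ y ∈ Y, y ∉ MulAction.orbit G x →
    ∀ᶠ p : X × X in 𝓝 (x, y), p.1 ∈ Y → p.2 ∈ Y → p.2 ∉ MulAction.orbit G p.1
  exists_compact : ∃ N ⊆ Y, IsCompact N ∧ ∀ y ∈ Y, ∃ x ∈ N, y ∈ MulAction.orbit G x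

/-- Compactness of `C` together with the closed orbit relation: saturations of compact sets are
relatively closed. -/
theorem IsStratum.eventually_notMem_orbit {Y : Set X} (hY : IsStratum G Y) {C : Set X}
    (hC : IsCompact C) (hCY : C ⊆ Y) {y : X} (hy : y ∈ Y)
    (hyC : ∀ c ∈ C, y ∉ MulAction.orbit G c) :
    ∀ᶠ b in 𝓝 y, ∀ c ∈ C, b ∈ Y → b ∉ MulAction.orbit G c := by
  refine hC.eventually_forall_of_forall_eventually fun c hc => ?_
  have h := hY.separated c (hCY hc) y hy (hyC c hc)
  have h' : Filter.Tendsto (Prod.swap : X × X → X × X) (𝓝 (y, c)) (𝓝 (c, y)) :=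
    continuous_swap.tendsto (y, c)
  have hq : ∀ᶠ p : X × X in 𝓝 (y, c), p.2 ∈ Y → p.1 ∈ Y → p.1 ∉ MulAction.orbit G p.2 :=
    h'.eventually h
  filter_upwards [hq] with p hp
  intro h1
  by_cases h2 : p.2 ∈ Y
  · exact hp h2 h1
  · intro h3
    obtain ⟨g, hg⟩ := h3
    apply h2
    have := hY.smul_mem g⁻¹ _ h1
    rwa [← hg, inv_smul_smul] at this

variable [ContinuousSMul G X]

/-- `E` is the saturation of a small relatively compact open neighbourhood of `z` in `Y`. It is open
as a union of translates, and closed because the orbit relation is closed. The neighbourhood is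
small enough that no orbit through it meets `S`. -/
theorem IsStratum.exists_invariantClopen {Y : Set X} (hY : IsStratum G Y) {S : Set X}
    (hS : IsCompact S) (hSY : S ⊆ Y) {z : X} (hz : z ∈ Y)
    (hzS : ∀ x ∈ S, x ∉ MulAction.orbit G z) :
    ∃ E, IsInvariantClopenIn G Y E ∧ z ∈ E ∧ Disjoint E S := by
  have h1 := hY.eventually_notMem_orbit hS hSY hz fun c hc h =>
    hzS c hc (MulAction.orbit_eq_iff.2 h ▸ MulAction.mem_orbit_self c)
  obtain ⟨A, hAN, hA, hzA, hAc⟩ := hY.exists_nhds z hz _ h1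
  refine ⟨{x | ∃ a ∈ A ∩ Y, x ∈ MulAction.orbit G a}, ⟨?_, ?_, ?_, ?_⟩,
    ⟨z, ⟨hzA, hz⟩, MulAction.mem_orbit_self z⟩, ?_⟩
  · rintro _ ⟨a, ha, g, rfl⟩
    exact hY.smul_mem g a ha.2
  · rintro g x ⟨a, ha, hx⟩
    exact ⟨a, ha, MulAction.mem_orbit_of_mem_orbit g hx⟩
  · rintro _ ⟨a, ha, g, rfl⟩
    have hc : Filter.Tendsto (fun y : X => g⁻¹ • y) (𝓝 (g • a)) (𝓝 a) := by
      simpa using (continuous_const_smul g⁻¹ : Continuous fun y : X => g⁻¹ • y).tendsto (g • a)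
    filter_upwards [hc (hA.mem_nhds ha.1)] with y hy hyY
    exact ⟨g⁻¹ • y, ⟨hy, hY.smul_mem _ _ hyY⟩, g, smul_inv_smul g y⟩
  · intro x hxY hx
    have h2 := hY.eventually_notMem_orbit hAc Set.inter_subset_right hxY fun c hc h =>
      hx ⟨c, hc, h⟩
    filter_upwards [h2] with y hy hyY
    rintro ⟨a, ha, h⟩
    exact hy a ha hyY h
  · rw [Set.disjoint_left]
    rintro x ⟨a, ha, hx⟩ hxS
    refine hAN ha.1 x hxS ha.2 ?_
    exact MulAction.orbit_eq_iff.2 hx ▸ MulAction.mem_orbit_self a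

end Topology

namespace EquivariantLineBundle

/-! ### Localisation over the orbit space of a stratum -/

section Strata

variable {R : Type u} {G : Type v} {X : Type w} [CommRing R] [Group G]
    [TopologicalSpace G] [TopologicalSpace X] [MulAction G X] [T2Space X]
    (L : EquivariantLineBundle.{u, v, w, t} R G X)

theorem cut_mem_sec_of_eventually {Y' Y : Set X} (hY' : Y' ⊆ Y)
    (h : ∀ x ∈ Y, x ∉ Y' → ∀ᶠ y in 𝓝 x, y ∈ Y → y ∉ Y') {s : ∀ x, L.Fiber x}
    (hs : s ∈ L.sec Y) : L.cut Y' s ∈ L.sec Y' := by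
  refine L.cut_mem_sec (F := closure Y') isClosed_closure ?_ hs
  refine Set.Subset.antisymm ?_ fun x hx => ⟨hY' hx, subset_closure hx⟩
  rintro x ⟨hxY, hx⟩
  by_contra hx'
  obtain ⟨y, hy, hy'⟩ := mem_closure_iff_nhds.1 hx _ (h x hxY hx')
  exact hy (hY' hy') hy'

theorem sec_mono_of_eventually {Y' Y : Set X} (hY' : Y' ⊆ Y)
    (h : ∀ x ∈ Y', ∀ᶠ y in 𝓝 x, y ∈ Y → y ∈ Y') : L.sec Y' ≤ L.sec Y := by
  refine L.sec_mono (V := interior {y | y ∈ Y → y ∈ Y'}) isOpen_interior ?_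
  refine Set.Subset.antisymm ?_ fun x hx => ⟨hY' hx, mem_interior_iff_mem_nhds.2 (h x hx)⟩
  rintro x ⟨hxY, hx⟩
  exact interior_subset hx hxY

/-- Local constancy in charts makes the zero set relatively open, so the support is the nonvanishing
locus itself, without closure. -/
theorem isCompact_ne_zero {Y : Set X} {s : ∀ x, L.Fiber x} (hs : s ∈ L.sec Y) :
    IsCompact {x | s x ≠ 0} := by
  obtain ⟨hcs, C, hCY, hC, hsC⟩ := hs
  have hsub : {x | s x ≠ 0} ⊆ C := fun x hx => by
    by_contra h
    exact hx (hsC x h)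
  refine hC.of_isClosed_subset (isClosed_of_closure_subset fun x hx => ?_) hsub
  have hxY : x ∈ Y := hCY (closure_minimal hsub hC.isClosed hx)
  intro h0
  obtain ⟨U, φ, hU, hxU, hφ, hn⟩ := L.exists_chart x
  have h := (L.continuousWithinAt_toTotal_iff hxU hn Y s).1 (hcs x hxY)
  rw [eventually_nhdsWithin_iff] at h
  obtain ⟨y, hy, hy'⟩ := mem_closure_iff_nhds.1 hx _ (Filter.inter_mem h (hU.mem_nhds hxU))
  refine hy' ((hφ y hy.2).1 ?_)
  rw [map_zero, hy.1 (hCY (hsub hy')), h0, map_zero]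

theorem ne_zero_subset {Y : Set X} {s : ∀ x, L.Fiber x} (hs : s ∈ L.sec Y) :
    {x | s x ≠ 0} ⊆ Y := fun _ hx => by
  by_contra h
  exact hx (L.sec_zero_of_notMem hs h)

theorem cut_mem_sec_of_invariantClopen {Y E : Set X} (hE : IsInvariantClopenIn G Y E)
    {s : ∀ x, L.Fiber x} (hs : s ∈ L.sec Y) : L.cut E s ∈ L.sec Y :=
  L.sec_mono_of_eventually hE.subset hE.isOpen
    (L.cut_mem_sec_of_eventually hE.subset hE.isClosed hs)

variable [ContinuousSMul G X]

/-- Families of sections over a stratum belong to a submodule if they do so orbit by orbit. -/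
theorem mem_of_forall_orbit {Y : Set X} (hY : IsStratum G Y) {ι : Type*}
    (P : Submodule R (ι →₀ ∀ x, L.Fiber x))
    (hP : ∀ E, IsInvariantClopenIn G Y E → ∀ p ∈ P, Finsupp.mapRange.linearMap (L.cut E) p ∈ P)
    (c : ι →₀ ∀ x, L.Fiber x) (hc : ∀ i, c i ∈ L.sec Y)
    (h : ∀ z ∈ Y, ∃ p ∈ P, (∀ i, p i ∈ L.sec Y) ∧
      ∀ i, L.cut (MulAction.orbit G z) (p i) = L.cut (MulAction.orbit G z) (c i)) : c ∈ P := by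
  have hloc : ∀ z ∈ Y, ∃ E, IsInvariantClopenIn G Y E ∧ z ∈ E ∧
      Finsupp.mapRange.linearMap (L.cut E) c ∈ P := by
    intro z hz
    obtain ⟨p, hpP, hpY, hpc⟩ := h z hz
    have hd : ∀ i, (c - p) i ∈ L.sec Y := fun i => (L.sec Y).sub_mem (hc i) (hpY i)
    -- `S` is where `c` and `p` differ. It is compact and misses the orbit of `z`, so `c` and `p`
    -- agree on some invariant clopen set around that orbit.
    obtain ⟨E, hE, hzE, hES⟩ := hY.exists_invariantClopen
      (S := ⋃ i ∈ (c - p).support, {x | (c - p) i x ≠ 0})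
      ((c - p).support.isCompact_biUnion fun i _ => L.isCompact_ne_zero (hd i))
      (Set.iUnion₂_subset fun i _ => L.ne_zero_subset (hd i)) hz (by
        intro x hx hxz
        simp only [Set.mem_iUnion] at hx
        obtain ⟨i, -, hx⟩ := hx
        refine hx ?_
        have h1 := congrFun (hpc i) x
        rw [L.cut_of_mem _ hxz, L.cut_of_mem _ hxz] at h1
        rw [Finsupp.sub_apply, Pi.sub_apply, h1, sub_self])
    refine ⟨E, hE, hzE, ?_⟩
    have : Finsupp.mapRange.linearMap (L.cut E) c = Finsupp.mapRange.linearMap (L.cut E) p := by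
      rw [← sub_eq_zero, ← map_sub]
      refine Finsupp.ext fun i => ?_
      refine L.cut_eq_zero fun x hx => ?_
      by_contra h0
      refine Set.disjoint_left.1 hES hx ?_
      simp only [Set.mem_iUnion]
      refine ⟨i, Finsupp.mem_support_iff.2 fun h1 => h0 ?_, h0⟩
      rw [h1]; rfl
    rw [this]
    exact hP E hE p hpP
  obtain ⟨N, hNY, hN, hNG⟩ := hY.exists_compact
  have key : ∃ E, IsInvariantClopenIn G Y E ∧ N ⊆ E ∧
      Finsupp.mapRange.linearMap (L.cut E) c ∈ P := by
    refine hN.induction_on (p := fun S => ∃ E, IsInvariantClopenIn G Y E ∧ S ⊆ E ∧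
      Finsupp.mapRange.linearMap (L.cut E) c ∈ P) ?_ ?_ ?_ ?_
    · refine ⟨∅, ⟨Set.empty_subset _, fun _ _ h => h.elim, fun _ h => h.elim,
        fun _ _ _ => Filter.Eventually.of_forall fun _ _ h => h.elim⟩, subset_rfl, ?_⟩
      have : L.cut ∅ = 0 := LinearMap.ext fun s => L.cut_eq_zero fun x hx => hx.elim
      rw [this]
      convert P.zero_mem
      refine Finsupp.ext fun i => ?_
      simp
    · rintro S T hST ⟨E, hE, hTE, hEP⟩
      exact ⟨E, hE, hST.trans hTE, hEP⟩
    · rintro S T ⟨E, hE, hTE, hEP⟩ ⟨E', hE', hTE', hEP'⟩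
      refine ⟨E ∪ E', hE.union hE', Set.union_subset_union hTE hTE', ?_⟩
      have : Finsupp.mapRange.linearMap (L.cut (E ∪ E')) c =
          Finsupp.mapRange.linearMap (L.cut E) c + Finsupp.mapRange.linearMap (L.cut (E' \ E))
            (Finsupp.mapRange.linearMap (L.cut E') c) := by
        refine Finsupp.ext fun i => ?_
        simp only [Finsupp.mapRange.linearMap_apply, Finsupp.mapRange_apply, Finsupp.add_apply]
        rw [cut_union, cut_cut, Set.inter_eq_left.2 Set.sdiff_subset]
      rw [this]
      exact P.add_mem hEP (hP _ (hE'.diff hE) _ hEP')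
    · intro x hx
      obtain ⟨E, hE, hxE, hEP⟩ := hloc x (hNY hx)
      refine ⟨E ∩ N, ?_, E, hE, Set.inter_subset_left, hEP⟩
      rw [mem_nhdsWithin_iff_eventually]
      filter_upwards [hE.isOpen x hxE] with y hy hyN using ⟨hy (hNY hyN), hyN⟩
  obtain ⟨E, hE, hNE, hEP⟩ := key
  convert hEP
  refine Finsupp.ext fun i => (L.cut_eq_self fun x hx => ?_).symm
  refine L.sec_zero_of_notMem (hc i) fun hxY => hx ?_
  obtain ⟨n, hn, g, rfl⟩ := hNG x hxY
  exact hE.smul_mem g n (hNE hn)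

theorem mem_orbit_smul (z : X) (g : G) (x : X) (hx : x ∈ MulAction.orbit G z) :
    g • x ∈ MulAction.orbit G z := MulAction.mem_orbit_of_mem_orbit g hx

variable [LocallyCompactSpace X] [TotallyDisconnectedSpace X]

/-- Restriction to a relatively closed subset is surjective: extend to the ambient open set, then
cut back to `Y`. -/
theorem map_cut_sec {U F Y Y' : Set X} (hU : IsOpen U) (hF : IsClosed F) (hY : U ∩ F = Y)
    (hY' : Y' ⊆ Y) (h : ∀ x ∈ Y, x ∉ Y' → ∀ᶠ y in 𝓝 x, y ∈ Y → y ∉ Y') :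
    (L.sec Y).map (L.cut Y') = L.sec Y' := by
  refine le_antisymm ?_ fun s hs => ?_
  · rintro _ ⟨s, hs, rfl⟩
    exact L.cut_mem_sec_of_eventually hY' h hs
  · have hYU : Y ⊆ U := hY ▸ Set.inter_subset_left
    obtain ⟨s', hs', rfl⟩ := L.exists_extension hU (hY'.trans hYU) hs
    refine ⟨L.cut Y s', L.cut_mem_sec hF hY hs', ?_⟩
    rw [cut_cut, Set.inter_eq_left.2 hY']

theorem map_cut_orbit {U F Y : Set X} (hU : IsOpen U) (hF : IsClosed F) (hUF : U ∩ F = Y)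
    (hY : IsStratum G Y) {z : X} (hz : z ∈ Y) :
    (L.sec Y).map (L.cut (MulAction.orbit G z)) = L.sec (MulAction.orbit G z) := by
  refine L.map_cut_sec hU hF hUF ?_ ?_
  · rintro _ ⟨g, rfl⟩
    exact hY.smul_mem g z hz
  · intro x hxY hx
    have h := hY.eventually_notMem_orbit (C := {z}) isCompact_singleton
      (Set.singleton_subset_iff.2 hz) hxY (by simpa using hx)
    filter_upwards [h] with y hy hyY using hy z rfl hyY

/-- Vanishing of `H₀` over an orbit writes the restriction of `s` as a combination of `g w - w`. As
restriction is surjective, this lifts to an element of the coinvariant kernel over `Y` that agrees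
with `s` on the orbit. -/
theorem sec_le_coinvSub_of_forall_orbit {U F Y : Set X} (hU : IsOpen U) (hF : IsClosed F)
    (hUF : U ∩ F = Y) (hY : IsStratum G Y)
    (h : ∀ z ∈ Y, L.sec (MulAction.orbit G z) ≤
      coinvSub L.translateRep (L.sec (MulAction.orbit G z))) :
    L.sec Y ≤ coinvSub L.translateRep (L.sec Y) := by
  intro s hs
  -- A single section is treated as a family indexed by `Unit`.
  have key := L.mem_of_forall_orbit hY (ι := Unit)
    ((coinvSub L.translateRep (L.sec Y)).comap (Finsupp.lapply ())) ?_ (Finsupp.single () s)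
    (fun _ => by simpa using hs) ?_
  · simpa using key
  · intro E hE p hp
    have h1 : L.cut E (p ()) ∈ (coinvSub L.translateRep (L.sec Y)).map (L.cut E) := ⟨_, hp, rfl⟩
    rw [← coinvSub_map _ _ (L.cut_translateRep hE.smul_mem)] at h1
    refine coinvSub_mono _ ?_ h1
    rintro _ ⟨s, hs, rfl⟩
    exact L.cut_mem_sec_of_invariantClopen hE hs
  · intro z hz
    have h1 := h z hz
    rw [← L.map_cut_orbit hU hF hUF hY hz,
      coinvSub_map _ _ (L.cut_translateRep (mem_orbit_smul z))] at h1
    obtain ⟨p, hp, hps⟩ := h1 ⟨s, hs, rfl⟩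
    refine ⟨Finsupp.single () p, by simpa using hp, fun _ => ?_, fun _ => by simpa using hps⟩
    simpa using coinvSub_le (fun g s hs => L.translateRep_mem_sec_of_invariant hY.smul_mem g hs) hp

/-- Restriction to an orbit commutes with `G`, so it sends cycles to cycles. The relation found over
the orbit lifts to one over `Y`, which is the family required by `mem_of_forall_orbit`. -/
theorem cyclesAreTrivial_of_forall_orbit {U F Y : Set X} (hU : IsOpen U) (hF : IsClosed F)
    (hUF : U ∩ F = Y) (hY : IsStratum G Y) (K : Subgroup G)
    (h : ∀ z ∈ Y, CyclesAreTrivial L.translateRep K (L.sec (MulAction.orbit G z))) :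
    CyclesAreTrivial L.translateRep K (L.sec Y) := by
  intro c hc hc0
  refine L.mem_of_forall_orbit hY _ ?_ c hc ?_
  · intro E hE p hp
    have h1 := Submodule.mem_map_of_mem (f := Finsupp.mapRange.linearMap (L.cut E)) hp
    rw [← chainRel_map K _ (L.cut_translateRep hE.smul_mem)] at h1
    refine chainRel_mono ?_ h1
    rintro _ ⟨s, hs, rfl⟩
    exact L.cut_mem_sec_of_invariantClopen hE hs
  · intro z hz
    have hm := L.map_cut_orbit hU hF hUF hY hz
    have hcut := L.cut_translateRep (mem_orbit_smul (G := G) z)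
    have h1 := h z hz (Finsupp.mapRange.linearMap (L.cut (MulAction.orbit G z)) c)
      (fun g => hm.le ⟨c g, hc g, rfl⟩) (by rw [boundary_mapRange _ hcut, hc0, map_zero])
    rw [← hm, chainRel_map K _ hcut] at h1
    obtain ⟨p, hp, hpc⟩ := h1
    exact ⟨p, hp, apply_mem_of_mem_chainRel
      (fun g s hs => L.translateRep_mem_sec_of_invariant hY.smul_mem g hs) hp,
      fun i => DFunLike.congr_fun hpc i⟩

end Strata

end EquivariantLineBundle

/-! ### Existence of strata, and induction over invariant open sets -/

section ExistsStratum

variable {G : Type v} {X : Type w} [Group G] [TopologicalSpace G] [TopologicalSpace X]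
  [MulAction G X] [ContinuousSMul G X]

theorem isConstructibleSet_orbitRel {Z : SubMulAction G X} (hZ : IsClosed (Z : Set X))
    (hZG : IsConstructibleAction G Z) {F : Set X} (hF : IsClosed F) (hFZ : F ⊆ Z) :
    IsConstructibleSet {p : X × X | p.1 ∈ F ∧ p.2 ∈ MulAction.orbit G p.1} := by
  obtain ⟨𝒞, h𝒞, hlc, hΓ⟩ := hZG
  have hι : IsClosedEmbedding (Prod.map Subtype.val Subtype.val : Z × Z → X × X) :=
    hZ.isClosedEmbedding_subtypeVal.prodMap hZ.isClosedEmbedding_subtypeVal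
  refine ⟨(fun C => Prod.map Subtype.val Subtype.val '' C ∩ {p : X × X | p.1 ∈ F}) '' 𝒞,
    h𝒞.image _, ?_, ?_⟩
  · rintro _ ⟨C, hC, rfl⟩
    exact ((hlc C hC).image hι.isInducing hι.isClosed_range.isLocallyClosed).inter
      (hF.preimage continuous_fst).isLocallyClosed
  · ext p
    constructor
    · rintro ⟨_, ⟨C, hC, rfl⟩, ⟨q, hq, rfl⟩, hp⟩
      have h1 : q ∈ ⋃₀ 𝒞 := ⟨C, hC, hq⟩
      rw [hΓ] at h1
      obtain ⟨g, hg⟩ := h1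
      exact ⟨hp, g, by rw [Prod.map_snd, hg]; rfl⟩
    · rintro ⟨hp, g, hg⟩
      have h1 : ((⟨p.1, hFZ hp⟩, g • ⟨p.1, hFZ hp⟩) : Z × Z) ∈ ⋃₀ 𝒞 := by
        rw [hΓ]
        exact ⟨g, rfl⟩
      obtain ⟨C, hC, hq⟩ := h1
      exact ⟨_, ⟨C, hC, rfl⟩, ⟨_, hq, Prod.ext rfl hg⟩, hp⟩

variable [T2Space X] [LocallyCompactSpace X] [TotallyDisconnectedSpace X]

/-- Over `F` the orbit relation is constructible, hence relatively closed in some open set around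
one of its points `(x, g x)`. As the relation is stable under `G × G`, it is also relatively closed
near `(x, x)`, and then over the saturation `V` of a small compact open `B ∋ x`. -/
theorem exists_isStratum {Z : SubMulAction G X} (hZ : IsClosed (Z : Set X))
    (hZG : IsConstructibleAction G Z) {F : Set X} (hF : IsClosed F) (hFZ : F ⊆ Z)
    (hFG : ∀ (g : G), ∀ x ∈ F, g • x ∈ F) (hne : F.Nonempty) :
    ∃ V : Set X, IsOpen V ∧ (∀ (g : G), ∀ x ∈ V, g • x ∈ V) ∧ (V ∩ F).Nonempty ∧
      IsStratum G (V ∩ F) := by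
  obtain ⟨O, hO, ⟨⟨x, y⟩, hxyO, hxF, g, hg⟩, hOΓ⟩ := exists_isOpen_inter_closure_subset
    (isConstructibleSet_orbitRel hZ hZG hF hFZ)
    (hne.elim fun x hx => ⟨(x, x), hx, MulAction.mem_orbit_self x⟩)
  set Γ : Set (X × X) := {p : X × X | p.1 ∈ F ∧ p.2 ∈ MulAction.orbit G p.1} with hΓ
  change g • x = y at hg
  subst hg
  change x ∈ F at hxF
  have hcont : Continuous fun p : X × X => (p.1, g • p.2) := by fun_prop
  obtain ⟨N₁, hN₁, N₂, hN₂, hNO⟩ := mem_nhds_prod_iff.1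
    ((hO.preimage hcont).mem_nhds (show (x, x) ∈ _ from hxyO))
  obtain ⟨N, hN, hxN, hNN⟩ := (loc_compact_Haus_tot_disc_of_zero_dim (H := X)).mem_nhds_iff.1
    (Filter.inter_mem hN₁ hN₂)
  obtain ⟨C, hC, hCN, hCc⟩ := LocallyCompactSpace.local_compact_nhds x N
    ((show IsClopen N from hN).2.mem_nhds hxN)
  obtain ⟨B, hB, hxB, hBC⟩ := (loc_compact_Haus_tot_disc_of_zero_dim (H := X)).mem_nhds_iff.1 hC
  have hBo : IsClopen B := hB
  have hBc : IsCompact B := hCc.of_isClosed_subset hBo.1 hBC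
  have hBN := (hBC.trans hCN).trans hNN
  -- The product `B × g B` lies in the open set where the relation is closed; moving the second
  -- factor by `g` brings this back to `B × B`.
  have hclosed : ∀ a ∈ B, ∀ b ∈ B, a ∈ F → b ∉ MulAction.orbit G a →
      ∀ᶠ p : X × X in 𝓝 (a, b), p.1 ∈ F → p.2 ∉ MulAction.orbit G p.1 := by
    intro a ha b hb haF hab
    have h1 : (a, g • b) ∉ closure Γ := fun h => by
      have h2 : (a, g • b) ∈ Γ := hOΓ ⟨hNO (show (a, b) ∈ _ from ⟨(hBN ha).1, (hBN hb).2⟩), h⟩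
      refine hab ?_
      have h3 : g • b ∈ MulAction.orbit G a := h2.2
      have := MulAction.mem_orbit_of_mem_orbit g⁻¹ h3
      rwa [inv_smul_smul] at this
    have h2 : ∀ᶠ p : X × X in 𝓝 (a, b), (p.1, g • p.2) ∉ closure Γ :=
      (isClosed_closure.isOpen_compl.preimage hcont).mem_nhds h1
    filter_upwards [h2] with p hp hpF hpo
    exact hp (subset_closure ⟨hpF, MulAction.mem_orbit_of_mem_orbit g hpo⟩)
  let V : Set X := ⋃ γ : G, γ • B
  have hVo : IsOpen V := isOpen_iUnion fun γ => hBo.2.smul γ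
  have hVG : ∀ (γ : G), ∀ x ∈ V, γ • x ∈ V := by
    intro γ x hx
    obtain ⟨γ', hx⟩ := Set.mem_iUnion.1 hx
    refine Set.mem_iUnion.2 ⟨γ * γ', ?_⟩
    rw [mul_smul]
    exact Set.smul_mem_smul_set hx
  have hBV : B ⊆ V := fun b hb => Set.mem_iUnion.2 ⟨1, by rwa [one_smul]⟩
  have hVex : ∀ y ∈ V ∩ F, ∃ γ : G, ∃ b ∈ B, b ∈ F ∧ γ • b = y := by
    rintro y ⟨hy, hyF⟩
    obtain ⟨γ, b, hb, rfl⟩ := Set.mem_iUnion.1 hy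
    exact ⟨γ, b, hb, by simpa using hFG γ⁻¹ _ hyF, rfl⟩
  refine ⟨V, hVo, hVG, ⟨x, hBV hxB, hxF⟩, fun γ y hy => ⟨hVG γ y hy.1, hFG γ y hy.2⟩, ?_, ?_, ?_⟩
  · rintro y ⟨hyV, hyF⟩ N hN
    obtain ⟨C, hC, hCN, hCc⟩ := LocallyCompactSpace.local_compact_nhds y _
      (Filter.inter_mem hN (hVo.mem_nhds hyV))
    obtain ⟨A, hA, hyA, hAC⟩ :=
      (loc_compact_Haus_tot_disc_of_zero_dim (H := X)).mem_nhds_iff.1 hC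
    have hAo : IsClopen A := hA
    refine ⟨A, fun a ha => (hCN (hAC ha)).1, hAo.2, hyA, ?_⟩
    have : A ∩ (V ∩ F) = A ∩ F := by
      ext a
      exact ⟨fun h => ⟨h.1, h.2.2⟩, fun h => ⟨h.1, (hCN (hAC h.1)).2, h.2⟩⟩
    rw [this]
    exact (hCc.of_isClosed_subset hAo.1 hAC).inter_right hF
  · intro y hy y' hy' hyy'
    obtain ⟨γ, b, hb, hbF, rfl⟩ := hVex y hy
    obtain ⟨γ', b', hb', -, rfl⟩ := hVex y' hy'
    have h1 : b' ∉ MulAction.orbit G b := fun h => hyy' (by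
      rw [MulAction.orbit_smul]
      exact MulAction.mem_orbit_of_mem_orbit γ' h)
    have hc : Filter.Tendsto (fun p : X × X => (γ⁻¹ • p.1, γ'⁻¹ • p.2)) (𝓝 (γ • b, γ' • b'))
        (𝓝 (b, b')) := by
      have : Continuous fun p : X × X => (γ⁻¹ • p.1, γ'⁻¹ • p.2) := by fun_prop
      simpa using this.tendsto (γ • b, γ' • b')
    filter_upwards [hc.eventually (hclosed b hb b' hb' hbF h1)] with p hp hp1 _ hpo
    refine hp (hFG _ _ hp1.2) ?_
    rw [MulAction.orbit_smul]
    exact MulAction.mem_orbit_of_mem_orbit γ'⁻¹ hpo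
  · refine ⟨B ∩ F, fun b hb => ⟨hBV hb.1, hb.2⟩, hBc.inter_right hF, fun y hy => ?_⟩
    obtain ⟨γ, b, hb, hbF, rfl⟩ := hVex y hy
    exact ⟨b, ⟨hb, hbF⟩, γ, rfl⟩

theorem invariant_open_induction {P : Set X → Prop} {U₀ : Set X} (hU₀ : IsOpen U₀)
    (hU₀G : ∀ (g : G), ∀ x ∈ U₀, g • x ∈ U₀) (h₀ : P U₀)
    (hchain : ∀ c : Set (Set X), c.Nonempty → IsChain (· ⊆ ·) c →
      (∀ U ∈ c, IsOpen U ∧ (∀ (g : G), ∀ x ∈ U, g • x ∈ U) ∧ U₀ ⊆ U ∧ P U) → P (⋃₀ c))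
    (hstep : ∀ U : Set X, IsOpen U → (∀ (g : G), ∀ x ∈ U, g • x ∈ U) → U₀ ⊆ U → P U →
      Uᶜ.Nonempty → ∃ V, IsOpen V ∧ (∀ (g : G), ∀ x ∈ V, g • x ∈ V) ∧ (V ∩ Uᶜ).Nonempty ∧
        P (U ∪ V)) : P Set.univ := by
  obtain ⟨U, hU₀U, hUmax⟩ := zorn_subset_nonempty
    {U : Set X | IsOpen U ∧ (∀ (g : G), ∀ x ∈ U, g • x ∈ U) ∧ U₀ ⊆ U ∧ P U}
    (fun c hc hch hcn => ⟨⋃₀ c, ⟨isOpen_sUnion fun U hU => (hc hU).1,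
      fun g x ⟨U, hU, hx⟩ => ⟨U, hU, (hc hU).2.1 g x hx⟩,
      hcn.elim fun U hU => (hc hU).2.2.1.trans (Set.subset_sUnion_of_mem hU),
      hchain c hcn hch fun U hU => hc hU⟩, fun U hU => Set.subset_sUnion_of_mem hU⟩)
    U₀ ⟨hU₀, hU₀G, subset_rfl, h₀⟩
  obtain ⟨hUo, hUG, -, hUP⟩ := hUmax.prop
  by_cases hne : Uᶜ.Nonempty
  · obtain ⟨V, hV, hVG, ⟨x, hxV, hxU⟩, hP⟩ := hstep U hUo hUG hU₀U hUP hne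
    have hUV : U ∪ V ⊆ U := hUmax.le_of_ge ⟨hUo.union hV,
      fun g x hx => hx.imp (hUG g x) (hVG g x), hU₀U.trans Set.subset_union_left, hP⟩
      Set.subset_union_left
    exact absurd (hUV (Or.inr hxV)) hxU
  · rw [Set.not_nonempty_iff_eq_empty, Set.compl_empty_iff] at hne
    exact hne ▸ hUP

end ExistsStratum

namespace EquivariantLineBundle

/-! ### Reduction of the two claims to single orbits -/

section Induction

variable {R : Type u} {G : Type v} {X : Type w} [CommRing R] [Algebra ℂ R]
    [Group G] [TopologicalSpace G] [IsTopologicalGroup G]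
    [TopologicalSpace X] [LocallyCompactSpace X] [T2Space X] [TotallyDisconnectedSpace X]
    [MulAction G X] [ContinuousSMul G X]
    (L : EquivariantLineBundle.{u, v, w, t} R G X)

/-- The stabilizer of a smooth vector is open, hence of finite index in a compact group. -/
theorem isFiniteVector_of_mem_sec {Y : Set X} (hY : ∀ (g : G), ∀ x ∈ Y, g • x ∈ Y)
    {s : ∀ x, L.Fiber x} (hs : s ∈ L.sec Y) (K : Subgroup G) (hK : IsCompact (K : Set G)) :
    IsFiniteVector (L.translateRep.comp K.subtype) s := by
  have : CompactSpace K := isCompact_iff_compactSpace.1 hK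
  let S : Subgroup K :=
    { carrier := {k | L.translateRep (k : G) s = s}
      mul_mem' := by
        intro a b ha hb
        change L.translateRep ((a : G) * b) s = s
        rw [map_mul, Module.End.mul_apply, hb, ha]
      one_mem' := by simp
      inv_mem' := by
        intro a ha
        change L.translateRep (a : G)⁻¹ s = s
        conv_lhs => rw [← (show L.translateRep (a : G) s = s from ha)]
        simp }
  have hS : IsOpen (S : Set K) := by
    refine S.isOpen_of_mem_nhds (g := 1) ?_
    exact (continuous_subtype_val.tendsto (1 : K)).eventually (L.eventually_translateRep_eq hY hs)
  have := S.quotient_finite_of_isOpen hS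
  exact ⟨S, Subgroup.finiteIndex_of_finite_quotient, fun k hk => hk⟩

theorem sec_mono_of_isOpen {U U' : Set X} (hU : IsOpen U) (h : U ⊆ U') : L.sec U ≤ L.sec U' :=
  L.sec_mono hU (Set.inter_eq_right.2 h)

/-- The compact support is already covered by one member of the chain. -/
theorem exists_mem_sec_of_isChain {c : Set (Set X)} (hc : c.Nonempty) (hch : IsChain (· ⊆ ·) c)
    (ho : ∀ U ∈ c, IsOpen U) {s : ∀ x, L.Fiber x} (hs : s ∈ L.sec (⋃₀ c)) :
    ∃ U ∈ c, s ∈ L.sec U := by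
  obtain ⟨hcs, C, hCU, hC, hsC⟩ := hs
  have : Nonempty c := hc.to_subtype
  obtain ⟨U, hU⟩ := hC.elim_directed_cover (fun U : c => (U : Set X)) (fun U => ho U U.2)
    (by rwa [← Set.sUnion_eq_iUnion]) (directedOn_iff_directed.1 hch.directedOn)
  exact ⟨U, U.2, hcs.mono (Set.subset_sUnion_of_mem U.2), C, hU, hC, hsC⟩

theorem exists_mem_coinvSub_of_isChain {c : Set (Set X)} (hc : c.Nonempty)
    (hch : IsChain (· ⊆ ·) c) (ho : ∀ U ∈ c, IsOpen U) {s : ∀ x, L.Fiber x}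
    (hs : s ∈ coinvSub L.translateRep (L.sec (⋃₀ c))) :
    ∃ U ∈ c, s ∈ coinvSub L.translateRep (L.sec U) := by
  refine Submodule.span_induction ?_ ?_ ?_ ?_ hs
  · rintro _ ⟨g, s, hs, rfl⟩
    obtain ⟨U, hU, hsU⟩ := L.exists_mem_sec_of_isChain hc hch ho hs
    exact ⟨U, hU, sub_mem_coinvSub g hsU⟩
  · exact hc.elim fun U hU => ⟨U, hU, Submodule.zero_mem _⟩
  · rintro x y _ _ ⟨U, hU, hx⟩ ⟨U', hU', hy⟩
    obtain ⟨U'', hU'', h1, h2⟩ := hch.directedOn U hU U' hU'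
    exact ⟨U'', hU'', Submodule.add_mem _
      (coinvSub_mono _ (L.sec_mono_of_isOpen (ho U hU) h1) hx)
      (coinvSub_mono _ (L.sec_mono_of_isOpen (ho U' hU') h2) hy)⟩
  · rintro a x _ ⟨U, hU, hx⟩
    exact ⟨U, hU, Submodule.smul_mem _ a hx⟩

/-- Surjectivity in `0 → sec U → sec (U ∪ V) → sec (V \ U) → 0`; exactness in the middle is
`mem_sec_of_cut_eq_zero`. -/
theorem map_cut_sec_union {U V : Set X} (hU : IsOpen U) (hV : IsOpen V) :
    (L.sec (U ∪ V)).map (L.cut (V ∩ Uᶜ)) = L.sec (V ∩ Uᶜ) := by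
  refine L.map_cut_sec (hU.union hV) isClosed_univ (Set.inter_univ _)
    (fun x hx => Or.inr hx.1) fun x hx hxV => ?_
  have hxU : x ∈ U := by
    by_contra h
    exact hx.elim h fun h' => hxV ⟨h', h⟩
  filter_upwards [hU.mem_nhds hxU] with y hy _ h using h.2 hy

theorem mem_sec_of_cut_eq_zero {U V : Set X} {s : ∀ x, L.Fiber x} (hs : s ∈ L.sec (U ∪ V))
    (h : L.cut (V ∩ Uᶜ) s = 0) : s ∈ L.sec U := by
  refine ⟨hs.1.mono Set.subset_union_left, _, fun x hx => ?_, L.isCompact_ne_zero hs,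
    fun x hx => by simpa using hx⟩
  by_contra hxU
  have hxV : x ∈ V := (L.ne_zero_subset hs hx).resolve_left hxU
  have h1 := congrFun h x
  rw [L.cut_of_mem _ (show x ∈ V ∩ Uᶜ from ⟨hxV, hxU⟩)] at h1
  exact hx h1

/-- Induction over invariant open `U` containing the complement of `Z`. The stratum added at each
step has `H₀ = 0`, so it contributes nothing new to the coinvariants. -/
theorem sec_univ_le_of_forall_orbit {Z : SubMulAction G X} (hZ : IsClosed (Z : Set X))
    (hZG : IsConstructibleAction G Z)
    (h : ∀ z ∈ Z, L.sec (MulAction.orbit G z) ≤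
      coinvSub L.translateRep (L.sec (MulAction.orbit G z))) :
    L.sec Set.univ ≤ L.sec (Z : Set X)ᶜ ⊔ coinvSub L.translateRep (L.sec Set.univ) := by
  refine invariant_open_induction (G := G)
    (P := fun U => L.sec U ≤ L.sec (Z : Set X)ᶜ ⊔ coinvSub L.translateRep (L.sec U))
    hZ.isOpen_compl (fun g x hx hg => hx (by simpa using Z.smul_mem g⁻¹ hg)) le_sup_left ?_ ?_
  · intro c hc hch hP s hs
    obtain ⟨U, hU, hsU⟩ := L.exists_mem_sec_of_isChain hc hch (fun U hU => (hP U hU).1) hs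
    exact sup_le_sup_left (coinvSub_mono _ (L.sec_mono_of_isOpen (hP U hU).1
      (Set.subset_sUnion_of_mem hU))) _ ((hP U hU).2.2.2 hsU)
  · intro U hU hUG hU₀ hP hne
    have hFZ : Uᶜ ⊆ (Z : Set X) := Set.compl_subset_comm.1 hU₀
    obtain ⟨V, hV, hVG, hVne, hst⟩ := exists_isStratum (G := G) hZ hZG hU.isClosed_compl hFZ
      (fun g x hx hg => hx (by simpa using hUG g⁻¹ _ hg)) hne
    refine ⟨V, hV, hVG, hVne, ?_⟩
    have h0 := L.sec_le_coinvSub_of_forall_orbit hV hU.isClosed_compl rfl hst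
      fun z hz => h z (hFZ hz.2)
    rw [← L.map_cut_sec_union hU hV] at h0
    have hUV : ∀ (g : G), ∀ x ∈ U ∪ V, g • x ∈ U ∪ V := fun g x hx => hx.imp (hUG g x) (hVG g x)
    have h1 := le_sup_coinvSub_of_quotient
      (fun g s hs => L.translateRep_mem_sec_of_invariant hUV g hs) _
      (L.cut_translateRep hst.smul_mem) (fun s hs h => L.mem_sec_of_cut_eq_zero hs h) h0
    refine h1.trans (sup_le (hP.trans (sup_le_sup_left (coinvSub_mono _
      (L.sec_mono_of_isOpen hU Set.subset_union_left)) _)) le_sup_right)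

/-- The same induction with `H₁`: a section over the complement of `Z` that dies in the coinvariants
over `U ∪ V` already dies over `U`, by the connecting map argument for the added stratum. -/
theorem sec_inf_coinvSub_le_of_forall_orbit {Z : SubMulAction G X} (hZ : IsClosed (Z : Set X))
    (hZG : IsConstructibleAction G Z) (K : Subgroup G)
    (hK : IsCompact (K : Set G))
    (h : ∀ z ∈ Z, CyclesAreTrivial L.translateRep K (L.sec (MulAction.orbit G z))) :
    L.sec (Z : Set X)ᶜ ⊓ coinvSub L.translateRep (L.sec Set.univ) ≤
      coinvSub L.translateRep (L.sec (Z : Set X)ᶜ) := by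
  refine invariant_open_induction (G := G)
    (P := fun U => L.sec (Z : Set X)ᶜ ⊓ coinvSub L.translateRep (L.sec U) ≤
      coinvSub L.translateRep (L.sec (Z : Set X)ᶜ))
    hZ.isOpen_compl (fun g x hx hg => hx (by simpa using Z.smul_mem g⁻¹ hg)) inf_le_right ?_ ?_
  · rintro c hc hch hP s ⟨hs, hs'⟩
    obtain ⟨U, hU, hsU⟩ := L.exists_mem_coinvSub_of_isChain hc hch (fun U hU => (hP U hU).1) hs'
    exact (hP U hU).2.2.2 ⟨hs, hsU⟩
  · intro U hU hUG hU₀ hP hne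
    have hFZ : Uᶜ ⊆ (Z : Set X) := Set.compl_subset_comm.1 hU₀
    obtain ⟨V, hV, hVG, hVne, hst⟩ := exists_isStratum (G := G) hZ hZG hU.isClosed_compl hFZ
      (fun g x hx hg => hx (by simpa using hUG g⁻¹ _ hg)) hne
    refine ⟨V, hV, hVG, hVne, ?_⟩
    have h0 := L.cyclesAreTrivial_of_forall_orbit hV hU.isClosed_compl rfl hst K
      fun z hz => h z (hFZ hz.2)
    rw [← L.map_cut_sec_union hU hV] at h0
    have hUV : ∀ (g : G), ∀ x ∈ U ∪ V, g • x ∈ U ∪ V := fun g x hx => hx.imp (hUG g x) (hVG g x)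
    have hle := L.sec_mono_of_isOpen hU (Set.subset_union_left (t := V))
    have h1 := inf_coinvSub_le_of_quotient
      (fun g s hs => L.translateRep_mem_sec_of_invariant hUG g hs)
      (fun g s hs => L.translateRep_mem_sec_of_invariant hUV g hs) _
      (L.cut_translateRep hst.smul_mem) (fun s hs h => L.mem_sec_of_cut_eq_zero hs h)
      (fun s hs => L.cut_eq_zero fun x hx => L.sec_zero_of_notMem hs hx.2)
      (inf_coinvSub_le_of_isFiniteVector hle
        fun s hs => L.isFiniteVector_of_mem_sec hUV hs K hK) h0
    rintro s ⟨hs, hs'⟩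
    exact hP ⟨hs, h1 ⟨L.sec_mono_of_isOpen hZ.isOpen_compl hU₀ hs, hs'⟩⟩

end Induction

end EquivariantLineBundle

/-! ### What vanishing smooth homology of a character says about cocycles -/

section SmoothHomology

variable {R : Type u} {H : Type v} [CommRing R] [Algebra ℂ R] [Group H] [TopologicalSpace H]
  [IsTopologicalGroup H] [LocallyCompactSpace H] [T2Space H] [TotallyDisconnectedSpace H]

/-- The map induced on coinvariants by a morphism of smooth representations. -/
abbrev coinvMap {A B : SmoothRep R H} (f : A ⟶ B) :
    A.obj.ρ.Coinvariants →ₗ[R] B.obj.ρ.Coinvariants :=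
  Representation.Coinvariants.map _ _ f.hom.hom

theorem exists_coinvMap_eq {M : SmoothRep R H} (P : ProjectiveResolution M) (i j k : ℕ)
    (hi : (ComplexShape.down ℕ).prev j = i) (hk : (ComplexShape.down ℕ).next j = k)
    (h : IsZero ((smoothHomology R H j).obj M)) (x : (P.complex.X j).obj.ρ.Coinvariants)
    (hx : coinvMap (P.complex.d j k) x = 0) : ∃ y, coinvMap (P.complex.d i j) y = x := by
  have h1 : IsZero (HomologicalComplex.homology
      (((smoothCoinvariants R H).mapHomologicalComplex (ComplexShape.down ℕ)).obj P.complex) j) :=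
    h.of_iso (P.isoLeftDerivedObj (smoothCoinvariants R H) j).symm
  rw [← HomologicalComplex.exactAt_iff_isZero_homology,
    HomologicalComplex.exactAt_iff' _ i j k hi hk, ShortComplex.moduleCat_exact_iff] at h1
  exact h1 x hx

theorem coinvMap_surjective {M : SmoothRep R H} (P : ProjectiveResolution M)
    (h : IsZero ((smoothHomology R H 0).obj M)) :
    Function.Surjective (coinvMap (P.complex.d 1 0)) := fun x =>
  exists_coinvMap_eq P 1 0 0 (by simp) (by simp) h x (by
    rw [P.complex.shape 0 0 (by simp)]
    obtain ⟨x, rfl⟩ := Representation.Coinvariants.mk_surjective _ x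
    exact (Representation.Coinvariants.map_mk _ _).trans (map_zero _))

variable {χ : H →* R} {hχ : ∀ᶠ h in 𝓝 (1 : H), χ h = 1}

/-- The map `r ↦ r a` factors through the coinvariants of `R_χ`. On a resolution, vanishing of `H₀`
makes every class in degree zero the image of one in degree one, which maps to zero in `R_χ`. -/
theorem eq_zero_of_isZero_smoothHomology_zero
    (h : IsZero ((smoothHomology R H 0).obj (charRep χ hχ)))
    {A : Type*} [AddCommGroup A] [Module R A] (a : A) (ha : ∀ h, χ h • a = a) : a = 0 := by
  let P := ProjectiveResolution.of (charRep χ hχ)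
  let π : P.complex.X 0 ⟶ charRep χ hχ := P.π.f 0
  have hπ : Function.Surjective π.hom.hom :=
    have : Epi π := inferInstanceAs (Epi (P.π.f 0))
    smoothRep_epi R H π
  let f : (charRep χ hχ).obj.ρ.Coinvariants →ₗ[R] A := Representation.Coinvariants.lift _
    (LinearMap.toSpanSingleton R A a ∘ₗ (ULift.moduleEquiv : ULift.{v} R ≃ₗ[R] R).toLinearMap)
    (fun g => by
      refine LinearMap.ext fun r => ?_
      change (χ g * (r : ULift.{v} R).down) • a = (r : ULift.{v} R).down • a
      rw [mul_comm, mul_smul, ha])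
  have hd : P.complex.d 1 0 ≫ π = 0 := P.complex_d_comp_π_f_zero
  obtain ⟨y, hy⟩ := hπ (ULift.up 1 : ULift.{v} R)
  obtain ⟨q, hq⟩ := coinvMap_surjective P h (Representation.Coinvariants.mk _ y)
  have h1 : f (coinvMap π (coinvMap (P.complex.d 1 0) q)) = 0 := by
    obtain ⟨q, rfl⟩ := Representation.Coinvariants.mk_surjective _ q
    have h2 : π.hom.hom ((P.complex.d 1 0).hom.hom q) = 0 :=
      congrArg (fun m : P.complex.X 1 ⟶ charRep χ hχ => m.hom.hom q) hd
    have h3 : coinvMap π (coinvMap (P.complex.d 1 0) (Representation.Coinvariants.mk _ q)) =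
      Representation.Coinvariants.mk _ (π.hom.hom ((P.complex.d 1 0).hom.hom q)) := rfl
    rw [h3, h2, map_zero, map_zero]
  rw [hq] at h1
  have h4 : coinvMap π (Representation.Coinvariants.mk _ y) =
    Representation.Coinvariants.mk _ (π.hom.hom y) := rfl
  rw [h4, hy] at h1
  have h5 : (1 : R) • a = 0 := h1
  rwa [one_smul] at h5

theorem exists_comp_eq_of_ker_le {M N A : Type*} [AddCommGroup M] [AddCommGroup N]
    [AddCommGroup A] [Module R M] [Module R N] [Module R A] (p : M →ₗ[R] N)
    (hp : Function.Surjective p) (f : M →ₗ[R] A) (h : ∀ x, p x = 0 → f x = 0) :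
    ∃ g : N →ₗ[R] A, ∀ x, g (p x) = f x := by
  refine ⟨(LinearMap.ker p).liftQ f h ∘ₗ (p.quotKerEquivOfSurjective hp).symm.toLinearMap,
    fun x => ?_⟩
  have : (p.quotKerEquivOfSurjective hp).symm (p x) = Submodule.Quotient.mk x := by
    rw [LinearEquiv.symm_apply_eq]
    rfl
  change (LinearMap.ker p).liftQ f h ((p.quotKerEquivOfSurjective hp).symm (p x)) = f x
  rw [this]
  rfl

/-- The extension of `R_χ` by a trivial representation defined by a cocycle. -/
def cocycleRep (hχ : ∀ᶠ h in 𝓝 (1 : H), χ h = 1) {A : Type max u v} [AddCommGroup A] [Module R A]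
    (c : H → A) (hc : ∀ h h', c (h * h') = χ h' • c h + c h')
    (hc1 : ∀ᶠ h in 𝓝 (1 : H), c h = 0) : SmoothRep R H where
  obj := Rep.of (X := A × ULift.{v} R)
    { toFun := fun h =>
        { toFun := fun p => (p.1 + p.2.down • c h, χ h • p.2)
          map_add' := fun p q => by
            refine Prod.ext ?_ (smul_add _ _ _)
            change p.1 + q.1 + (p.2.down + q.2.down) • c h =
              p.1 + p.2.down • c h + (q.1 + q.2.down • c h)
            rw [add_smul]
            abel
          map_smul' := fun r p => by
            refine Prod.ext ?_ (smul_comm _ _ _)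
            change r • p.1 + (r * p.2.down) • c h = r • (p.1 + p.2.down • c h)
            rw [smul_add, mul_smul] }
      map_one' := by
        have h1 : c 1 = 0 := by simpa using hc 1 1
        refine LinearMap.ext fun p => Prod.ext ?_ ?_
        · change p.1 + p.2.down • c 1 = p.1
          rw [h1, smul_zero, add_zero]
        · change χ 1 • p.2 = p.2
          rw [map_one, one_smul]
      map_mul' := fun g h => by
        refine LinearMap.ext fun p => Prod.ext ?_ ?_
        · change p.1 + p.2.down • c (g * h) =
            p.1 + p.2.down • c h + (χ h * p.2.down) • c g
          rw [hc, smul_add, smul_smul, mul_comm (χ h)]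
          abel
        · change χ (g * h) • p.2 = χ g • χ h • p.2
          rw [map_mul, mul_smul] }
  property := fun p => by
    refine isOpen_stab_of_le R H _ p _ (Filter.inter_mem hχ hc1) fun g hg => ?_
    have h1 : χ g = 1 := hg.1
    have h2 : c g = 0 := hg.2
    have h3 : ((p : A × ULift.{v} R).1 + (p : A × ULift.{v} R).2.down • c g,
        χ g • (p : A × ULift.{v} R).2) = (p : A × ULift.{v} R) := by
      rw [h1, h2, smul_zero, add_zero, one_smul]
    exact h3

/-- A cocycle defines an extension `B` of `R_χ` by the trivial module `A`, and a splitting of `B`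
exhibits it as a coboundary. The lift `f₀ : P₀ → B` restricts along `d` to a map `P₁ → A` that
factors through coinvariants. Since `(P₂)_H → (P₁)_H → (P₀)_H → 0` is exact, that map extends to
`(P₀)_H`. Subtracting the extension from `f₀` makes it descend to a splitting. -/
theorem exists_coboundary_aux
    (h0 : IsZero ((smoothHomology R H 0).obj (charRep χ hχ)))
    (h1 : IsZero ((smoothHomology R H 1).obj (charRep χ hχ)))
    {A : Type max u v} [AddCommGroup A] [Module R A]
    (c : H → A) (hc : ∀ h h', c (h * h') = χ h' • c h + c h')
    (hc1 : ∀ᶠ h in 𝓝 (1 : H), c h = 0) : ∃ a : A, ∀ h, c h = χ h • a - a := by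
  let P := ProjectiveResolution.of (charRep χ hχ)
  let π : P.complex.X 0 ⟶ charRep χ hχ := P.π.f 0
  let B : SmoothRep R H := cocycleRep hχ c hc hc1
  let p : B ⟶ charRep χ hχ := ObjectProperty.homMk (Rep.ofHom
    ⟨LinearMap.snd R A (ULift.{v} R), fun g => rfl⟩)
  have hp : Epi p := smoothRep_epi_of R H p fun r => ⟨((0 : A), (r : ULift.{v} R)), rfl⟩
  have hP0 : Projective (P.complex.X 0) := P.projective 0
  let f₀ : P.complex.X 0 ⟶ B := Projective.factorThru π p
  have hf₀ : f₀ ≫ p = π := Projective.factorThru_comp π p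
  let F₀ : (P.complex.X 0).obj.V →ₗ[R] A × ULift.{v} R := f₀.hom.hom.toLinearMap
  have hF₀ : ∀ (g : H) y, F₀ ((P.complex.X 0).obj.ρ g y) =
      ((F₀ y).1 + (F₀ y).2.down • c g, χ g • (F₀ y).2) := fun g y => Rep.hom_comm_apply f₀.hom g y
  have hd : P.complex.d 1 0 ≫ π = 0 := P.complex_d_comp_π_f_zero
  have hFd : ∀ q, (F₀ ((P.complex.d 1 0).hom.hom q)).2 = 0 := fun q => by
    have h2 : P.complex.d 1 0 ≫ f₀ ≫ p = 0 := by rw [hf₀, hd]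
    exact congrArg (fun m : P.complex.X 1 ⟶ charRep χ hχ => m.hom.hom q) h2
  let f₁ : (P.complex.X 1).obj.ρ.Coinvariants →ₗ[R] A := Representation.Coinvariants.lift _
    (LinearMap.fst R A (ULift.{v} R) ∘ₗ F₀ ∘ₗ (P.complex.d 1 0).hom.hom.toLinearMap) (fun g => by
      refine LinearMap.ext fun q => ?_
      change (F₀ ((P.complex.d 1 0).hom.hom ((P.complex.X 1).obj.ρ g q))).1 =
        (F₀ ((P.complex.d 1 0).hom.hom q)).1
      rw [Rep.hom_comm_apply, hF₀, hFd]
      change _ + (0 : R) • c g = _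
      rw [zero_smul, add_zero])
  have hf₁ : ∀ q, f₁ (Representation.Coinvariants.mk _ q) =
    (F₀ ((P.complex.d 1 0).hom.hom q)).1 := fun q => rfl
  -- `h1` makes the map vanish on the kernel of `(P₁)_H → (P₀)_H`; `h0` makes that arrow surjective,
  -- so the extension is defined on all of `(P₀)_H`.
  obtain ⟨g, hg⟩ := exists_comp_eq_of_ker_le (coinvMap (P.complex.d 1 0))
    (coinvMap_surjective P h0) f₁ (by
      intro x hx
      obtain ⟨y, rfl⟩ := exists_coinvMap_eq P 2 1 0 (by simp) (by simp) h1 x hx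
      obtain ⟨y, rfl⟩ := Representation.Coinvariants.mk_surjective _ y
      have h2 : (P.complex.d 1 0).hom.hom ((P.complex.d 2 1).hom.hom y) = 0 :=
        congrArg (fun m : P.complex.X 2 ⟶ P.complex.X 0 => m.hom.hom y)
          (P.complex.d_comp_d 2 1 0)
      change (F₀ ((P.complex.d 1 0).hom.hom ((P.complex.d 2 1).hom.hom y))).1 = 0
      rw [h2, map_zero]
      rfl)
  have hg' : ∀ q, g (Representation.Coinvariants.mk _ ((P.complex.d 1 0).hom.hom q)) =
    (F₀ ((P.complex.d 1 0).hom.hom q)).1 := fun q => hg (Representation.Coinvariants.mk _ q)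
  let Φ : (P.complex.X 0).obj.V →ₗ[R] A × ULift.{v} R :=
    F₀ - LinearMap.inl R A (ULift.{v} R) ∘ₗ g ∘ₗ Representation.Coinvariants.mk _
  have hΦ : ∀ y, Φ y = ((F₀ y).1 - g (Representation.Coinvariants.mk _ y), (F₀ y).2) := fun y =>
    Prod.ext rfl (sub_zero _)
  let φ : P.complex.X 0 ⟶ B := ObjectProperty.homMk (Rep.ofHom ⟨Φ, fun x => by
    refine LinearMap.ext fun y => ?_
    change Φ ((P.complex.X 0).obj.ρ x y) = ((Φ y).1 + (Φ y).2.down • c x, χ x • (Φ y).2)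
    rw [hΦ, hΦ, hF₀, Representation.Coinvariants.mk_self_apply]
    refine Prod.ext ?_ rfl
    change _ + _ - _ = _ - _ + _
    abel⟩)
  have hφ : P.complex.d 1 0 ≫ φ = 0 := by
    refine ObjectProperty.hom_ext _ (Rep.hom_ext
      (Representation.IntertwiningMap.toLinearMap_injective _ _ (LinearMap.ext fun q => ?_)))
    change Φ ((P.complex.d 1 0).hom.hom q) = 0
    rw [hΦ, hg', hFd, sub_self]
    rfl
  have hepi : Epi (ShortComplex.mk _ _ P.complex_d_comp_π_f_zero).g :=
    inferInstanceAs (Epi (P.π.f 0))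
  let σ : charRep χ hχ ⟶ B := P.exact₀.desc φ hφ
  have hσ : π ≫ σ = φ := P.exact₀.g_desc φ hφ
  have hφp : φ ≫ p = π := by
    rw [← hf₀]
    refine ObjectProperty.hom_ext _ (Rep.hom_ext
      (Representation.IntertwiningMap.toLinearMap_injective _ _ (LinearMap.ext fun q => ?_)))
    change (Φ q).2 = (F₀ q).2
    rw [hΦ]
  have hσp : σ ≫ p = 𝟙 _ := by
    have : Epi π := hepi
    rw [← cancel_epi π, ← Category.assoc, hσ, hφp, Category.comp_id]
  let s : ULift.{v} R →ₗ[R] A × ULift.{v} R := σ.hom.hom.toLinearMap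
  have hs2 : (s (ULift.up 1)).2 = ULift.up 1 :=
    congrArg (fun m : charRep χ hχ ⟶ charRep χ hχ => m.hom.hom (ULift.up 1 : ULift.{v} R)) hσp
  -- With `σ 1 = (a, 1)`, equivariance compares `χ(x) a` with `a + c x`.
  refine ⟨(s (ULift.up 1)).1, fun x => ?_⟩
  have h2 : s (χ x • ULift.up 1) = ((s (ULift.up 1)).1 + (s (ULift.up 1)).2.down • c x,
    χ x • (s (ULift.up 1)).2) := Rep.hom_comm_apply σ.hom x (ULift.up 1 : ULift.{v} R)
  have h3 := congrArg Prod.fst h2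
  rw [map_smul, hs2] at h3
  change χ x • (s (ULift.up 1)).1 = (s (ULift.up 1)).1 + (1 : R) • c x at h3
  rw [h3, one_smul, add_sub_cancel_left]

/-- If `H_i(H, χ) = 0` for `i = 0, 1` then all smooth cocycles with values in `Hom(R_χ, A)` are
coboundaries. -/
theorem exists_coboundary
    (h0 : IsZero ((smoothHomology R H 0).obj (charRep χ hχ)))
    (h1 : IsZero ((smoothHomology R H 1).obj (charRep χ hχ)))
    {A : Type*} [AddCommGroup A] [Module R A]
    (c : H → A) (hc : ∀ h h', c (h * h') = χ h' • c h + c h')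
    (hc1 : ∀ᶠ h in 𝓝 (1 : H), c h = 0) : ∃ a : A, ∀ h, c h = χ h • a - a := by
  -- The values of the cocycle span a copy of a quotient of `H →₀ R`, which lives in the universe
  -- that the auxiliary statement demands.
  let f : (H →₀ R) →ₗ[R] A := Finsupp.linearCombination R c
  let q : (H →₀ R) →ₗ[R] (H →₀ R) ⧸ LinearMap.ker f := (LinearMap.ker f).mkQ
  let i : ((H →₀ R) ⧸ LinearMap.ker f) →ₗ[R] A := (LinearMap.ker f).liftQ f le_rfl
  have hi : Function.Injective i := by
    rw [← LinearMap.ker_eq_bot]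
    exact Submodule.ker_liftQ_eq_bot _ _ _ le_rfl
  let c' : H → (H →₀ R) ⧸ LinearMap.ker f := fun h => q (Finsupp.single h 1)
  have hic : ∀ h, i (c' h) = c h := fun h =>
    (Finsupp.linearCombination_single R (1 : R) h).trans (one_smul _ _)
  obtain ⟨a, ha⟩ := exists_coboundary_aux h0 h1 c'
    (fun h h' => hi (by rw [map_add, map_smul, hic, hic, hic, hc]))
    (hc1.mono fun h hh => hi (by rw [hic, hh, map_zero]))
  exact ⟨i a, fun h => by rw [← hic, ha, map_sub, map_smul]⟩

end SmoothHomology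

/-! ### The modular character as a ratio of indices -/

section Modulus

open MeasureTheory MeasureTheory.Measure

variable {G : Type*} [Group G] [TopologicalSpace G] [IsTopologicalGroup G] [LocallyCompactSpace G]

theorem haar_eq_relIndex_mul [MeasurableSpace G] [BorelSpace G] (μ : Measure G)
    [IsMulLeftInvariant μ] {K K₁ : Subgroup G} (hK : IsOpen (K : Set G)) (hKK₁ : K ≤ K₁)
    (hK₁ : IsOpen (K₁ : Set G)) (hK₁c : IsCompact (K₁ : Set G)) :
    μ K₁ = K.relIndex K₁ * μ K := by
  have hmeas : MeasurableEmbedding (Subtype.val : K₁ → G) :=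
    MeasurableEmbedding.subtype_coe hK₁.measurableSet
  have : CompactSpace K₁ := isCompact_iff_compactSpace.1 hK₁c
  have hopen : IsOpen (K.subgroupOf K₁ : Set K₁) := hK.preimage continuous_subtype_val
  have := (K.subgroupOf K₁).quotient_finite_of_isOpen hopen
  have : (K.subgroupOf K₁).FiniteIndex := Subgroup.finiteIndex_of_finite_quotient
  have hinv : IsMulLeftInvariant (μ.comap (Subtype.val : K₁ → G)) := by
    refine ⟨fun k => Measure.ext fun A hA => ?_⟩
    rw [Measure.map_apply (measurable_const_mul k) hA, hmeas.comap_apply, hmeas.comap_apply]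
    have : (Subtype.val : K₁ → G) '' ((k * ·) ⁻¹' A) =
        ((k : G) * ·) ⁻¹' ((Subtype.val : K₁ → G) '' A) := by
      ext x
      constructor
      · rintro ⟨y, hy, rfl⟩
        exact ⟨k * y, hy, rfl⟩
      · rintro ⟨y, hy, hyx⟩
        change (y : G) = k * x at hyx
        refine ⟨k⁻¹ * y, ?_, ?_⟩
        · change k * (k⁻¹ * y) ∈ A
          rwa [mul_inv_cancel_left]
        · change (k : G)⁻¹ * y = x
          rw [hyx, inv_mul_cancel_left]
    rw [this, measure_preimage_mul]
  have h := Subgroup.index_mul_measure (K.subgroupOf K₁) hopen.measurableSet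
    (μ.comap (Subtype.val : K₁ → G))
  rw [hmeas.comap_apply, hmeas.comap_apply, Set.image_univ, Subtype.range_coe] at h
  have h2 : (Subtype.val : K₁ → G) '' (K.subgroupOf K₁ : Set K₁) = K := by
    ext x
    exact ⟨fun ⟨y, hy, e⟩ => e ▸ hy, fun hx => ⟨⟨x, hKK₁ hx⟩, hx, rfl⟩⟩
  rw [h2] at h
  exact h.symm

/-- Here `K' = h K h⁻¹`, whose left Haar measure is that of `K h⁻¹`, namely `Δ(h)⁻¹` times that of
`K`. Indices in `K₁` are inverse to measures. -/
theorem relIndex_conj_eq_modulus_mul {K K' K₁ : Subgroup G} (h : G)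
    (hK' : ∀ x, x ∈ K' ↔ h⁻¹ * x * h ∈ K) (hK : IsOpen (K : Set G)) (hKK₁ : K ≤ K₁)
    (hK'K₁ : K' ≤ K₁) (hK₁c : IsCompact (K₁ : Set G)) :
    (K'.relIndex K₁ : NNReal) = modulus G h * K.relIndex K₁ := by
  borelize G
  have hK₁ : IsOpen (K₁ : Set G) := Subgroup.isOpen_mono hKK₁ hK
  have hK'o : IsOpen (K' : Set G) := by
    have : (K' : Set G) = (fun x => h⁻¹ * x * h) ⁻¹' (K : Set G) := Set.ext hK'
    rw [this]
    exact hK.preimage (by fun_prop)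
  have hKc : IsCompact (K : Set G) := hK₁c.of_isClosed_subset (K.isClosed_of_isOpen hK) hKK₁
  have hcl : IsClosed (h • (K : Set G)) := (K.isClosed_of_isOpen hK).smul h
  have hcc : IsCompact (h • (K : Set G)) := hKc.smul h
  have h1 := measure_isMulInvariant_eq_smul_of_isCompact_closure
    (Measure.map (· * h) (haar (G := G))) (haar (G := G)) (s := h • (K : Set G))
    (by rwa [hcl.closure_eq])
  rw [← modularCharacterFun_eq_haarScalarFactor,
    Measure.map_apply (measurable_mul_const h) hcl.measurableSet] at h1
  have hpre : (· * h) ⁻¹' (h • (K : Set G)) = (K' : Set G) := by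
    ext x
    rw [Set.mem_preimage, Set.mem_smul_set_iff_inv_smul_mem, smul_eq_mul, ← mul_assoc]
    exact (hK' x).symm
  rw [hpre, measure_smul, ENNReal.smul_def, smul_eq_mul] at h1
  have h2 := haar_eq_relIndex_mul (haar (G := G)) hK hKK₁ hK₁ hK₁c
  have h3 := haar_eq_relIndex_mul (haar (G := G)) hK'o hK'K₁ hK₁ hK₁c
  rw [h1, h2, ← mul_assoc] at h3
  have h0 : haar (K : Set G) ≠ 0 := (hK.measure_pos _ ⟨1, K.one_mem⟩).ne'
  have ht : haar (K : Set G) ≠ ⊤ := hKc.measure_lt_top.ne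
  have h4 := (ENNReal.mul_left_inj h0 ht).1 h3
  have h5 : (K.relIndex K₁ : NNReal) = K'.relIndex K₁ * modularCharacterFun h := by
    exact_mod_cast h4
  change _ = (modularCharacterFun h)⁻¹ * _
  rw [h5, mul_comm, mul_assoc, mul_inv_cancel₀ (modularCharacterFun_pos h).ne', mul_one]

theorem relIndex_ne_zero_of_isCompact {K K₁ : Subgroup G} (hK : IsOpen (K : Set G))
    (hK₁c : IsCompact (K₁ : Set G)) : K.relIndex K₁ ≠ 0 := by
  have : CompactSpace K₁ := isCompact_iff_compactSpace.1 hK₁c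
  have hopen : IsOpen (K.subgroupOf K₁ : Set K₁) := hK.preimage continuous_subtype_val
  have := (K.subgroupOf K₁).quotient_finite_of_isOpen hopen
  exact Subgroup.index_ne_zero_of_finite

end Modulus

/-! ### Orbits are locally closed and orbit maps are open -/

section OrbitMap

variable {G : Type v} {X : Type w} [Group G] [TopologicalSpace G] [IsTopologicalGroup G]
  [SigmaCompactSpace G] [TopologicalSpace X] [T2Space X] [LocallyCompactSpace X]
  [MulAction G X] [ContinuousSMul G X]

/-- A locally closed orbit is locally compact, so the transitive action of the σ-compact group `G`
on it has open orbit map. -/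
theorem eventually_mem_orbit_imp {z : X} (hO : IsLocallyClosed (MulAction.orbit G z)) (g : G)
    {A : Set G} (hA : A ∈ 𝓝 g) :
    ∀ᶠ y in 𝓝 (g • z), y ∈ MulAction.orbit G z → ∃ a ∈ A, a • z = y := by
  have := hO.locallyCompactSpace
  have : ContinuousSMul G (MulAction.orbit G z) :=
    ⟨Continuous.subtype_mk (continuous_fst.smul (continuous_subtype_val.comp continuous_snd)) _⟩
  let z' : MulAction.orbit G z := ⟨z, MulAction.mem_orbit_self z⟩
  have h := (isOpenMap_smul_of_sigmaCompact (G := G) z').image_mem_nhds hA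
  rw [nhds_subtype_eq_comap, Filter.mem_comap] at h
  obtain ⟨T, hT, hTA⟩ := h
  filter_upwards [hT] with y hy hyO
  obtain ⟨a, ha, hay⟩ := hTA (show (⟨y, hyO⟩ : MulAction.orbit G z) ∈ _ from hy)
  exact ⟨a, ha, congrArg Subtype.val hay⟩

/-- The subset `g K z` of the orbit of `z`. -/
def tube (z : X) (g : G) (K : Subgroup G) : Set X := {x | ∃ k ∈ K, (g * k) • z = x}

theorem tube_subset_orbit (z : X) (g : G) (K : Subgroup G) :
    tube z g K ⊆ MulAction.orbit G z := by
  rintro _ ⟨k, -, rfl⟩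
  exact ⟨_, rfl⟩

theorem isCompact_tube (z : X) (g : G) {K : Subgroup G} (hK : IsCompact (K : Set G)) :
    IsCompact (tube z g K) :=
  hK.image (f := fun k => (g * k) • z) (by fun_prop)

theorem eventually_mem_tube {z : X} (hO : IsLocallyClosed (MulAction.orbit G z)) (g : G)
    {K : Subgroup G} (hK : IsOpen (K : Set G)) {x : X} (hx : x ∈ tube z g K) :
    ∀ᶠ y in 𝓝 x, y ∈ MulAction.orbit G z → y ∈ tube z g K := by
  obtain ⟨k, hk, rfl⟩ := hx
  have hA : (fun a => g⁻¹ * a) ⁻¹' (K : Set G) ∈ 𝓝 (g * k) :=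
    (hK.preimage (by fun_prop)).mem_nhds (by simpa using hk)
  filter_upwards [eventually_mem_orbit_imp hO (g * k) hA] with y hy hyO
  obtain ⟨a, ha, rfl⟩ := hy hyO
  exact ⟨g⁻¹ * a, ha, by rw [mul_inv_cancel_left]⟩

theorem eventually_notMem_tube (z : X) (g : G) {K : Subgroup G} (hK : IsCompact (K : Set G))
    {x : X} (hx : x ∉ tube z g K) : ∀ᶠ y in 𝓝 x, y ∈ MulAction.orbit G z → y ∉ tube z g K := by
  filter_upwards [(isCompact_tube z g hK).isClosed.isOpen_compl.mem_nhds hx] with y hy _ using hy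

/-- A stratum that is open in the orbit closure must contain the dense orbit. There orbits are
relatively closed, so the stratum equals the orbit. -/
theorem isLocallyClosed_orbit [TotallyDisconnectedSpace X] {Z : SubMulAction G X}
    (hZ : IsClosed (Z : Set X)) (hZG : IsConstructibleAction G Z) {z : X} (hz : z ∈ Z) :
    IsLocallyClosed (MulAction.orbit G z) := by
  have hsub : MulAction.orbit G z ⊆ (Z : Set X) := by
    rintro _ ⟨g, rfl⟩
    exact Z.smul_mem g hz
  have hinv : ∀ (g : G), ∀ x ∈ closure (MulAction.orbit G z),
      g • x ∈ closure (MulAction.orbit G z) := fun g x hx =>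
    map_mem_closure (continuous_const_smul g) hx fun y hy =>
      MulAction.mem_orbit_of_mem_orbit g hy
  obtain ⟨V, hV, hVG, ⟨x, hxV, hx⟩, hst⟩ := exists_isStratum (G := G) hZ hZG isClosed_closure
    (closure_minimal hsub hZ) hinv ⟨z, subset_closure (MulAction.mem_orbit_self z)⟩
  obtain ⟨y, hyV, g, rfl⟩ := mem_closure_iff_nhds.1 hx V (hV.mem_nhds hxV)
  have hzV : z ∈ V := by simpa using hVG g⁻¹ _ hyV
  have hzY : z ∈ V ∩ closure (MulAction.orbit G z) :=
    ⟨hzV, subset_closure (MulAction.mem_orbit_self z)⟩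
  refine ⟨V, closure (MulAction.orbit G z), hV, isClosed_closure, Set.Subset.antisymm ?_ ?_⟩
  · rintro _ ⟨g, rfl⟩
    exact hst.smul_mem g z hzY
  · intro y hy
    by_contra hyO
    have h := hst.eventually_notMem_orbit (C := {z}) isCompact_singleton
      (Set.singleton_subset_iff.2 hzY) hy (by simpa using hyO)
    obtain ⟨y', hy', hy'O⟩ := mem_closure_iff_nhds.1 hy.2 _ h
    obtain ⟨g, rfl⟩ := hy'O
    exact hy' z rfl (hst.smul_mem g z hzY) ⟨g, rfl⟩

end OrbitMap

namespace EquivariantLineBundle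

/-! ### Invariant sections supported on `K z` -/

section OrbitSections

variable {R : Type u} {G : Type v} {X : Type w} [CommRing R]
    [Group G] [TopologicalSpace G] [IsTopologicalGroup G] [SigmaCompactSpace G]
    [TopologicalSpace X] [LocallyCompactSpace X] [T2Space X] [TotallyDisconnectedSpace X]
    [MulAction G X] [ContinuousSMul G X]
    (L : EquivariantLineBundle.{u, v, w, t} R G X)

theorem exists_mem_sec_apply_eq {Y : Set X} (hY : IsLocallyClosed Y) {z : X} (hz : z ∈ Y)
    (v : L.Fiber z) : ∃ s ∈ L.sec Y, s z = v := by
  classical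
  obtain ⟨U, F, hU, hF, rfl⟩ := hY
  have h0 : (fun x => if h : z = x then h ▸ v else 0 : ∀ x, L.Fiber x) ∈ L.sec {z} := by
    refine ⟨?_, {z}, subset_rfl, isCompact_singleton, fun x hx => ?_⟩
    · exact continuousOn_singleton _ _
    · exact dif_neg fun h => hx h.symm
  obtain ⟨s, hs, hsz⟩ := L.exists_extension hU (Set.singleton_subset_iff.2 hz.1) h0
  refine ⟨L.cut (U ∩ F) s, L.cut_mem_sec hF rfl hs, ?_⟩
  rw [L.cut_of_mem _ hz]
  have h1 := congrFun hsz z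
  rw [L.cut_of_mem _ (Set.mem_singleton z)] at h1
  rw [h1]
  exact dif_pos rfl

theorem sec_tube_le {z : X} (hO : IsLocallyClosed (MulAction.orbit G z)) (g : G)
    {K : Subgroup G} (hK : IsOpen (K : Set G)) :
    L.sec (tube z g K) ≤ L.sec (MulAction.orbit G z) :=
  L.sec_mono_of_eventually (tube_subset_orbit z g K) fun _ hx => eventually_mem_tube hO g hK hx

theorem cut_tube_mem_sec {z : X} (g : G) {K : Subgroup G} (hK : IsCompact (K : Set G))
    {s : ∀ x, L.Fiber x} (hs : s ∈ L.sec (MulAction.orbit G z)) :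
    L.cut (tube z g K) s ∈ L.sec (tube z g K) :=
  L.cut_mem_sec_of_eventually (tube_subset_orbit z g K)
    (fun _ _ hx => eventually_notMem_tube z g hK hx) hs

theorem mem_sec_tube_of_mem_sec_orbit {z : X} (g : G) {K : Subgroup G}
    (hK : IsCompact (K : Set G)) {s : ∀ x, L.Fiber x} (hs : s ∈ L.sec (MulAction.orbit G z))
    (h : ∀ x ∉ tube z g K, s x = 0) : s ∈ L.sec (tube z g K) := by
  rw [← L.cut_eq_self h]
  exact L.cut_tube_mem_sec g hK hs

theorem act_congr_left {g g' : G} (hg : g = g') {x y : X} (h : g • x = y) (h' : g' • x = y)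
    (v : L.Fiber x) : L.act g h v = L.act g' h' v := by
  subst hg; rfl

/-- A section supported on `K z` that is invariant under `K`. -/
theorem exists_invariant_section {z : X} (hO : IsLocallyClosed (MulAction.orbit G z))
    {K : Subgroup G} (hK : IsOpen (K : Set G)) (hKc : IsCompact (K : Set G)) (v : L.Fiber z)
    (hv : ∀ k ∈ K, ∀ h : k • z = z, L.act k h v = v) :
    ∃ e ∈ L.sec (tube z 1 K), e z = v ∧ ∀ k ∈ K, L.translateRep k e = e := by
  classical
  let e : ∀ x, L.Fiber x := fun x =>
    if h : ∃ k ∈ K, k • z = x then L.act h.choose h.choose_spec.2 v else 0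
  have he : ∀ k ∈ K, ∀ (x : X) (hx : k • z = x), e x = L.act k hx v := by
    intro k hk x hx
    have h : ∃ k ∈ K, k • z = x := ⟨k, hk, hx⟩
    have h1 : e x = L.act h.choose h.choose_spec.2 v := dif_pos h
    rw [h1]
    have hk'x : h.choose • z = x := h.choose_spec.2
    have h2 : (k⁻¹ * h.choose) • z = z := by rw [mul_smul, hk'x, ← hx, inv_smul_smul]
    have h3 := L.act_mul k (k⁻¹ * h.choose) h2 hx (by rw [mul_inv_cancel_left]; exact hk'x) v
    rw [hv _ (K.mul_mem (K.inv_mem hk) h.choose_spec.1) h2] at h3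
    rw [← h3]
    exact L.act_congr_left (mul_inv_cancel_left _ _).symm _ _ _
  have he0 : ∀ x, (¬ ∃ k ∈ K, k • z = x) → e x = 0 := fun x hx => dif_neg hx
  refine ⟨e, ⟨?_, _, subset_rfl, isCompact_tube z 1 hKc, ?_⟩, ?_, ?_⟩
  · rintro _ ⟨k, hk, rfl⟩
    rw [one_mul]
    -- Continuity of `e` at `k z` comes from comparison with `k s`, where `s` is any section with `s
    -- z = v`. A point near `k z` has the form `a z` with `k⁻¹ a` fixing `s`, and both sections have
    -- the value `a v` there.
    obtain ⟨s, hs, hsz⟩ := L.exists_mem_sec_apply_eq hO (MulAction.mem_orbit_self z) v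
    have hinv : ∀ (g : G), ∀ x ∈ MulAction.orbit G z, g • x ∈ MulAction.orbit G z :=
      mem_orbit_smul z
    have h1 := Filter.inter_mem (hK.mem_nhds K.one_mem) (L.eventually_translateRep_eq hinv hs)
    have h2 : (fun a => k⁻¹ * a) ⁻¹' ((K : Set G) ∩ {g | L.translateRep g s = s}) ∈ 𝓝 k := by
      refine (continuous_const_mul k⁻¹).continuousAt.preimage_mem_nhds ?_
      rwa [inv_mul_cancel]
    have h3 := eventually_mem_orbit_imp hO k h2
    have h4 := L.translateRep_mem_sec_of_invariant hinv k hs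
    have key : ∀ y, (y ∈ MulAction.orbit G z → ∃ a ∈ (fun a => k⁻¹ * a) ⁻¹'
        ((K : Set G) ∩ {g | L.translateRep g s = s}), a • z = y) → y ∈ MulAction.orbit G z →
        L.toTotal e y = L.toTotal (L.translateRep k s) y := by
      intro y hy hyO
      obtain ⟨a, ⟨haK, has⟩, hay⟩ := hy hyO
      have haK' : a ∈ K := by simpa using K.mul_mem hk haK
      have has' : L.translateRep (k⁻¹ * a) s = s := has
      refine congrArg (Bundle.TotalSpace.mk y) ?_
      rw [he a haK' y hay, ← has', ← Module.End.mul_apply, ← map_mul, mul_inv_cancel_left,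
        L.translateRep_apply_of_eq a s hay, hsz]
    refine ((h4.1 (k • z) ⟨k, rfl⟩).mono (tube_subset_orbit z 1 K)).congr_of_eventuallyEq ?_ ?_
    · rw [Filter.EventuallyEq, eventually_nhdsWithin_iff]
      filter_upwards [h3] with y hy hyT using key y hy (tube_subset_orbit z 1 K hyT)
    · exact key _ h3.self_of_nhds ⟨k, rfl⟩
  · intro x hx
    refine he0 x ?_
    rintro ⟨k, hk, rfl⟩
    exact hx ⟨k, hk, by rw [one_mul]⟩
  · rw [he 1 K.one_mem z (one_smul G z)]
    exact L.act_one _ _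
  · intro k hk
    funext x
    rw [translateRep_apply]
    by_cases h : ∃ k' ∈ K, k' • z = k⁻¹ • x
    · obtain ⟨k', hk', h'⟩ := h
      have hx : (k * k') • z = x := by rw [mul_smul, h', smul_inv_smul]
      rw [he k' hk' _ h', he (k * k') (K.mul_mem hk hk') x hx]
      exact (L.act_mul k k' h' _ hx v).symm
    · rw [he0 _ h, map_zero, he0]
      rintro ⟨k', hk', rfl⟩
      exact h ⟨k⁻¹ * k', K.mul_mem (K.inv_mem hk) hk', mul_smul _ _ _⟩

/-- A section supported on `K z` that is invariant under `K` is determined by its value at `z`. -/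
theorem eq_of_invariant_of_apply_eq {z : X} {K : Subgroup G} {s s' : ∀ x, L.Fiber x}
    (hs : ∀ x ∉ tube z 1 K, s x = 0) (hs' : ∀ x ∉ tube z 1 K, s' x = 0)
    (hsK : ∀ k ∈ K, L.translateRep k s = s) (hsK' : ∀ k ∈ K, L.translateRep k s' = s')
    (h : s z = s' z) : s = s' := by
  funext x
  by_cases hx : x ∈ tube z 1 K
  · obtain ⟨k, hk, hkx⟩ := hx
    rw [one_mul] at hkx
    rw [← hsK k hk, ← hsK' k hk, L.translateRep_apply_of_eq k s hkx,
      L.translateRep_apply_of_eq k s' hkx, h]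
  · rw [hs x hx, hs' x hx]

end OrbitSections

end EquivariantLineBundle

/-- The ring homomorphism `ℝ≥0 → ℂ → R`. -/
def nnrealHom (R : Type*) [CommRing R] [Algebra ℂ R] : NNReal →+* R :=
  (algebraMap ℂ R).comp (Complex.ofRealHom.comp NNReal.toRealHom)

theorem isUnit_nnrealHom (R : Type*) [CommRing R] [Algebra ℂ R] {x : NNReal} (hx : x ≠ 0) :
    IsUnit (nnrealHom R x) := (IsUnit.mk0 x hx).map _

theorem isUnit_natCast_of_ne_zero (R : Type*) [CommRing R] [Algebra ℂ R] {n : ℕ} (hn : n ≠ 0) :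
    IsUnit (n : R) := by
  rw [← map_natCast (nnrealHom R)]
  exact isUnit_nnrealHom R (Nat.cast_ne_zero.2 hn)

namespace EquivariantLineBundle

/-! ### The integral on an orbit and its behaviour under the stabilizer -/

section OrbitIntegral

variable {R : Type u} {G : Type v} {X : Type w} [CommRing R]
    [Group G] [TopologicalSpace G] [IsTopologicalGroup G]
    [TopologicalSpace X] [LocallyCompactSpace X] [T2Space X] [TotallyDisconnectedSpace X]
    [MulAction G X] [ContinuousSMul G X]
    (L : EquivariantLineBundle.{u, v, w, t} R G X)

/-- The representation of `G` on the compactly supported sections over an orbit. -/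
def orbitRep (z : X) : Representation R G (L.sec (MulAction.orbit G z)) where
  toFun g := (L.translateRep g).restrict fun _ hs =>
    L.translateRep_mem_sec_of_invariant (mem_orbit_smul z) g hs
  map_one' := LinearMap.ext fun s => Subtype.ext (by
    change L.translateRep 1 (s : ∀ x, L.Fiber x) = s
    rw [map_one, Module.End.one_apply])
  map_mul' g h := LinearMap.ext fun s => Subtype.ext (by
    change L.translateRep (g * h) (s : ∀ x, L.Fiber x) = L.translateRep g (L.translateRep h s)
    rw [map_mul, Module.End.mul_apply])

theorem coe_orbitRep (z : X) (g : G) (s : L.sec (MulAction.orbit G z)) :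
    (L.orbitRep z g s : ∀ x, L.Fiber x) = L.translateRep g s := rfl

variable [Algebra ℂ R]

theorem isFiniteVector_orbitRep {z : X} {K : Subgroup G} (hK : IsCompact (K : Set G))
    (m : L.sec (MulAction.orbit G z)) :
    IsFiniteVector ((L.orbitRep z).comp K.subtype) m := by
  obtain ⟨S, hS, h⟩ := L.isFiniteVector_of_mem_sec (mem_orbit_smul z) m.2 K hK
  exact ⟨S, hS, fun k hk => Subtype.ext (h k hk)⟩

variable [LocallyCompactSpace G]

/-- An `R`-valued integral over a neighbourhood of `z` in its orbit that is invariant under the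
compact open subgroup `K₁`, together with invariant sections supported on `K z`. -/
structure OrbitIntegral (z : X) (K₁ : Subgroup G) where
  I : L.sec (MulAction.orbit G z) →ₗ[R] R
  e : Subgroup G → L.sec (MulAction.orbit G z)
  I_translate : ∀ k ∈ K₁, ∀ m, I (L.orbitRep z k m) = I m
  e_mem : ∀ K : Subgroup G, IsOpen (K : Set G) → K ≤ K₁ →
    (e K : ∀ x, L.Fiber x) ∈ L.sec (tube z 1 K)
  isUnit_I_e : ∀ K : Subgroup G, IsOpen (K : Set G) → K ≤ K₁ → IsUnit (I (e K))
  I_stabilizer : ∀ (h : MulAction.stabilizer G z) (K : Subgroup G), IsOpen (K : Set G) → K ≤ K₁ →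
    (∀ k ∈ K, (h : G) * k * (h : G)⁻¹ ∈ K₁) →
    I (L.orbitRep z h (e K)) = L.twistedChar z h * I (e K)
  exists_sub_mem : ∀ K : Subgroup G, IsOpen (K : Set G) → K ≤ K₁ →
    ∀ m : L.sec (MulAction.orbit G z), (m : ∀ x, L.Fiber x) ∈ L.sec (tube z 1 K) →
    ∃ r : R, m - r • e K ∈ coinvSub ((L.orbitRep z).comp K.subtype) ⊤

theorem quotient_sum_ite {Q : Type*} [Fintype Q] {V : Type*} [AddCommMonoid V] (S : Set Q) (v : V)
    (f : Q → V) (h1 : ∀ q ∈ S, f q = v) (h2 : ∀ q ∉ S, f q = 0) :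
    ∑ q, f q = Nat.card S • v := by
  classical
  rw [Finset.sum_congr rfl fun q _ => (show f q = if q ∈ S then v else 0 by
    split_ifs with h
    · exact h1 q h
    · exact h2 q h), ← Finset.sum_filter, Finset.sum_const, Nat.card_eq_fintype_card,
    Fintype.card_subtype]

/-- A coset of `K` in `K₁` contributes at `z` exactly when it meets the stabilizer `H`, and then its
term is `s z`. Such cosets correspond to the cosets of `K ∩ H` in `K₁ ∩ H`. -/
theorem sum_translate_apply {z : X} {K K₁ : Subgroup G} (hKK₁ : K ≤ K₁)
    [Fintype (K₁ ⧸ K.subgroupOf K₁)] {s : ∀ x, L.Fiber x}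
    (hs : ∀ k ∈ K, L.translateRep k s = s) (hs0 : ∀ x ∉ tube z 1 K, s x = 0)
    (hz : ∀ k ∈ K₁, ∀ h : k • z = z, L.act k h (s z) = s z) :
    ∑ q : K₁ ⧸ K.subgroupOf K₁, L.translateRep (q.out : K₁) s z =
      ((K.subgroupOf (MulAction.stabilizer G z)).relIndex
        (K₁.subgroupOf (MulAction.stabilizer G z))) • s z := by
  set H := MulAction.stabilizer G z
  let j : ↥(K₁.subgroupOf H) ⧸ (K.subgroupOf H).subgroupOf (K₁.subgroupOf H) →
      K₁ ⧸ K.subgroupOf K₁ := Quotient.map' (fun x => ⟨((x : H) : G), x.2⟩) (by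
    intro x y hxy
    rw [QuotientGroup.leftRel_apply] at hxy ⊢
    exact hxy)
  have hj : Function.Injective j := by
    intro x y
    induction x using QuotientGroup.induction_on with | H x =>
    induction y using QuotientGroup.induction_on with | H y =>
    intro h
    have h' : (QuotientGroup.mk ⟨((x : H) : G), x.2⟩ : K₁ ⧸ K.subgroupOf K₁) =
      QuotientGroup.mk ⟨((y : H) : G), y.2⟩ := h
    have h2 : (⟨((x : H) : G), x.2⟩ : K₁)⁻¹ * ⟨((y : H) : G), y.2⟩ ∈ K.subgroupOf K₁ :=
      QuotientGroup.eq.1 h'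
    have h3 : x⁻¹ * y ∈ (K.subgroupOf H).subgroupOf (K₁.subgroupOf H) := h2
    exact QuotientGroup.eq.2 h3
  have hcard : (K.subgroupOf H).relIndex (K₁.subgroupOf H) = Nat.card (Set.range j) :=
    Nat.card_congr (Equiv.ofInjective j hj)
  rw [hcard]
  have hout : ∀ (q : K₁ ⧸ K.subgroupOf K₁) (k : K₁), (k : K₁ ⧸ K.subgroupOf K₁) = q →
      L.translateRep (q.out : K₁) s = L.translateRep k s := fun q k hk =>
    out_apply_eq (L.translateRep.comp K₁.subtype) (fun k' hk' => hs k' hk') q k hk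
  refine quotient_sum_ite _ _ _ ?_ ?_
  · rintro _ ⟨x, rfl⟩
    induction x using QuotientGroup.induction_on with
    | H x =>
      have h := hout (j (x : _ ⧸ _)) ⟨((x : H) : G), x.2⟩ rfl
      rw [h, L.translateRep_apply_of_eq _ s (x : H).2]
      exact hz _ x.2 _
  · intro q hq
    rw [translateRep_apply]
    by_cases h0 : (((q.out : K₁) : G)⁻¹ • z) ∈ tube z 1 K
    · exfalso
      obtain ⟨k, hk, hkz⟩ := h0
      rw [one_mul] at hkz
      have hH : ((q.out : K₁) : G) * k ∈ H := by
        rw [MulAction.mem_stabilizer_iff, mul_smul, hkz, smul_inv_smul]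
      refine hq ⟨QuotientGroup.mk ⟨⟨_, hH⟩, K₁.mul_mem (q.out : K₁).2 (hKK₁ hk)⟩, ?_⟩
      conv_rhs => rw [← QuotientGroup.out_eq' q]
      refine QuotientGroup.eq.2 ?_
      change (((q.out : K₁) : G) * k)⁻¹ * ((q.out : K₁) : G) ∈ K
      rw [mul_inv_rev, inv_mul_cancel_right]
      exact K.inv_mem hk
    · rw [hs0 _ h0, map_zero]

variable [T2Space G] [SigmaCompactSpace G]

/-- The integral averages over `K₁` and evaluates at `z`; `e K` is the `K`-invariant section on `K
z` with a fixed value at `z`. Then `I (e K)` is the quotient of the index of `K ∩ G_z` in `K₁ ∩ G_z`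
by that of `K` in `K₁`. Conjugating `K` by the stabilizer multiplies these indices by the two
modular characters. -/
theorem exists_orbitIntegral {z : X} (hO : IsLocallyClosed (MulAction.orbit G z))
    {K₁ : Subgroup G} (hK₁c : IsCompact (K₁ : Set G))
    (hχ : ∀ k : MulAction.stabilizer G z, (k : G) ∈ K₁ → L.stabChar z k = 1) :
    Nonempty (L.OrbitIntegral z K₁) := by
  obtain ⟨ψ⟩ := L.exists_fiberEquiv z
  set v : L.Fiber z := ψ.symm 1 with hv
  have hψv : ψ v = 1 := ψ.apply_symm_apply 1
  have hact : ∀ k ∈ K₁, ∀ h : k • z = z, L.act k h v = v := fun k hk h => by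
    have := L.act_eq_stabChar_smul z ⟨k, h⟩ v
    rwa [hχ ⟨k, h⟩ hk, one_smul] at this
  have hcomp : ∀ K : Subgroup G, IsOpen (K : Set G) → K ≤ K₁ → IsCompact (K : Set G) :=
    fun K hK hKK₁ => hK₁c.of_isClosed_subset (K.isClosed_of_isOpen hK) hKK₁
  have hex : ∀ K : Subgroup G, ∃ e : L.sec (MulAction.orbit G z), IsOpen (K : Set G) → K ≤ K₁ →
      (e : ∀ x, L.Fiber x) ∈ L.sec (tube z 1 K) ∧ (e : ∀ x, L.Fiber x) z = v ∧
        ∀ k ∈ K, L.translateRep k (e : ∀ x, L.Fiber x) = e := fun K => by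
    by_cases hK : IsOpen (K : Set G) ∧ K ≤ K₁
    · obtain ⟨e, he, hez, heK⟩ := L.exists_invariant_section hO hK.1 (hcomp K hK.1 hK.2) v
        fun k hk => hact k (hK.2 hk)
      exact ⟨⟨e, L.sec_tube_le hO 1 hK.1 he⟩, fun _ _ => ⟨he, hez, heK⟩⟩
    · exact ⟨0, fun h1 h2 => absurd ⟨h1, h2⟩ hK⟩
  choose e he using hex
  have he0 : ∀ (K : Subgroup G) (hK : IsOpen (K : Set G)) (hKK₁ : K ≤ K₁), ∀ x ∉ tube z 1 K,
      (e K : ∀ x, L.Fiber x) x = 0 := fun K hK hKK₁ x hx =>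
    L.sec_zero_of_notMem (he K hK hKK₁).1 hx
  obtain ⟨E, hE1, hE2, hE3, hE4⟩ := exists_projection (ρ := (L.orbitRep z).comp K₁.subtype)
    fun m => L.isFiniteVector_orbitRep hK₁c m
  let I : L.sec (MulAction.orbit G z) →ₗ[R] R :=
    ψ.toLinearMap ∘ₗ LinearMap.proj z ∘ₗ (L.sec (MulAction.orbit G z)).subtype ∘ₗ E
  have hI : ∀ m, I m = ψ ((E m : ∀ x, L.Fiber x) z) := fun m => rfl
  have hIe : ∀ K : Subgroup G, IsOpen (K : Set G) → K ≤ K₁ →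
      (K.relIndex K₁ : R) * I (e K) = ((K.subgroupOf (MulAction.stabilizer G z)).relIndex
        (K₁.subgroupOf (MulAction.stabilizer G z)) : ℕ) := by
    intro K hK hKK₁
    obtain ⟨-, hez, heK⟩ := he K hK hKK₁
    have hfin : Finite (K₁ ⧸ K.subgroupOf K₁) :=
      Nat.finite_of_card_ne_zero (relIndex_ne_zero_of_isCompact hK hK₁c)
    have := Fintype.ofFinite (K₁ ⧸ K.subgroupOf K₁)
    have hfix : ∀ k ∈ K.subgroupOf K₁, (L.orbitRep z).comp K₁.subtype k (e K) = e K :=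
      fun k hk => Subtype.ext (heK k hk)
    have h1 := hE3 _ (apply_sum_out ((L.orbitRep z).comp K₁.subtype) hfix)
    rw [map_sum, Finset.sum_congr rfl fun q _ => hE2 _ _, Finset.sum_const, Finset.card_univ] at h1
    have h2 := congrArg (fun m : L.sec (MulAction.orbit G z) => ψ ((m : ∀ x, L.Fiber x) z)) h1
    have h3 : ψ ((((Fintype.card (K₁ ⧸ K.subgroupOf K₁) • E (e K) :
        L.sec (MulAction.orbit G z))) : ∀ x, L.Fiber x) z) = (K.relIndex K₁ : R) * I (e K) := by
      have h : ∀ (n : ℕ) (m : L.sec (MulAction.orbit G z)),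
          ((n • m : L.sec (MulAction.orbit G z)) : ∀ x, L.Fiber x) z =
            n • (m : ∀ x, L.Fiber x) z := fun _ _ => rfl
      rw [h, map_nsmul, nsmul_eq_mul, ← hI, Subgroup.relIndex, Subgroup.index,
        Nat.card_eq_fintype_card]
    have h4 : (((∑ q : K₁ ⧸ K.subgroupOf K₁, (L.orbitRep z).comp K₁.subtype q.out (e K) :
        L.sec (MulAction.orbit G z))) : ∀ x, L.Fiber x) z =
        ∑ q : K₁ ⧸ K.subgroupOf K₁, L.translateRep (q.out : K₁) (e K : ∀ x, L.Fiber x) z := by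
      rw [Submodule.coe_sum, Finset.sum_apply]
      rfl
    rw [← h3, h2, h4, L.sum_translate_apply hKK₁ heK (he0 K hK hKK₁)
      (by rw [hez]; exact hact), hez, map_nsmul, hψv, nsmul_eq_mul, mul_one]
  have hHc : IsClosed (MulAction.stabilizer G z : Set G) :=
    isClosed_eq (f := fun g : G => g • z) (by fun_prop) continuous_const
  have hK₁H : IsCompact (K₁.subgroupOf (MulAction.stabilizer G z) :
      Set (MulAction.stabilizer G z)) := hHc.isClosedEmbedding_subtypeVal.isCompact_preimage hK₁c
  have hKH : ∀ K : Subgroup G, IsOpen (K : Set G) →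
      IsOpen (K.subgroupOf (MulAction.stabilizer G z) : Set (MulAction.stabilizer G z)) :=
    fun K hK => hK.preimage continuous_subtype_val
  refine ⟨⟨I, e, fun k hk m => ?_, fun K hK hKK₁ => (he K hK hKK₁).1, fun K hK hKK₁ => ?_,
    fun h K hK hKK₁ hconj => ?_, fun K hK hKK₁ m hm => ?_⟩⟩
  · rw [hI, hI]
    exact congrArg (fun m : L.sec (MulAction.orbit G z) => ψ ((m : ∀ x, L.Fiber x) z))
      (hE2 ⟨k, hk⟩ m)
  · have h1 := isUnit_natCast_of_ne_zero R (relIndex_ne_zero_of_isCompact (hKH K hK) hK₁H)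
    rw [← hIe K hK hKK₁] at h1
    exact isUnit_of_mul_isUnit_right h1
  · let K' : Subgroup G := K.comap (MulAut.conj (h : G)⁻¹).toMonoidHom
    have hK' : ∀ x, x ∈ K' ↔ (h : G)⁻¹ * x * h ∈ K := fun x => by
      simp [K', Subgroup.mem_comap]
    have hK'K₁ : K' ≤ K₁ := fun x hx => by
      have := hconj _ ((hK' x).1 hx)
      simpa [mul_assoc] using this
    have hK'o : IsOpen (K' : Set G) := by
      rw [show (K' : Set G) = (fun x => (h : G)⁻¹ * x * h) ⁻¹' (K : Set G) from Set.ext hK']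
      exact hK.preimage (by fun_prop)
    obtain ⟨-, hez, heK⟩ := he K hK hKK₁
    obtain ⟨-, hez', heK'⟩ := he K' hK'o hK'K₁
    have hχh : L.orbitRep z h (e K) = L.stabChar z h • e K' := by
      refine Subtype.ext ?_
      change L.translateRep (h : G) (e K : ∀ x, L.Fiber x) =
        L.stabChar z h • (e K' : ∀ x, L.Fiber x)
      refine L.eq_of_invariant_of_apply_eq (z := z) (K := K') ?_ ?_ ?_ ?_ ?_
      · intro x hx
        rw [translateRep_apply, he0 K hK hKK₁, map_zero]
        rintro ⟨k, hk, hkx⟩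
        rw [one_mul] at hkx
        refine hx ⟨h * k * (h : G)⁻¹, (hK' _).2 (by simpa [mul_assoc] using hk), ?_⟩
        have hz : (h : G)⁻¹ • z = z := (h⁻¹).2
        rw [one_mul, mul_smul, hz, mul_smul, hkx, smul_inv_smul]
      · intro x hx
        rw [Pi.smul_apply, he0 K' hK'o hK'K₁ x hx, smul_zero]
      · intro k hk
        have h1 : k * h = h * ((h : G)⁻¹ * k * h) := by group
        rw [← Module.End.mul_apply, ← map_mul, h1, map_mul, Module.End.mul_apply,
          heK _ ((hK' k).1 hk)]
      · intro k hk
        rw [map_smul, heK' k hk]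
      · rw [L.translateRep_apply_of_eq (h : G) _ h.2, Pi.smul_apply, hez, hez']
        exact L.act_eq_stabChar_smul z h v
    rw [hχh, map_smul, smul_eq_mul]
    have hG := relIndex_conj_eq_modulus_mul (h : G) hK' hK hKK₁ hK'K₁ hK₁c
    have hH := relIndex_conj_eq_modulus_mul h
      (K := K.subgroupOf (MulAction.stabilizer G z)) (K' := K'.subgroupOf (MulAction.stabilizer G z))
      (K₁ := K₁.subgroupOf (MulAction.stabilizer G z))
      (fun x => hK' x) (hKH K hK) (Subgroup.comap_mono hKK₁) (Subgroup.comap_mono hK'K₁) hK₁H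
    have hG' := congrArg (nnrealHom R) hG
    have hH' := congrArg (nnrealHom R) hH
    rw [map_mul, map_natCast, map_natCast] at hG' hH'
    rw [← hIe K hK hKK₁, ← hIe K' hK'o hK'K₁, hG'] at hH'
    have hΔ : modulus G (h : G) ≠ 0 := by
      intro h0
      have h1 := (modulus G).map_mul (h : G) (h : G)⁻¹
      rw [mul_inv_cancel, map_one, h0, zero_mul] at h1
      exact one_ne_zero h1
    have hu := (isUnit_nnrealHom R hΔ).mul
      (isUnit_natCast_of_ne_zero R (relIndex_ne_zero_of_isCompact hK hK₁c))
    change _ = L.stabChar z h * nnrealHom R (modulus (MulAction.stabilizer G z) h /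
      modulus G (h : G)) * I (e K)
    rw [mul_assoc]
    congr 1
    -- Both sides are compared after clearing `Δ_G(h)` and the index of `K` in `K₁`, which are units
    -- in `R`.
    refine hu.mul_left_cancel ?_
    rw [hH']
    have hdiv : nnrealHom R (modulus G (h : G)) * nnrealHom R (modulus (MulAction.stabilizer G z) h /
        modulus G (h : G)) = nnrealHom R (modulus (MulAction.stabilizer G z) h) := by
      rw [← map_mul, mul_div_cancel₀ _ hΔ]
    rw [← hdiv]
    ring
  · obtain ⟨-, hez, heK⟩ := he K hK hKK₁
    -- The `K`-average of `m` is invariant and still supported on `K z`, so its value at `z`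
    -- determines it as a multiple of `e K`.
    obtain ⟨m', hm', hmm'⟩ :=
      (L.isFiniteVector_orbitRep (hcomp K hK hKK₁) m).exists_average
    have hsup : ∀ x ∉ tube z 1 K, (m' : ∀ x, L.Fiber x) x = 0 := by
      intro x hx
      have hle : Submodule.span R (Set.range fun k => (L.orbitRep z).comp K.subtype k m - m) ≤
          LinearMap.ker (LinearMap.proj (R := R) x ∘ₗ
            (L.sec (MulAction.orbit G z)).subtype) := by
        refine Submodule.span_le.2 ?_
        rintro _ ⟨k, rfl⟩
        change L.translateRep (k : G) (m : ∀ x, L.Fiber x) x - (m : ∀ x, L.Fiber x) x = 0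
        rw [L.sec_zero_of_notMem hm hx, translateRep_apply, L.sec_zero_of_notMem hm, map_zero,
          sub_zero]
        rintro ⟨k', hk', hkx⟩
        rw [one_mul] at hkx
        exact hx ⟨k * k', K.mul_mem k.2 hk', by rw [one_mul, mul_smul, hkx, smul_inv_smul]⟩
      have h1 : (m : ∀ x, L.Fiber x) x - (m' : ∀ x, L.Fiber x) x = 0 := hle hmm'
      rwa [L.sec_zero_of_notMem hm hx, zero_sub, neg_eq_zero] at h1
    refine ⟨ψ ((m' : ∀ x, L.Fiber x) z), ?_⟩
    have h1 : m' = ψ ((m' : ∀ x, L.Fiber x) z) • e K := by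
      refine Subtype.ext ?_
      refine L.eq_of_invariant_of_apply_eq (z := z) (K := K) hsup ?_
        (fun k hk => congrArg Subtype.val (hm' ⟨k, hk⟩)) ?_ ?_
      · intro x hx
        change ψ ((m' : ∀ x, L.Fiber x) z) • (e K : ∀ x, L.Fiber x) x = 0
        rw [he0 K hK hKK₁ x hx, smul_zero]
      · intro k hk
        change L.translateRep k (ψ ((m' : ∀ x, L.Fiber x) z) • (e K : ∀ x, L.Fiber x)) =
          ψ ((m' : ∀ x, L.Fiber x) z) • (e K : ∀ x, L.Fiber x)
        rw [map_smul, heK k hk]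
      · change _ = ψ ((m' : ∀ x, L.Fiber x) z) • (e K : ∀ x, L.Fiber x) z
        rw [hez, hv, ← map_smul, smul_eq_mul, mul_one, ψ.symm_apply_apply]
    rw [← h1]
    refine Submodule.span_mono ?_ hmm'
    rintro _ ⟨k, rfl⟩
    exact ⟨k, m, trivial, rfl⟩

end OrbitIntegral

end EquivariantLineBundle

theorem coinvSub_le_ker {R K V A : Type*} [CommRing R] [Group K] [AddCommGroup V] [Module R V]
    [AddCommGroup A] [Module R A] {ρ : Representation R K V} {W : Submodule R V} (f : V →ₗ[R] A)
    (hf : ∀ k v, f (ρ k v) = f v) : coinvSub ρ W ≤ LinearMap.ker f := by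
  refine Submodule.span_le.2 ?_
  rintro _ ⟨k, v, -, rfl⟩
  change f (ρ k v - v) = 0
  rw [map_sub, hf, sub_self]

namespace EquivariantLineBundle

/-! ### Decomposition of orbit sections into pieces supported on tubes -/

section TubeSections

variable {R : Type u} {G : Type v} {X : Type w} [CommRing R]
    [Group G] [TopologicalSpace G] [IsTopologicalGroup G] [SigmaCompactSpace G]
    [TopologicalSpace X] [LocallyCompactSpace X] [T2Space X] [TotallyDisconnectedSpace X]
    [MulAction G X] [ContinuousSMul G X]
    (L : EquivariantLineBundle.{u, v, w, t} R G X)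

/-- The sections over the orbit of `z` that are supported on `g K z`. -/
def tubeSub (z : X) (g : G) (K : Subgroup G) : Submodule R (L.sec (MulAction.orbit G z)) where
  carrier := {m | ∀ x ∉ tube z g K, (m : ∀ x, L.Fiber x) x = 0}
  zero_mem' := fun _ _ => rfl
  add_mem' := fun {m m'} hm hm' x hx => by
    change (m : ∀ x, L.Fiber x) x + (m' : ∀ x, L.Fiber x) x = 0
    rw [hm x hx, hm' x hx, add_zero]
  smul_mem' := fun r m hm x hx => by
    change r • (m : ∀ x, L.Fiber x) x = 0
    rw [hm x hx, smul_zero]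

variable {L} in
theorem tubeSub_mono {z : X} {g g' : G} {K K' : Subgroup G} (h : tube z g K ⊆ tube z g' K') :
    L.tubeSub z g K ≤ L.tubeSub z g' K' := fun _ hm x hx => hm x fun hx' => hx (h hx')

variable {L} in
theorem orbitRep_mem_tubeSub {z : X} {g : G} {K : Subgroup G}
    {m : L.sec (MulAction.orbit G z)} (hm : m ∈ L.tubeSub z g K) (g' : G) :
    L.orbitRep z g' m ∈ L.tubeSub z (g' * g) K := by
  intro x hx
  rw [coe_orbitRep, translateRep_apply, hm, map_zero]
  rintro ⟨k, hk, hkx⟩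
  exact hx ⟨k, hk, by rw [mul_assoc, mul_smul, hkx, smul_inv_smul]⟩

variable {L} in
theorem orbitRep_stabilizer_mem_tubeSub {z : X} {K K' : Subgroup G}
    {m : L.sec (MulAction.orbit G z)} (hm : m ∈ L.tubeSub z 1 K) (h : MulAction.stabilizer G z)
    (hK : ∀ k ∈ K, (h : G) * k * (h : G)⁻¹ ∈ K') :
    L.orbitRep z h m ∈ L.tubeSub z 1 K' := by
  refine tubeSub_mono ?_ (orbitRep_mem_tubeSub hm (h : G))
  rintro _ ⟨k, hk, rfl⟩
  have hz : (h : G)⁻¹ • z = z := (h⁻¹).2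
  refine ⟨_, hK k hk, ?_⟩
  rw [one_mul, mul_one, mul_smul, hz]

theorem mem_sec_of_mem_tubeSub {z : X} {g : G} {K : Subgroup G} (hK : IsCompact (K : Set G))
    {m : L.sec (MulAction.orbit G z)} (hm : m ∈ L.tubeSub z g K) :
    (m : ∀ x, L.Fiber x) ∈ L.sec (tube z g K) :=
  L.mem_sec_tube_of_mem_sec_orbit g hK m.2 hm

/-- Tubes are relatively open and cover the orbit, so a clopen partition splits each section. -/
theorem iSup_tubeSub {z : X} (hO : IsLocallyClosed (MulAction.orbit G z)) {K : Subgroup G}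
    (hK : IsOpen (K : Set G)) : ⨆ g, L.tubeSub z g K = ⊤ := by
  rw [eq_top_iff]
  intro m _
  suffices (m : ∀ x, L.Fiber x) ∈
      (⨆ g, L.tubeSub z g K).map (L.sec (MulAction.orbit G z)).subtype by
    obtain ⟨m', hm', h⟩ := this
    rwa [← show m' = m from Subtype.ext h]
  refine L.mem_of_locally m.2 _ ?_
  rintro _ ⟨g, rfl⟩
  refine ⟨_, eventually_mem_tube hO g hK ⟨1, K.one_mem, by rw [mul_one]⟩, fun B hB hBc => ?_⟩
  refine ⟨⟨L.cut B m, L.cut_clopen_mem_sec m.2 hBc⟩,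
    Submodule.mem_iSup_of_mem g fun x hx => ?_, rfl⟩
  change L.cut B m x = 0
  by_cases hxB : x ∈ B
  · rw [L.cut_of_mem _ hxB]
    exact L.sec_zero_of_notMem m.2 fun hxO => hx (hB hxB hxO)
  · exact L.cut_of_notMem _ hxB

/-- Cutting off a section over an orbit outside a tube. -/
def cutTube {z : X} (hO : IsLocallyClosed (MulAction.orbit G z)) (g : G) {K : Subgroup G}
    (hK : IsOpen (K : Set G)) (hKc : IsCompact (K : Set G)) :
    L.sec (MulAction.orbit G z) →ₗ[R] L.sec (MulAction.orbit G z) :=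
  (L.cut (tube z g K)).restrict fun _ hs => L.sec_tube_le hO g hK (L.cut_tube_mem_sec g hKc hs)

/-- Gluing linear functionals that are given on the sections supported on tubes. -/
theorem exists_glue {z : X} (hO : IsLocallyClosed (MulAction.orbit G z)) {K : Subgroup G}
    (hK : IsOpen (K : Set G)) (hKc : IsCompact (K : Set G)) {A : Type*} [AddCommGroup A]
    [Module R A] (l : G → L.sec (MulAction.orbit G z) →ₗ[R] A)
    (hl : ∀ g g' m, m ∈ L.tubeSub z g K → m ∈ L.tubeSub z g' K → l g m = l g' m)
    (S : Finset G) : ∃ f : L.sec (MulAction.orbit G z) →ₗ[R] A,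
      ∀ g ∈ S, ∀ m ∈ L.tubeSub z g K, f m = l g m := by
  classical
  induction S using Finset.induction_on with
  | empty => exact ⟨0, by simp⟩
  | insert g S _ ih =>
    obtain ⟨f, hf⟩ := ih
    let C := L.cutTube hO g hK hKc
    have hC : ∀ m, C m ∈ L.tubeSub z g K := fun m x hx => L.cut_of_notMem _ hx
    have hC' : ∀ g' m, m ∈ L.tubeSub z g' K → C m ∈ L.tubeSub z g' K := by
      intro g' m hm x hx
      change L.cut (tube z g K) m x = 0
      by_cases hxg : x ∈ tube z g K
      · rw [L.cut_of_mem _ hxg, hm x hx]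
      · exact L.cut_of_notMem _ hxg
    -- On the new tube the functional is `l g`, off it the one already built; compatibility on
    -- overlaps keeps the earlier values.
    refine ⟨l g ∘ₗ C + f ∘ₗ (1 - C), fun g' hg' m hm => ?_⟩
    change l g (C m) + f (m - C m) = l g' m
    rcases Finset.mem_insert.1 hg' with rfl | hg'
    · have : C m = m := Subtype.ext (L.cut_eq_self hm)
      rw [this, sub_self, map_zero, add_zero]
    · rw [hf g' hg' _ (Submodule.sub_mem _ hm (hC' g' m hm)), hl g g' _ (hC m) (hC' g' m hm),
        map_sub, add_sub_cancel]

end TubeSections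

/-! ### Shapiro's lemma for an orbit, in dual form -/

section Shapiro

variable {R : Type u} {G : Type v} {X : Type w} [CommRing R] [Algebra ℂ R]
    [Group G] [TopologicalSpace G] [IsTopologicalGroup G]
    [LocallyCompactSpace G] [T2Space G] [TotallyDisconnectedSpace G] [SigmaCompactSpace G]
    [TopologicalSpace X] [LocallyCompactSpace X] [T2Space X] [TotallyDisconnectedSpace X]
    [MulAction G X] [ContinuousSMul G X]
    {L : EquivariantLineBundle.{u, v, w, t} R G X} {z : X} {K₁ : Subgroup G}

/-- The elements of `K₁` that stay in `K₁` after conjugation by `g`. -/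
def conjInf (K₁ : Subgroup G) (g : G) : Subgroup G :=
  K₁ ⊓ K₁.comap (MulAut.conj g).toMonoidHom

theorem isOpen_conjInf (hK₁ : IsOpen (K₁ : Set G)) (g : G) : IsOpen (conjInf K₁ g : Set G) :=
  hK₁.inter (hK₁.preimage (f := fun k => g * k * g⁻¹) (by fun_prop))

/-- Uniqueness of invariant functionals: modulo the `K`-coinvariant kernel `m` is `r • e K`, so `f`
and the integral both see only `r`. -/
theorem smul_apply_eq_of_invariant (J : L.OrbitIntegral z K₁) (hK₁c : IsCompact (K₁ : Set G))
    {K : Subgroup G} (hK : IsOpen (K : Set G)) (hKK₁ : K ≤ K₁) {A : Type*} [AddCommGroup A]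
    [Module R A] (f : L.sec (MulAction.orbit G z) →ₗ[R] A)
    (hf : ∀ k ∈ K, ∀ m, f (L.orbitRep z k m) = f m) {m : L.sec (MulAction.orbit G z)}
    (hm : m ∈ L.tubeSub z 1 K) : J.I (J.e K) • f m = J.I m • f (J.e K) := by
  have hKc : IsCompact (K : Set G) := hK₁c.of_isClosed_subset (K.isClosed_of_isOpen hK) hKK₁
  obtain ⟨r, hr⟩ := J.exists_sub_mem K hK hKK₁ m (L.mem_sec_of_mem_tubeSub hKc hm)
  have h1 := coinvSub_le_ker (ρ := (L.orbitRep z).comp K.subtype) f (fun k m => hf (k : G) k.2 m) hr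
  have h2 := coinvSub_le_ker (ρ := (L.orbitRep z).comp K.subtype) J.I
    (fun k m => J.I_translate (k : G) (hKK₁ k.2) m) hr
  rw [LinearMap.mem_ker, map_sub, map_smul, sub_eq_zero] at h1 h2
  rw [h1, h2, smul_smul, smul_eq_mul, mul_comm]

theorem orbitIntegral_stabilizer (J : L.OrbitIntegral z K₁) (hK₁c : IsCompact (K₁ : Set G))
    {K : Subgroup G} (hK : IsOpen (K : Set G)) (hKK₁ : K ≤ K₁) (h : MulAction.stabilizer G z)
    (hconj : ∀ k ∈ K, (h : G) * k * (h : G)⁻¹ ∈ K₁) {m : L.sec (MulAction.orbit G z)}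
    (hm : m ∈ L.tubeSub z 1 K) : J.I (L.orbitRep z h m) = L.twistedChar z h * J.I m := by
  have h1 := smul_apply_eq_of_invariant J hK₁c hK hKK₁ (J.I ∘ₗ L.orbitRep z (h : G))
    (fun k hk m => by
      have h2 : (h : G) * k = ((h : G) * k * (h : G)⁻¹) * h := by group
      rw [LinearMap.comp_apply, LinearMap.comp_apply, ← Module.End.mul_apply, ← map_mul, h2,
        map_mul, Module.End.mul_apply, J.I_translate _ (hconj k hk)]) hm
  rw [LinearMap.comp_apply, LinearMap.comp_apply, J.I_stabilizer h K hK hKK₁ hconj] at h1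
  refine (J.isUnit_I_e K hK hKK₁).mul_left_cancel (h1.trans ?_)
  rw [smul_eq_mul]
  ring

/-- Near `z` the quotient map is a `G`-invariant functional, hence a multiple of the integral.
Comparison under the stabilizer shows that its value on `e K₁` is fixed by `twistedChar`, so it
vanishes by the hypothesis on `H₀`. Translates of sections near `z` generate everything. -/
theorem coinvSub_orbitRep_eq_top (J : L.OrbitIntegral z K₁) (hK₁ : IsOpen (K₁ : Set G))
    (hK₁c : IsCompact (K₁ : Set G)) (hO : IsLocallyClosed (MulAction.orbit G z))
    (h0 : IsZero ((smoothHomology R (MulAction.stabilizer G z) 0).obj (L.twistedRep z))) :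
    coinvSub (L.orbitRep z) ⊤ = ⊤ := by
  set q := (coinvSub (L.orbitRep z) ⊤).mkQ with hq
  have hqg : ∀ g m, q (L.orbitRep z g m) = q m := fun g m => by
    rw [← sub_eq_zero, ← map_sub, hq, Submodule.mkQ_apply, Submodule.Quotient.mk_eq_zero]
    exact sub_mem_coinvSub g Submodule.mem_top
  have hA : ∀ m ∈ L.tubeSub z 1 K₁, J.I (J.e K₁) • q m = J.I m • q (J.e K₁) := fun m hm =>
    smul_apply_eq_of_invariant J hK₁c hK₁ le_rfl q (fun k _ m => hqg k m) hm
  have he : q (J.e K₁) = 0 := by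
    refine eq_zero_of_isZero_smoothHomology_zero h0 _ fun h => ?_
    have hKo := isOpen_conjInf hK₁ (h : G)
    have hKle : conjInf K₁ (h : G) ≤ K₁ := inf_le_left
    have hconj : ∀ k ∈ conjInf K₁ (h : G), (h : G) * k * (h : G)⁻¹ ∈ K₁ := fun k hk => hk.2
    have hem : J.e (conjInf K₁ (h : G)) ∈ L.tubeSub z 1 (conjInf K₁ (h : G)) := fun x hx =>
      L.sec_zero_of_notMem (J.e_mem _ hKo hKle) hx
    have hem' : J.e (conjInf K₁ (h : G)) ∈ L.tubeSub z 1 K₁ :=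
      tubeSub_mono (fun _ ⟨k, hk, e⟩ => ⟨k, hKle hk, e⟩) hem
    have h1 := hA _ hem'
    have h2 := hA _ (orbitRep_stabilizer_mem_tubeSub hem h hconj)
    rw [hqg, h1, J.I_stabilizer h _ hKo hKle hconj, mul_comm, mul_smul] at h2
    exact ((J.isUnit_I_e _ hKo hKle).smul_left_cancel.1 h2).symm
  have h1 : ∀ m ∈ L.tubeSub z 1 K₁, q m = 0 := fun m hm => by
    have := hA m hm
    rw [he, smul_zero] at this
    exact (J.isUnit_I_e K₁ hK₁ le_rfl).smul_eq_zero.1 this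
  refine top_le_iff.1 ((L.iSup_tubeSub hO hK₁).ge.trans (iSup_le fun g m hm => ?_))
  have h2 := h1 _ (by simpa using orbitRep_mem_tubeSub hm g⁻¹)
  rwa [hqg, hq, Submodule.mkQ_apply, Submodule.Quotient.mk_eq_zero] at h2

/-- A cocycle of `G` with values in the functionals on the sections over an orbit is a coboundary
on finite sets. -/
theorem exists_primitive (J : L.OrbitIntegral z K₁) (hK₁ : IsOpen (K₁ : Set G))
    (hK₁c : IsCompact (K₁ : Set G)) (hO : IsLocallyClosed (MulAction.orbit G z))
    (h0 : IsZero ((smoothHomology R (MulAction.stabilizer G z) 0).obj (L.twistedRep z)))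
    (h1 : IsZero ((smoothHomology R (MulAction.stabilizer G z) 1).obj (L.twistedRep z)))
    {A : Type*} [AddCommGroup A] [Module R A] (D : G → L.sec (MulAction.orbit G z) →ₗ[R] A)
    (hD : ∀ g h m, D (g * h) m = D g (L.orbitRep z h m) + D h m) (hD1 : ∀ k ∈ K₁, D k = 0)
    (c : G →₀ L.sec (MulAction.orbit G z)) : ∃ f : L.sec (MulAction.orbit G z) →ₗ[R] A,
      ∀ g, D g (c g) = f (L.orbitRep z g (c g)) - f (c g) := by
  classical
  have hKo := fun g => isOpen_conjInf hK₁ g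
  have hKle : ∀ g, conjInf K₁ g ≤ K₁ := fun g => inf_le_left
  have hem : ∀ K : Subgroup G, IsOpen (K : Set G) → K ≤ K₁ → J.e K ∈ L.tubeSub z 1 K :=
    fun K hK hKK₁ x hx => L.sec_zero_of_notMem (J.e_mem _ hK hKK₁) hx
  have hinv : ∀ h : MulAction.stabilizer G z, ∀ k ∈ conjInf K₁ (h : G), ∀ m,
      D h (L.orbitRep z k m) = D h m := by
    intro h k hk m
    have e1 := hD h k m
    have e2 := hD ((h : G) * k * (h : G)⁻¹) h m
    rw [hD1 k hk.1, LinearMap.zero_apply, add_zero] at e1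
    rw [hD1 ((h : G) * k * (h : G)⁻¹) hk.2, LinearMap.zero_apply, zero_add, inv_mul_cancel_right] at e2
    rw [← e1, e2]
  have hu : ∀ h : MulAction.stabilizer G z, ∃ a : A, ∀ m ∈ L.tubeSub z 1 (conjInf K₁ (h : G)),
      D h m = J.I m • a := by
    intro h
    obtain ⟨u, hu⟩ := J.isUnit_I_e _ (hKo h) (hKle h)
    refine ⟨(↑u⁻¹ : R) • D h (J.e (conjInf K₁ (h : G))), fun m hm => ?_⟩
    have e1 := smul_apply_eq_of_invariant J hK₁c (hKo h) (hKle h) (D h) (hinv h) hm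
    rw [smul_smul, mul_comm, mul_smul, ← e1, smul_smul, ← hu, Units.inv_mul, one_smul]
  choose u hu using hu
  have hcoc : ∀ h h', u (h * h') = L.twistedChar z h' • u h + u h' := by
    intro h h'
    -- A subgroup small enough for `h'`, for `h h'`, and, after conjugation by `h'`, for `h`, so
    -- that all three formulas apply to `e K`.
    let K := conjInf K₁ (h' : G) ⊓ conjInf K₁ ((h * h' : MulAction.stabilizer G z) : G)
    have hK : IsOpen (K : Set G) := (hKo _).inter (hKo _)
    have hKK₁ : K ≤ K₁ := inf_le_left.trans (hKle _)
    have hm := hem K hK hKK₁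
    have e1 := hu (h * h') _ (tubeSub_mono (fun _ ⟨k, hk, e⟩ => ⟨k, hk.2, e⟩) hm)
    have e2 := hu h' _ (tubeSub_mono (fun _ ⟨k, hk, e⟩ => ⟨k, hk.1, e⟩) hm)
    have e3 := hu h _ (orbitRep_stabilizer_mem_tubeSub hm h' (K' := conjInf K₁ (h : G))
      fun k hk => ⟨hk.1.2, by
        have := hk.2.2
        change ((h : G) * h') * k * ((h : G) * h')⁻¹ ∈ K₁ at this
        change (h : G) * (h' * k * (h' : G)⁻¹) * (h : G)⁻¹ ∈ K₁
        simpa [mul_assoc] using this⟩)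
    have e4 := hD h h' (J.e K)
    rw [J.I_stabilizer h' K hK hKK₁ fun k hk => hk.1.2] at e3
    change D ((h : G) * h') (J.e K) = _ at e1
    rw [e1, e2, e3, mul_comm, mul_smul, ← smul_add] at e4
    exact (J.isUnit_I_e K hK hKK₁).smul_left_cancel.1 e4
  have hu1 : ∀ᶠ h in 𝓝 (1 : MulAction.stabilizer G z), u h = 0 := by
    filter_upwards [(hK₁.preimage continuous_subtype_val).mem_nhds
      (show ((1 : MulAction.stabilizer G z) : G) ∈ (K₁ : Set G) from K₁.one_mem)] with h hh
    have e1 := hu h _ (hem _ (hKo h) (hKle h))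
    rw [hD1 h hh, LinearMap.zero_apply] at e1
    exact (J.isUnit_I_e _ (hKo h) (hKle h)).smul_eq_zero.1 e1.symm
  obtain ⟨a, ha⟩ := exists_coboundary h0 h1 u hcoc hu1
  have hst : ∀ h : MulAction.stabilizer G z, ∀ m ∈ L.tubeSub z 1 (conjInf K₁ (h : G)),
      D h m + J.I m • a = J.I (L.orbitRep z h m) • a := by
    intro h m hm
    rw [orbitIntegral_stabilizer J hK₁c (hKo h) (hKle h) h (fun k hk => hk.2) hm, hu h m hm, ha,
      smul_sub, sub_add_cancel, smul_smul, mul_comm]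
  -- The candidate primitive near `g z`: `I • a` solves the problem for the stabilizer near `z`, and
  -- the cocycle transports it by `g`.
  let l : G → L.sec (MulAction.orbit G z) →ₗ[R] A := fun g =>
    (D g + J.I.smulRight a) ∘ₗ L.orbitRep z g⁻¹
  have hl : ∀ g m, l g m = D g (L.orbitRep z g⁻¹ m) + J.I (L.orbitRep z g⁻¹ m) • a :=
    fun _ _ => rfl
  have hρ : ∀ g g' m, L.orbitRep z g (L.orbitRep z g' m) = L.orbitRep z (g * g') m :=
    fun g g' m => by rw [map_mul, Module.End.mul_apply]
  have hlmul : ∀ g g' m, l (g * g') (L.orbitRep z g m) = D g m + l g' m := by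
    intro g g' m
    rw [hl, hl, hρ, hD, hρ, mul_inv_rev, inv_mul_cancel_right, mul_inv_cancel, map_one,
      Module.End.one_apply, add_assoc]
  have hlK : ∀ g, ∀ k ∈ K₁, l (g * k) = l g := by
    intro g k hk
    refine LinearMap.ext fun m => ?_
    have e : L.orbitRep z (g * k)⁻¹ m = L.orbitRep z k⁻¹ (L.orbitRep z g⁻¹ m) := by
      rw [hρ, mul_inv_rev]
    rw [hl, hl, hD, hD1 k hk, LinearMap.zero_apply, add_zero, e,
      J.I_translate _ (K₁.inv_mem hk), hρ k, mul_inv_cancel, map_one, Module.End.one_apply]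
  have hlH : ∀ g (h : MulAction.stabilizer G z), ∀ m ∈ L.tubeSub z (g * h) (conjInf K₁ (h : G)),
      l (g * h) m = l g m := by
    intro g h m hm
    have hm' := orbitRep_mem_tubeSub hm (g * h : G)⁻¹
    rw [inv_mul_cancel] at hm'
    have e1 := hst h _ hm'
    have e2 : (h : G) * (g * h : G)⁻¹ = g⁻¹ := by group
    rw [hρ, e2] at e1
    rw [hl, hl, hD, hρ, e2, add_assoc, e1]
  have hglue : ∀ g g' m, m ∈ L.tubeSub z g K₁ → m ∈ L.tubeSub z g' K₁ → l g m = l g' m := by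
    intro g g' m hm hm'
    suffices (m : ∀ x, L.Fiber x) ∈
        (LinearMap.ker (l g - l g')).map (L.sec (MulAction.orbit G z)).subtype by
      obtain ⟨m₁, hm₁, h⟩ := this
      obtain rfl : m₁ = m := Subtype.ext h
      exact sub_eq_zero.1 hm₁
    refine L.mem_of_locally m.2 _ fun x _ => ?_
    by_cases hx : x ∈ tube z g K₁ ∩ tube z g' K₁
    · obtain ⟨⟨k, hk, hkx⟩, k', hk', hkx'⟩ := hx
      -- Two ways of reaching `x` from `z` differ by a stabilizer element; `hlH` compares the
      -- corresponding functionals on sections supported close to `x`.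
      let h : MulAction.stabilizer G z := ⟨(g' * k')⁻¹ * (g * k), by
        rw [MulAction.mem_stabilizer_iff, mul_smul, hkx, ← hkx', inv_smul_smul]⟩
      have hh : g * k = (g' * k') * h := (mul_inv_cancel_left _ _).symm
      refine ⟨_, eventually_mem_tube hO (g * k) (hKo h) (x := x) ⟨1, Subgroup.one_mem _, by
        rwa [mul_one]⟩, fun B hB hBc => ?_⟩
      refine ⟨⟨L.cut B m, L.cut_clopen_mem_sec m.2 hBc⟩, ?_, rfl⟩
      change l g _ - l g' _ = 0
      rw [← hlK g k hk, ← hlK g' k' hk', hh, hlH, sub_self]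
      rw [← hh]
      intro y hy
      change L.cut B m y = 0
      by_cases hyB : y ∈ B
      · rw [L.cut_of_mem _ hyB]
        exact L.sec_zero_of_notMem m.2 fun hyO => hy (hB hyB hyO)
      · exact L.cut_of_notMem _ hyB
    · refine ⟨_, ((isCompact_tube z g hK₁c).inter
        (isCompact_tube z g' hK₁c)).isClosed.isOpen_compl.mem_nhds hx, fun B hB _ => ?_⟩
      rw [L.cut_eq_zero]
      · exact Submodule.zero_mem _
      · intro y hy
        by_cases hyg : y ∈ tube z g K₁
        · exact hm' y fun h => hB hy ⟨hyg, h⟩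
        · exact hm y hyg
  -- Each identity involves only finitely many tubes, so gluing over a finite set suffices for the
  -- finitely supported `c`.
  have hfin : ∀ g m, ∃ S : Finset G, ∀ f : L.sec (MulAction.orbit G z) →ₗ[R] A,
      (∀ g ∈ S, ∀ m ∈ L.tubeSub z g K₁, f m = l g m) →
      D g m = f (L.orbitRep z g m) - f m := by
    intro g m
    have hm : m ∈ ⨆ g, L.tubeSub z g K₁ := by
      rw [L.iSup_tubeSub hO hK₁]
      trivial
    refine Submodule.iSup_induction _ (motive := fun m => ∃ S : Finset G,
      ∀ f : L.sec (MulAction.orbit G z) →ₗ[R] A,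
      (∀ g ∈ S, ∀ m ∈ L.tubeSub z g K₁, f m = l g m) →
      D g m = f (L.orbitRep z g m) - f m) hm ?_ ?_ ?_
    · intro g' m hm
      refine ⟨{g', g * g'}, fun f hf => ?_⟩
      rw [hf g' (by simp) m hm, hf (g * g') (by simp) _ (orbitRep_mem_tubeSub hm g), hlmul,
        add_sub_cancel_right]
    · exact ⟨∅, fun f _ => by simp⟩
    · rintro m m' ⟨S, hS⟩ ⟨S', hS'⟩
      refine ⟨S ∪ S', fun f hf => ?_⟩
      rw [map_add, map_add, map_add, map_add,
        hS f fun g hg => hf g (Finset.mem_union_left _ hg),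
        hS' f fun g hg => hf g (Finset.mem_union_right _ hg)]
      abel
  choose S hS using hfin
  obtain ⟨f, hf⟩ := L.exists_glue hO hK₁ hK₁c l hglue (c.support.biUnion fun g => S g (c g))
  refine ⟨f, fun g => ?_⟩
  by_cases hg : g ∈ c.support
  · exact hS g (c g) f fun g' hg' => hf g' (Finset.mem_biUnion.2 ⟨g, hg, hg'⟩)
  · rw [Finsupp.notMem_support_iff.1 hg, map_zero, map_zero, map_zero, sub_zero]

end Shapiro

/-! ### Vanishing of `H₀` and `H₁` on an orbit -/

section Orbits

variable {R : Type u} {G : Type v} {X : Type w} [CommRing R] [Algebra ℂ R]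
    [Group G] [TopologicalSpace G] [IsTopologicalGroup G]
    [LocallyCompactSpace G] [T2Space G] [TotallyDisconnectedSpace G] [SigmaCompactSpace G]
    [TopologicalSpace X] [LocallyCompactSpace X] [T2Space X] [TotallyDisconnectedSpace X]
    [MulAction G X] [ContinuousSMul G X]
    (L : EquivariantLineBundle.{u, v, w, t} R G X) {z : X}

theorem exists_subgroup_orbitIntegral (hO : IsLocallyClosed (MulAction.orbit G z))
    {K₀ : Subgroup G} (hK₀ : IsOpen (K₀ : Set G)) : ∃ K₁ ≤ K₀, IsOpen (K₁ : Set G) ∧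
      IsCompact (K₁ : Set G) ∧ Nonempty (L.OrbitIntegral z K₁) := by
  have h := L.eventually_stabChar z
  rw [nhds_subtype_eq_comap, Filter.eventually_comap] at h
  obtain ⟨K₁, hK₁, hK₁c, hle⟩ := exists_compact_open_subgroup
    (Filter.inter_mem h (hK₀.mem_nhds K₀.one_mem))
  exact ⟨K₁, fun k hk => (hle hk).2, hK₁, hK₁c,
    L.exists_orbitIntegral hO hK₁c fun k hk => (hle hk).1 k rfl⟩

theorem sec_orbit_le_coinvSub (hO : IsLocallyClosed (MulAction.orbit G z))
    (h0 : IsZero ((smoothHomology R (MulAction.stabilizer G z) 0).obj (L.twistedRep z))) :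
    L.sec (MulAction.orbit G z) ≤ coinvSub L.translateRep (L.sec (MulAction.orbit G z)) := by
  obtain ⟨K₁, -, hK₁, hK₁c, ⟨J⟩⟩ := L.exists_subgroup_orbitIntegral hO (K₀ := ⊤) isOpen_univ
  have htop := coinvSub_orbitRep_eq_top J hK₁ hK₁c hO h0
  have hle : coinvSub (L.orbitRep z) ⊤ ≤ (coinvSub L.translateRep
      (L.sec (MulAction.orbit G z))).comap (L.sec (MulAction.orbit G z)).subtype := by
    refine Submodule.span_le.2 ?_
    rintro _ ⟨g, m, -, rfl⟩
    exact sub_mem_coinvSub g m.2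
  intro s hs
  exact hle (htop.ge (Submodule.mem_top (x := ⟨s, hs⟩)))

/-- The tautological cocycle sends `g` to `m ↦ [g] m` in chains modulo relations. A primitive `f` on
the support of `c` identifies the class of `c` with `f` of its boundary, which is zero. -/
theorem cyclesAreTrivial_orbit (hO : IsLocallyClosed (MulAction.orbit G z))
    (h0 : IsZero ((smoothHomology R (MulAction.stabilizer G z) 0).obj (L.twistedRep z)))
    (h1 : IsZero ((smoothHomology R (MulAction.stabilizer G z) 1).obj (L.twistedRep z)))
    {K₀ : Subgroup G} (hK₀ : IsOpen (K₀ : Set G)) :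
    CyclesAreTrivial L.translateRep K₀ (L.sec (MulAction.orbit G z)) := by
  classical
  obtain ⟨K₁, hK₁₀, hK₁, hK₁c, ⟨J⟩⟩ := L.exists_subgroup_orbitIntegral hO hK₀
  intro c hc hbc
  set W := chainRel L.translateRep K₀ (L.sec (MulAction.orbit G z)) with hW
  let D : G → L.sec (MulAction.orbit G z) →ₗ[R] (G →₀ (∀ x, L.Fiber x)) ⧸ W := fun g =>
    W.mkQ ∘ₗ Finsupp.lsingle g ∘ₗ (L.sec (MulAction.orbit G z)).subtype
  have hDdef : ∀ g m, D g m = W.mkQ (Finsupp.single g (m : ∀ x, L.Fiber x)) := fun _ _ => rfl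
  have hD : ∀ g h m, D (g * h) m = D g (L.orbitRep z h m) + D h m := by
    intro g h m
    rw [← sub_eq_zero, ← sub_sub, hDdef, hDdef, hDdef, ← map_sub, ← map_sub, Submodule.mkQ_apply,
      Submodule.Quotient.mk_eq_zero]
    exact mul_mem_chainRel K₀ g h m.2
  have hD1 : ∀ k ∈ K₁, D k = 0 := by
    intro k hk
    refine LinearMap.ext fun m => ?_
    rw [hDdef, Submodule.mkQ_apply, LinearMap.zero_apply, Submodule.Quotient.mk_eq_zero]
    exact single_mem_chainRel (hK₁₀ hk) m.2
  let c' : G →₀ L.sec (MulAction.orbit G z) :=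
    Finsupp.onFinset c.support (fun g => ⟨c g, hc g⟩) fun g hg => Finsupp.mem_support_iff.2
      fun h => hg (Subtype.ext h)
  obtain ⟨f, hf⟩ := exists_primitive J hK₁ hK₁c hO h0 h1 D hD hD1 c'
  have e1 : ∑ g ∈ c.support, (L.orbitRep z g (c' g) - c' g) = 0 := by
    refine Subtype.ext (Eq.trans ?_ hbc)
    rw [Submodule.coe_sum, boundary, Finsupp.lsum_apply]
    rfl
  have e2 : W.mkQ c = ∑ g ∈ c.support, D g (c' g) := by
    conv_lhs => rw [← Finsupp.sum_single c]
    rw [Finsupp.sum, map_sum]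
    rfl
  rw [← Submodule.Quotient.mk_eq_zero, ← Submodule.mkQ_apply, e2,
    Finset.sum_congr rfl fun g _ => (hf g).trans (map_sub f _ _).symm, ← map_sum, e1, map_zero]

end Orbits

end EquivariantLineBundle

theorem map_mem_coinvSub_range_iff {R G M V : Type*} [CommRing R] [Group G] [AddCommGroup M]
    [Module R M] [AddCommGroup V] [Module R V] {σ : Representation R G M}
    {ρ : Representation R G V} {i : M →ₗ[R] V} (hi : Function.Injective i)
    (h : ∀ g m, i (σ g m) = ρ g (i m)) (m : M) :
    i m ∈ coinvSub ρ (LinearMap.range i) ↔ Representation.Coinvariants.mk σ m = 0 := by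
  have : coinvSub ρ (LinearMap.range i) = (Representation.Coinvariants.ker σ).map i := by
    rw [coinvSub, Representation.Coinvariants.ker, Submodule.map_span]
    congr 1
    ext x
    constructor
    · rintro ⟨g, _, ⟨m, rfl⟩, rfl⟩
      exact ⟨_, ⟨(g, m), rfl⟩, by rw [map_sub, h]⟩
    · rintro ⟨_, ⟨⟨g, m⟩, rfl⟩, rfl⟩
      exact ⟨g, _, ⟨m, rfl⟩, by rw [map_sub, h]⟩
  rw [this, Representation.Coinvariants.mk_eq_zero, Submodule.mem_map]
  exact ⟨fun ⟨m', hm', e⟩ => hi e ▸ hm', fun hm => ⟨m, hm, rfl⟩⟩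

namespace EquivariantLineBundle

/-! ### Translation back to coinvariants of `𝒮(U, L)` and `𝒮(X, L)` -/

section Extension

variable {R : Type u} {G : Type v} {X : Type w} [CommRing R] [Group G]
    [TopologicalSpace G] [TopologicalSpace X] [MulAction G X] [ContinuousSMul G X] [T2Space X]
    (L : EquivariantLineBundle.{u, v, w, t} R G X)

/-- Extension by zero, as a linear map into all sections of `L`. -/
def extendLinear (U : SubMulAction G X) (hU : IsOpen (U : Set X)) :
    (L.restrict U).schwartz →ₗ[R] ∀ x, L.Fiber x :=
  L.schwartz.subtype ∘ₗ (L.extendByZero U hU).toLinearMap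

theorem range_extendLinear (U : SubMulAction G X) (hU : IsOpen (U : Set X)) :
    LinearMap.range (L.extendLinear U hU) = L.sec U := by
  ext s
  constructor
  · rintro ⟨s, rfl⟩
    refine ⟨(L.extend_mem U hU s.2).1.continuousOn, Subtype.val '' closure {x | s.1 x ≠ 0},
      fun _ ⟨x, _, e⟩ => e ▸ x.2, s.2.2.image continuous_subtype_val, fun x hx => ?_⟩
    by_cases h : x ∈ U
    · refine (L.extend_of_mem U s x h).trans ?_
      by_contra h0
      exact hx ⟨⟨x, h⟩, subset_closure h0, rfl⟩
    · exact L.extend_of_notMem U s x h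
  · rintro ⟨hs, C, hCU, hC, hsC⟩
    have hmem : (fun x : U => s x : ∀ x : U, (L.restrict U).Fiber x) ∈
        (L.restrict U).schwartz := by
      refine ⟨?_, ?_⟩
      · refine (inducing_pullbackTotalSpaceEmbedding R L.Fiber
          (Subtype.val : U → X)).continuous_iff.2 (Continuous.prodMk continuous_id ?_)
        exact hs.comp_continuous continuous_subtype_val fun x => x.2
      · have hc : IsCompact ((Subtype.val : U → X) ⁻¹' C) := by
          rw [Subtype.isCompact_iff, Set.image_preimage_eq_inter_range, Subtype.range_coe,
            Set.inter_eq_left.2 hCU]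
          exact hC
        refine hc.of_isClosed_subset isClosed_closure (closure_minimal (fun x hx => ?_)
          (hC.isClosed.preimage continuous_subtype_val))
        by_contra h
        exact hx (hsC x h)
    refine ⟨⟨_, hmem⟩, funext fun x => ?_⟩
    by_cases h : x ∈ U
    · exact L.extend_of_mem U _ x h
    · exact (L.extend_of_notMem U _ x h).trans (hsC x fun hx => h (hCU hx)).symm

theorem injective_extendLinear (U : SubMulAction G X) (hU : IsOpen (U : Set X)) :
    Function.Injective (L.extendLinear U hU) := by
  intro s s' h
  refine Subtype.ext (funext fun x => ?_)
  have := congrFun h (x : X)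
  change L.extend U s x = L.extend U s' x at this
  rwa [L.extend_of_mem U _ x x.2, L.extend_of_mem U _ x x.2] at this

theorem schwartz_mk_eq_zero_iff (s : L.schwartz) :
    Representation.Coinvariants.mk L.schwartzRep s = 0 ↔
      (s : ∀ x, L.Fiber x) ∈ coinvSub L.translateRep (L.sec Set.univ) := by
  rw [sec_univ, ← map_mem_coinvSub_range_iff (ρ := L.translateRep) L.schwartz.injective_subtype
    (fun _ _ => rfl), Submodule.range_subtype]
  rfl

theorem restrict_schwartz_mk_eq_zero_iff (U : SubMulAction G X) (hU : IsOpen (U : Set X))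
    (s : (L.restrict U).schwartz) :
    Representation.Coinvariants.mk (L.restrict U).schwartzRep s = 0 ↔
      L.extendLinear U hU s ∈ coinvSub L.translateRep (L.sec U) := by
  rw [← range_extendLinear L U hU]
  refine (map_mem_coinvSub_range_iff (L.injective_extendLinear U hU) (fun g s => ?_) s).symm
  exact congrArg (fun f => (f s : ∀ x, L.Fiber x)) ((L.extendByZero U hU).isIntertwining' g)

theorem surjective_coinvariantsMap (U : SubMulAction G X) (hU : IsOpen (U : Set X))
    (h : L.sec Set.univ ≤ L.sec U ⊔ coinvSub L.translateRep (L.sec Set.univ)) :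
    Function.Surjective (L.coinvariantsMap U hU) := by
  intro q
  obtain ⟨s, rfl⟩ := Representation.Coinvariants.mk_surjective _ q
  obtain ⟨s₁, hs₁, s₂, hs₂, e⟩ := Submodule.mem_sup.1 (h (L.sec_univ.ge s.2))
  rw [← range_extendLinear L U hU] at hs₁
  obtain ⟨s', rfl⟩ := hs₁
  refine ⟨Representation.Coinvariants.mk _ s', ?_⟩
  change Representation.Coinvariants.mk L.schwartzRep (L.extendByZero U hU s') = _
  rw [eq_comm, ← sub_eq_zero, ← map_sub, schwartz_mk_eq_zero_iff]
  rwa [show ((s - L.extendByZero U hU s' : L.schwartz) : ∀ x, L.Fiber x) = s₂ from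
    sub_eq_of_eq_add' e.symm]

theorem injective_coinvariantsMap (U : SubMulAction G X) (hU : IsOpen (U : Set X))
    (h : L.sec U ⊓ coinvSub L.translateRep (L.sec Set.univ) ≤
      coinvSub L.translateRep (L.sec U)) :
    Function.Injective (L.coinvariantsMap U hU) := by
  rw [injective_iff_map_eq_zero]
  intro q hq
  obtain ⟨s, rfl⟩ := Representation.Coinvariants.mk_surjective _ q
  change Representation.Coinvariants.mk L.schwartzRep (L.extendByZero U hU s) = 0 at hq
  rw [schwartz_mk_eq_zero_iff] at hq
  rw [restrict_schwartz_mk_eq_zero_iff L U hU]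
  exact h ⟨(L.range_extendLinear U hU).le ⟨s, rfl⟩, hq⟩

end Extension

end EquivariantLineBundle

end LSpaceCoinv

end

theorem mainTheorem4 {R : Type u} {G : Type v} {X : Type w}
    [CommRing R] [Algebra ℂ R]
    [Group G] [TopologicalSpace G] [IsTopologicalGroup G]
    [LocallyCompactSpace G] [T2Space G] [TotallyDisconnectedSpace G] [SigmaCompactSpace G]
    [TopologicalSpace X] [LocallyCompactSpace X] [T2Space X] [TotallyDisconnectedSpace X]
    [MulAction G X] [ContinuousSMul G X]
    (Z : SubMulAction G X) (hZ : IsClosed (Z : Set X))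
    (hZG : LSpaceCoinv.IsConstructibleAction G Z)
    (L : LSpaceCoinv.EquivariantLineBundle.{u, v, w, t} R G X) :
    ((∀ z ∈ Z, ∀ i ∈ ({0, 1} : Set ℕ), CategoryTheory.Limits.IsZero
        ((LSpaceCoinv.smoothHomology R (MulAction.stabilizer G z) i).obj (L.twistedRep z))) →
      Function.Bijective (L.coinvariantsMap Zᶜ hZ.isOpen_compl)) ∧
    ((∀ z ∈ Z, CategoryTheory.Limits.IsZero
        ((LSpaceCoinv.smoothHomology R (MulAction.stabilizer G z) 0).obj (L.twistedRep z))) →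
      Function.Surjective (L.coinvariantsMap Zᶜ hZ.isOpen_compl)) := by
  have horb : ∀ z ∈ Z, IsLocallyClosed (MulAction.orbit G z) := fun z hz =>
    LSpaceCoinv.isLocallyClosed_orbit hZ hZG hz
  have hsurj : (∀ z ∈ Z, CategoryTheory.Limits.IsZero
      ((LSpaceCoinv.smoothHomology R (MulAction.stabilizer G z) 0).obj (L.twistedRep z))) →
      Function.Surjective (L.coinvariantsMap Zᶜ hZ.isOpen_compl) := fun h =>
    L.surjective_coinvariantsMap _ _ (L.sec_univ_le_of_forall_orbit hZ hZG fun z hz =>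
      L.sec_orbit_le_coinvSub (horb z hz) (h z hz))
  refine ⟨fun h => ⟨?_, hsurj fun z hz => h z hz 0 (by simp)⟩, hsurj⟩
  -- Any compact open subgroup will do: it only serves to normalise chains.
  obtain ⟨K, hK, hKc, -⟩ := LSpaceCoinv.exists_compact_open_subgroup (G := G) Filter.univ_mem
  exact L.injective_coinvariantsMap _ _ (L.sec_inf_coinvSub_le_of_forall_orbit hZ hZG K hKc
    fun z hz => L.cyclesAreTrivial_orbit (horb z hz) (h z hz 0 (by simp)) (h z hz 1 (by simp)) hK)
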